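/- Conventions. For $x,y$ in a group, $x^y=y^{-1}xy$ and $[x,y]=x^{-1}y^{-1}xy$. For a group $G$, a subgroup $H$ and $a\in G$, the coset graph $\mathrm{Cos}(G,H,a)$ has as vertices the right cosets $Hg$ ($g\in G$) and as edges the pairs $\{Hg,Hag\}$ ($g\in G$); $G$ acts on it by right multiplication. $D_n$ denotes the dihedral group of order $2n$. Let $\Gamma$ be a connected graph and $G\le\mathrm{Aut}(\Gamma)$. The pair $(\Gamma,G)$ is *locally-$D_4$* if $\Gamma$ is tetravalent, $G$ is transitive on the arcs of $\Gamma$, and for each vertex $v$ the permutation group induced by the stabiliser $G_v$ on the neighbourhood of $v$ is permutation isomorphic to $D_4$ acting on $4$ points. For $N\trianglelefteq G$, the graph $\Gamma/N$ has the $N$-orbits as vertices, two distinct orbits being adjacent if they contain adjacent vertices of $\Gamma$. The pair $(\Gamma,G)$ is a *central $N$-cover* of a pair $(\Delta,K)$ with $K\le\mathrm{Aut}(\Delta)$ if $N\le Z(G)$, the projection $\Gamma\to\Gamma/N$ maps the neighbourhood of each vertex bijectively onto the neighbourhood of its image, and there are isomorphisms $\Gamma/N\cong\Delta$ and $G/N\cong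 K$ compatible with the actions. The graphs $C(r,s)$, $2\le s\le r-2$. Let $W_r$ be the graph on $\mathbb Z_r\times\mathbb Z_2$ in which $(v,i)$ is adjacent to $(v\pm1,j)$ for all $i,j$; its fibres are the sets $\{v\}\times\mathbb Z_2$. The vertices of $C(r,s)$ are the paths with $s-1$ edges in $W_r$ containing at most one vertex from each fibre; two distinct such paths are adjacent if their intersection is a path with $s-2$ edges and their union is a path with $s$ edges containing at most one vertex from each fibre. Let $$G_{r,s}=\langle x_i\ (i\in\mathbb Z_r),a,b\mid x_i^2=[x_i,x_j]=a^r=b^2=(ab)^2=1,\ x_i^a=x_{i+1},\ x_i^b=x_{r-s-1-i}\rangle\cong C_2^r\rtimes D_r.$$ It acts on $C(r,s)$ through its action on $W_r$, where $x_i$ interchanges the two vertices of the $i$-th fibre and fixes all other vertices, $(v,i)^a=(v+1,i)$ and $(v,i)^b=(r-s-1-v,i)$. The graphs $\Gamma_t^\pm$. For $t\ge2$ let $G_t^+$ and $G_t^-$ be the groups generated by $x_i$ ($i\in\mathbb Z_{2t}$), $z$, $a$, $b$ subject to $$x_i^2=z^2=[x_i,z]=1,\quad [x_i,x_j]=1\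 (j\ne i+t),\quad [x_i,x_{i+t}]=z,$$ $$b^2=1,\quad a^b=a^{-1},\quad x_i^a=x_{i+1},\quad x_i^b=x_{t-1-i},$$ together with $a^{2t}=1$ for $G_t^+$ and $a^{2t}=z$ for $G_t^-$. (The first line presents the extraspecial group $E_t$ of order $2^{2t+1}$ and plus type, and $G_t^\pm$ is an extension of $E_t$ by $D_{2t}$.) Let $H_t^\pm=\langle x_0,\dots,x_{t-1},b\rangle\le G_t^\pm$ and $\Gamma_t^\pm=\mathrm{Cos}(G_t^\pm,H_t^\pm,a)$. **Theorem.** Let $t\ge2$ and let $(\Gamma,G)$ be $(\Gamma_t^+,G_t^+)$ or $(\Gamma_t^-,G_t^-)$. Then $G$ acts faithfully on $\Gamma$ and: (i) $|V\Gamma|=t2^{t+2}$ and $|G_v|=2^{t+1}$ for every vertex $v$, and hence $|V\Gamma|=2|G_v|\log_2(|G_v|/2)$; (ii) $\langle z\rangle\cong C_2$ and $(\Gamma,G)$ is a central $\langle z\rangle$-cover of $(C(2t,t),G_{2t,t})$; (iii) $(\Gamma,G)$ is a locally-$D_4$ pair; (iv) the girth of $\Gamma$ is $4$ if $\Gamma=\Gamma_2^+$,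 is $6$ if $\Gamma=\Gamma_2^-$ or $\Gamma=\Gamma_3^+$, and is $8$ otherwise; (v) $\mathrm{Aut}(\Gamma)=G$ unless $(\Gamma,G)=(\Gamma_2^-,G_2^-)$, while $|\mathrm{Aut}(\Gamma_2^-):G_2^-|=9$. -/

import Mathlib

namespace ArcTransitive

section Pairs

/-! A pair `(Γ, G)` is given by a graph `Γ` and a homomorphism `ρ : G →* Aut Γ`; when `ρ` is
injective this is the same as a subgroup of `Aut Γ`.  Automorphisms act on the left here, so a right
action `v ↦ v ^ g` is encoded by `ρ g v = v ^ (g⁻¹)`; orbits and stabilisers are the same. -/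

/-- `G` acts transitively on the arcs (ordered pairs of adjacent vertices) of `Γ`. -/
def IsArcTransitive {V G : Type*} [Group G] {Γ : SimpleGraph V} (ρ : G →* (Γ ≃g Γ)) : Prop :=
  ∀ u v u' v' : V, Γ.Adj u v → Γ.Adj u' v' → ∃ g : G, ρ g u = u' ∧ ρ g v = v'

/-- The stabiliser `G_v`. -/
def vertexStabilizer {V G : Type*} [Group G] {Γ : SimpleGraph V} (ρ : G →* (Γ ≃g Γ)) (v : V) :
    Subgroup G where
  carrier := {g | ρ g v = v}
  one_mem' := by simp
  mul_mem' := by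
    intro g h hg hh
    simp only [Set.mem_ofPred_eq, map_mul, RelIso.mul_apply] at *
    rw [hh, hg]
  inv_mem' := by
    intro g hg
    simp only [Set.mem_ofPred_eq, map_inv] at *
    conv_lhs => rw [← hg]
    exact RelIso.inv_apply_self _ _

/-- The permutation group induced by `G_v` on the neighbourhood `Γ(v)`. -/
def localGroup {V G : Type*} [Group G] {Γ : SimpleGraph V} (ρ : G →* (Γ ≃g Γ)) (v : V) :
    Subgroup (Equiv.Perm (Γ.neighborSet v)) where
  carrier := {σ | ∃ g ∈ vertexStabilizer ρ v, ∀ u : Γ.neighborSet v, (σ u : V) = ρ g u}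
  one_mem' := ⟨1, one_mem _, by simp⟩
  mul_mem' := by
    rintro σ τ ⟨g, hg, hσ⟩ ⟨h, hh, hτ⟩
    exact ⟨g * h, mul_mem hg hh, fun u => by simp [hσ, hτ]⟩
  inv_mem' := by
    rintro σ ⟨g, hg, hσ⟩
    refine ⟨g⁻¹, inv_mem hg, fun u => ?_⟩
    have h := hσ (σ⁻¹ u)
    have h₁ : σ (σ⁻¹ u) = u := σ.apply_symm_apply u
    rw [h₁] at h
    rw [h, map_inv, RelIso.inv_apply_self]

/-- The dihedral group of order `8` as a permutation group on `4` points. -/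
def dihedralPerm : Subgroup (Equiv.Perm (ZMod 4)) :=
  Subgroup.closure {Equiv.addRight 1, Equiv.neg (ZMod 4)}

/-- `(Γ, G)` is a locally-`D₄` pair. -/
def IsLocallyD4 {V G : Type*} [Group G] {Γ : SimpleGraph V} (ρ : G →* (Γ ≃g Γ)) : Prop :=
  Function.Injective ρ ∧ Γ.Connected ∧ (∀ v, (Γ.neighborSet v).ncard = 4) ∧ IsArcTransitive ρ ∧
    ∀ v, ∃ e : Γ.neighborSet v ≃ ZMod 4,
      (localGroup ρ v).map e.permCongrHom.toMonoidHom = dihedralPerm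

/-- The orbit relation on vertices of a subgroup `N ≤ G`. -/
def orbitSetoid {V G : Type*} [Group G] {Γ : SimpleGraph V} (ρ : G →* (Γ ≃g Γ))
    (N : Subgroup G) : Setoid V where
  r u v := ∃ n ∈ N, ρ n u = v
  iseqv :=
    { refl := fun u => ⟨1, one_mem _, by simp⟩
      symm := by
        rintro u v ⟨n, hn, rfl⟩
        exact ⟨n⁻¹, inv_mem hn, by rw [map_inv, RelIso.inv_apply_self]⟩
      trans := by
        rintro u v w ⟨n, hn, rfl⟩ ⟨m, hm, rfl⟩
        exact ⟨m * n, mul_mem hm hn, by simp⟩ }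

/-- The vertex set of the normal quotient. -/
abbrev OrbitSpace {V G : Type*} [Group G] {Γ : SimpleGraph V} (ρ : G →* (Γ ≃g Γ))
    (N : Subgroup G) : Type _ := Quotient (orbitSetoid ρ N)

/-- The quotient projection `π : v ↦ v ^ N`. -/
def orbitProj {V G : Type*} [Group G] {Γ : SimpleGraph V} (ρ : G →* (Γ ≃g Γ))
    (N : Subgroup G) (v : V) : OrbitSpace ρ N := Quotient.mk (orbitSetoid ρ N) v

/-- The normal quotient graph `Γ / N`: two distinct orbits are adjacent when they contain adjacent
vertices. -/
def quotientGraph {V G : Type*} [Group G] {Γ : SimpleGraph V} (ρ : G →* (Γ ≃g Γ))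
    (N : Subgroup G) : SimpleGraph (OrbitSpace ρ N) :=
  SimpleGraph.fromRel fun p q => ∃ u v : V, orbitProj ρ N u = p ∧ orbitProj ρ N v = q ∧ Γ.Adj u v

/-- `(Γ, G)` is a central `N`-cover of the pair `(Δ, K)`: the subgroup `N` is central in `G`, the
projection `Γ → Γ / N` is locally bijective, and the pair `(Γ / N, G / N)` is isomorphic to the pair
`(Δ, K)`. -/
def IsCentralCover {V G W K : Type*} [Group G] [Group K] {Γ : SimpleGraph V}
    {Δ : SimpleGraph W} (ρ : G →* (Γ ≃g Γ)) (N : Subgroup G) (κ : K →* (Δ ≃g Δ)) : Prop :=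
  Function.Injective ρ ∧ Function.Injective κ ∧ N ≤ Subgroup.center G ∧
  (∀ v, Set.BijOn (orbitProj ρ N) (Γ.neighborSet v)
    ((quotientGraph ρ N).neighborSet (orbitProj ρ N v))) ∧
  ∃ _ : N.Normal, ∃ (φ : quotientGraph ρ N ≃g Δ) (ψ : G ⧸ N ≃* K),
    ∀ (g : G) (v : V), φ (orbitProj ρ N (ρ g v)) = κ (ψ (g : G ⧸ N)) (φ (orbitProj ρ N v))

end Pairs

section CosetGraphs

/-- The set of right cosets `H g`. -/
abbrev RightCosets {G : Type*} [Group G] (H : Subgroup G) : Type _ :=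
  Quotient (QuotientGroup.rightRel H)

/-- The right coset `H g`. -/
def rightCoset {G : Type*} [Group G] (H : Subgroup G) (g : G) : RightCosets H :=
  Quotient.mk (QuotientGroup.rightRel H) g

/-- The coset graph `Cos(G, H, a)`, with edges `{H g, H a g}`. -/
def cosetGraph {G : Type*} [Group G] (H : Subgroup G) (a : G) : SimpleGraph (RightCosets H) :=
  SimpleGraph.fromRel fun p q => ∃ g : G, p = rightCoset H g ∧ q = rightCoset H (a * g)

/-- The permutation `H x ↦ H x g⁻¹` of the right cosets. -/
def cosetPerm {G : Type*} [Group G] (H : Subgroup G) (g : G) : Equiv.Perm (RightCosets H) where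
  toFun := Quotient.map (fun x => x * g⁻¹) (by
    intro x y h
    have h' := QuotientGroup.rightRel_apply.1 h
    exact QuotientGroup.rightRel_apply.2 (by simpa [mul_assoc] using h'))
  invFun := Quotient.map (fun x => x * g) (by
    intro x y h
    have h' := QuotientGroup.rightRel_apply.1 h
    exact QuotientGroup.rightRel_apply.2 (by simpa [mul_assoc] using h'))
  left_inv := by
    rintro ⟨x⟩
    exact congrArg (rightCoset H) (by group)
  right_inv := by
    rintro ⟨x⟩
    exact congrArg (rightCoset H) (by group)

lemma cosetPerm_rightCoset {G : Type*} [Group G] (H : Subgroup G) (g x : G) :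
    cosetPerm H g (rightCoset H x) = rightCoset H (x * g⁻¹) := rfl

lemma exists_cosetPerm_iff {G : Type*} [Group G] (H : Subgroup G) (a g : G)
    (p q : RightCosets H) :
    (∃ x : G, cosetPerm H g p = rightCoset H x ∧ cosetPerm H g q = rightCoset H (a * x)) ↔
      ∃ x : G, p = rightCoset H x ∧ q = rightCoset H (a * x) := by
  constructor
  · rintro ⟨x, h₁, h₂⟩
    refine ⟨x * g, (cosetPerm H g).injective ?_, (cosetPerm H g).injective ?_⟩
    · rw [h₁, cosetPerm_rightCoset]; congr 1; group
    · rw [h₂, cosetPerm_rightCoset]; congr 1; group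
  · rintro ⟨x, rfl, rfl⟩
    refine ⟨x * g⁻¹, cosetPerm_rightCoset _ _ _, ?_⟩
    rw [cosetPerm_rightCoset, mul_assoc]

/-- The action of `G` on `Cos(G, H, a)` by right multiplication. -/
def cosetAction {G : Type*} [Group G] (H : Subgroup G) (a : G) :
    G →* (cosetGraph H a ≃g cosetGraph H a) where
  toFun g :=
    { toEquiv := cosetPerm H g
      map_rel_iff' := by
        intro p q
        simp only [cosetGraph, SimpleGraph.fromRel_adj, exists_cosetPerm_iff, ne_eq,
          EmbeddingLike.apply_eq_iff_eq] }
  map_one' := by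
    apply RelIso.ext
    rintro ⟨x⟩
    exact congrArg (rightCoset H) (by group)
  map_mul' g h := by
    apply RelIso.ext
    rintro ⟨x⟩
    exact congrArg (rightCoset H) (by group)

end CosetGraphs

section ExponentialFamily

/-- The graph `W_r`: the lexicographic product of a cycle of length `r` with an edgeless graph on
two vertices.  The fibres are the fibres of the first projection. -/
def wreathGraph (r : ℕ) : SimpleGraph (ZMod r × ZMod 2) :=
  SimpleGraph.fromRel fun p q => q.1 = p.1 + 1

/-- `P` is an `n`-path (a path with `n` edges) of `W_r`. -/
def IsNPath {r : ℕ} (n : ℕ) (P : (wreathGraph r).Subgraph) : Prop :=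
  ∃ (u v : ZMod r × ZMod 2) (p : (wreathGraph r).Walk u v),
    p.IsPath ∧ p.length = n ∧ p.toSubgraph = P

/-- `P` is an `n`-path of `W_r` containing at most one vertex from each fibre. -/
def IsTransversalPath {r : ℕ} (n : ℕ) (P : (wreathGraph r).Subgraph) : Prop :=
  IsNPath n P ∧ Set.InjOn Prod.fst P.verts

/-- The vertices of `C(r, s)` for `2 ≤ s ≤ r - 2`: the `(s-1)`-paths of `W_r` containing at most one
vertex from each fibre. -/
abbrev CVertex (r s : ℕ) : Type := {P : (wreathGraph r).Subgraph // IsTransversalPath (s - 1) P}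

/-- The graph `C(r, s)` for `2 ≤ s ≤ r - 2`: two distinct paths are adjacent when their intersection
is an `(s-2)`-path and their union is an `s`-path containing at most one vertex from each fibre. -/
def CGraph (r s : ℕ) : SimpleGraph (CVertex r s) where
  Adj P Q := P ≠ Q ∧ IsNPath (s - 2) (P.1 ⊓ Q.1) ∧ IsTransversalPath s (P.1 ⊔ Q.1)
  symm := ⟨fun P Q h => ⟨h.1.symm, inf_comm P.1 Q.1 ▸ h.2.1, sup_comm P.1 Q.1 ▸ h.2.2⟩⟩
  loopless := ⟨fun _ h => h.1 rfl⟩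

/-- The group of automorphisms of `W_r` that permute the fibres. -/
def fibreAut (r : ℕ) : Subgroup (wreathGraph r ≃g wreathGraph r) where
  carrier := {f | ∀ p q, (f p).1 = (f q).1 ↔ p.1 = q.1}
  one_mem' := fun p q => Iff.rfl
  mul_mem' := by
    intro f g hf hg p q
    rw [RelIso.mul_apply, RelIso.mul_apply, hf, hg]
  inv_mem' := by
    intro f hf p q
    rw [← hf, RelIso.apply_inv_self, RelIso.apply_inv_self]

/-- The image of a subgraph of `W_r` under an automorphism. -/
def mapSub {r : ℕ} (f : wreathGraph r ≃g wreathGraph r) (P : (wreathGraph r).Subgraph) :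
    (wreathGraph r).Subgraph := P.map f.toHom

lemma mapSub_one {r : ℕ} (P : (wreathGraph r).Subgraph) : mapSub 1 P = P :=
  SimpleGraph.Subgraph.map_id P

lemma mapSub_mul {r : ℕ} (f g : wreathGraph r ≃g wreathGraph r) (P : (wreathGraph r).Subgraph) :
    mapSub (f * g) P = mapSub f (mapSub g P) :=
  SimpleGraph.Subgraph.map_comp P g.toHom f.toHom

lemma mapSub_sup {r : ℕ} (f : wreathGraph r ≃g wreathGraph r) (P Q : (wreathGraph r).Subgraph) :
    mapSub f (P ⊔ Q) = mapSub f P ⊔ mapSub f Q :=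
  SimpleGraph.Subgraph.map_sup _ _ _

lemma mapSub_mono {r : ℕ} (f : wreathGraph r ≃g wreathGraph r) {P Q : (wreathGraph r).Subgraph}
    (h : P ≤ Q) : mapSub f P ≤ mapSub f Q := SimpleGraph.Subgraph.map_mono h

lemma mapSub_inf {r : ℕ} (f : wreathGraph r ≃g wreathGraph r) (P Q : (wreathGraph r).Subgraph) :
    mapSub f (P ⊓ Q) = mapSub f P ⊓ mapSub f Q := by
  apply le_antisymm
  · exact le_inf (mapSub_mono f inf_le_left) (mapSub_mono f inf_le_right)
  · have h : mapSub f⁻¹ (mapSub f P ⊓ mapSub f Q) ≤ P ⊓ Q := by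
      refine le_inf ?_ ?_
      · refine (mapSub_mono f⁻¹ inf_le_left).trans ?_
        rw [← mapSub_mul, inv_mul_cancel, mapSub_one]
      · refine (mapSub_mono f⁻¹ inf_le_right).trans ?_
        rw [← mapSub_mul, inv_mul_cancel, mapSub_one]
    have h' := mapSub_mono f h
    rwa [← mapSub_mul, mul_inv_cancel, mapSub_one] at h'

lemma IsNPath.mapSub {r n : ℕ} {P : (wreathGraph r).Subgraph} (h : IsNPath n P)
    (f : wreathGraph r ≃g wreathGraph r) : IsNPath n (mapSub f P) := by
  obtain ⟨u, v, p, hp, hl, rfl⟩ := h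
  refine ⟨_, _, p.map f.toHom, ?_, ?_, ?_⟩
  · exact hp.map f.injective
  · rw [SimpleGraph.Walk.length_map, hl]
  · exact SimpleGraph.Walk.toSubgraph_map _ _

lemma IsTransversalPath.mapSub {r n : ℕ} {P : (wreathGraph r).Subgraph}
    (h : IsTransversalPath n P) (f : fibreAut r) : IsTransversalPath n (mapSub f.1 P) := by
  refine ⟨h.1.mapSub f.1, ?_⟩
  rintro _ ⟨p, hp, rfl⟩ _ ⟨q, hq, rfl⟩ hpq
  exact congrArg f.1 (h.2 hp hq ((f.2 p q).1 hpq))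

lemma isNPath_mapSub_iff {r n : ℕ} {P : (wreathGraph r).Subgraph}
    (f : wreathGraph r ≃g wreathGraph r) : IsNPath n (mapSub f P) ↔ IsNPath n P := by
  refine ⟨fun h => ?_, fun h => h.mapSub f⟩
  have h' := h.mapSub f⁻¹
  rwa [← mapSub_mul, inv_mul_cancel, mapSub_one] at h'

lemma isTransversalPath_mapSub_iff {r n : ℕ} {P : (wreathGraph r).Subgraph} (f : fibreAut r) :
    IsTransversalPath n (mapSub f.1 P) ↔ IsTransversalPath n P := by
  refine ⟨fun h => ?_, fun h => h.mapSub f⟩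
  have h' := h.mapSub f⁻¹
  rwa [← mapSub_mul, ← Subgroup.coe_mul, inv_mul_cancel, Subgroup.coe_one, mapSub_one] at h'

/-- Fibre-permuting automorphisms of `W_r` act on `C(r, s)` by mapping paths to paths. -/
def pathAction (r s : ℕ) : fibreAut r →* (CGraph r s ≃g CGraph r s) where
  toFun f :=
    { toFun := fun P => ⟨mapSub f.1 P.1, P.2.mapSub f⟩
      invFun := fun P => ⟨mapSub (f⁻¹).1 P.1, P.2.mapSub f⁻¹⟩
      left_inv := fun P => Subtype.ext (by
        change mapSub (f⁻¹).1 (mapSub f.1 P.1) = P.1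
        rw [← mapSub_mul, ← Subgroup.coe_mul, inv_mul_cancel, Subgroup.coe_one, mapSub_one])
      right_inv := fun P => Subtype.ext (by
        change mapSub f.1 (mapSub (f⁻¹).1 P.1) = P.1
        rw [← mapSub_mul, ← Subgroup.coe_mul, mul_inv_cancel, Subgroup.coe_one, mapSub_one])
      map_rel_iff' := by
        intro P Q
        change (_ ≠ _ ∧ IsNPath (s - 2) (mapSub f.1 P.1 ⊓ mapSub f.1 Q.1) ∧
          IsTransversalPath s (mapSub f.1 P.1 ⊔ mapSub f.1 Q.1)) ↔ _
        rw [← mapSub_inf, ← mapSub_sup, isNPath_mapSub_iff, isTransversalPath_mapSub_iff]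
        refine and_congr_left fun _ => not_congr (EmbeddingLike.apply_eq_iff_eq _) }
  map_one' := RelIso.ext fun P => Subtype.ext (mapSub_one P.1)
  map_mul' f g := RelIso.ext fun P => Subtype.ext (mapSub_mul f.1 g.1 P.1)

/-- `x_i` interchanges the two vertices of the `i`-th fibre. -/
def xAut (r : ℕ) (i : ZMod r) : fibreAut r :=
  ⟨{ toFun := fun p => (p.1, if p.1 = i then p.2 + 1 else p.2)
     invFun := fun p => (p.1, if p.1 = i then p.2 + 1 else p.2)
     left_inv := by
       rintro ⟨v, j⟩
       by_cases h : v = i <;> simp [h, add_assoc, CharTwo.add_self_eq_zero]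
     right_inv := by
       rintro ⟨v, j⟩
       by_cases h : v = i <;> simp [h, add_assoc, CharTwo.add_self_eq_zero]
     map_rel_iff' := by
       rintro ⟨v, j⟩ ⟨w, k⟩
       by_cases hvw : v = w
       · subst hvw
         by_cases h : v = i <;> simp [wreathGraph, h]
       · simp [wreathGraph, hvw] },
   fun p q => Iff.rfl⟩

/-- The shift by `-1` on the fibres, which is the inverse of `a : (v, i) ↦ (v + 1, i)`; the inverse
appears because right actions are encoded as left actions. -/
def aAut (r : ℕ) : fibreAut r :=
  ⟨{ toFun := fun p => (p.1 - 1, p.2)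
     invFun := fun p => (p.1 + 1, p.2)
     left_inv := by rintro ⟨v, j⟩; simp
     right_inv := by rintro ⟨v, j⟩; simp
     map_rel_iff' := by
       rintro ⟨v, j⟩ ⟨w, k⟩
       simp [wreathGraph, sub_eq_iff_eq_add] },
   fun p q => by simp⟩

/-- The reflection `(v, i) ↦ (r - s - 1 - v, i)`. -/
def bAut (r s : ℕ) : fibreAut r :=
  ⟨{ toFun := fun p => ((r : ZMod r) - s - 1 - p.1, p.2)
     invFun := fun p => ((r : ZMod r) - s - 1 - p.1, p.2)
     left_inv := by rintro ⟨v, j⟩; simp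
     right_inv := by rintro ⟨v, j⟩; simp
     map_rel_iff' := by
       rintro ⟨v, j⟩ ⟨w, k⟩
       have h : ∀ c x y : ZMod r, c - x = c - y + 1 ↔ y = x + 1 := fun c x y => by
         constructor <;> intro h <;> linear_combination h
       simp only [wreathGraph, SimpleGraph.fromRel_adj, Equiv.coe_fn_mk, h, ne_eq,
         Prod.mk.injEq, sub_right_inj]
       tauto },
   fun p q => by simp⟩

/-- Generator symbols for `G_{r,s}`. -/
inductive QuotGen (r : ℕ) : Type
  | x (i : ZMod r)
  | a
  | b

/-- The defining relators of `G_{r,s} = C_2^r ⋊ D_r`. -/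
def quotRels (r s : ℕ) : Set (FreeGroup (QuotGen r)) :=
  let x : ZMod r → FreeGroup (QuotGen r) := fun i => FreeGroup.of (.x i)
  let a : FreeGroup (QuotGen r) := FreeGroup.of .a
  let b : FreeGroup (QuotGen r) := FreeGroup.of .b
  {w | (∃ i, w = x i ^ 2) ∨ (∃ i j, w = (x i)⁻¹ * (x j)⁻¹ * x i * x j) ∨
    w = a ^ r ∨ w = b ^ 2 ∨ w = (a * b) ^ 2 ∨
    (∃ i, w = (a⁻¹ * x i * a) * (x (i + 1))⁻¹) ∨
    (∃ i, w = (b⁻¹ * x i * b) * (x ((r : ZMod r) - s - 1 - i))⁻¹)}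

/-- The group `G_{r,s}`. -/
abbrev QuotGroup (r s : ℕ) : Type := PresentedGroup (quotRels r s)

/-- The action of the generators of `G_{r,s}` on `W_r`. -/
def quotGenAut (r s : ℕ) : QuotGen r → fibreAut r
  | .x i => xAut r i
  | .a => aAut r
  | .b => bAut r s

lemma fibreAut_ext {r : ℕ} {f g : fibreAut r} (h : ∀ p, f.1 p = g.1 p) : f = g :=
  Subtype.ext (RelIso.ext h)

lemma xAut_apply (r : ℕ) (i : ZMod r) (p : ZMod r × ZMod 2) :
    (xAut r i).1 p = (p.1, if p.1 = i then p.2 + 1 else p.2) := rfl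

lemma aAut_apply (r : ℕ) (p : ZMod r × ZMod 2) : (aAut r).1 p = (p.1 - 1, p.2) := rfl

lemma bAut_apply (r s : ℕ) (p : ZMod r × ZMod 2) :
    (bAut r s).1 p = ((r : ZMod r) - s - 1 - p.1, p.2) := rfl

lemma fibreAut_mul_apply {r : ℕ} (f g : fibreAut r) (p : ZMod r × ZMod 2) :
    (f * g).1 p = f.1 (g.1 p) := rfl

lemma aAut_pow_apply (r n : ℕ) (p : ZMod r × ZMod 2) :
    ((aAut r) ^ n).1 p = (p.1 - n, p.2) := by
  induction n with
  | zero => simp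
  | succ n ih =>
    rw [pow_succ', fibreAut_mul_apply, ih, aAut_apply]
    push_cast
    rw [sub_sub]

lemma quotGenAut_rels (r s : ℕ) :
    ∀ w ∈ quotRels r s, FreeGroup.lift (quotGenAut r s) w = 1 := by
  rintro w (⟨i, rfl⟩ | ⟨i, j, rfl⟩ | rfl | rfl | rfl | ⟨i, rfl⟩ | ⟨i, rfl⟩) <;>
    simp only [map_pow, map_mul, map_inv, FreeGroup.lift_apply_of,
      quotGenAut]
  · refine fibreAut_ext fun ⟨v, k⟩ => ?_
    rw [pow_two, fibreAut_mul_apply, xAut_apply, xAut_apply]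
    by_cases h : v = i <;> simp [h, add_assoc, CharTwo.add_self_eq_zero]
  · rw [mul_assoc, mul_assoc, inv_mul_eq_iff_eq_mul, mul_one, inv_mul_eq_iff_eq_mul]
    refine fibreAut_ext fun ⟨v, k⟩ => ?_
    simp only [fibreAut_mul_apply, xAut_apply]
    split_ifs <;> rfl
  · refine fibreAut_ext fun ⟨v, k⟩ => ?_
    rw [aAut_pow_apply]
    simp
  · refine fibreAut_ext fun ⟨v, k⟩ => ?_
    rw [pow_two, fibreAut_mul_apply, bAut_apply, bAut_apply]
    simp
  · refine fibreAut_ext fun ⟨v, k⟩ => ?_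
    rw [pow_two]
    simp only [fibreAut_mul_apply, bAut_apply, aAut_apply]
    refine Prod.ext ?_ rfl
    change _ = v
    ring
  · rw [mul_inv_eq_one, mul_assoc, inv_mul_eq_iff_eq_mul]
    refine fibreAut_ext fun ⟨v, k⟩ => ?_
    simp only [fibreAut_mul_apply, xAut_apply, aAut_apply, sub_eq_iff_eq_add]
  · rw [mul_inv_eq_one, mul_assoc, inv_mul_eq_iff_eq_mul]
    refine fibreAut_ext fun ⟨v, k⟩ => ?_
    simp only [fibreAut_mul_apply, xAut_apply, bAut_apply]
    have h : ((r : ZMod r) - s - 1 - v = i) ↔ v = (r : ZMod r) - s - 1 - i := by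
      constructor <;> intro h <;> linear_combination -h
    simp only [h]

/-- The action of `G_{r,s}` on `C(r, s)`. -/
def quotAction (r s : ℕ) : QuotGroup r s →* (CGraph r s ≃g CGraph r s) :=
  (pathAction r s).comp (PresentedGroup.toGroup (quotGenAut_rels r s))

end ExponentialFamily

section ExtraspecialFamily

/-- The sign in `G_t^±`. -/
inductive Sgn : Type
  | plus
  | minus

/-- Generator symbols for `G_t^±`. -/
inductive ExtGen (t : ℕ) : Type
  | x (i : ZMod (2 * t))
  | z
  | a
  | b

/-- The relators of the extraspecial group `E_t` of order `2^(2t+1)` and plus type. -/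
def extraspecialRels (t : ℕ) : Set (FreeGroup (ExtGen t)) :=
  let x : ZMod (2 * t) → FreeGroup (ExtGen t) := fun i => FreeGroup.of (.x i)
  let z : FreeGroup (ExtGen t) := FreeGroup.of .z
  {w | (∃ i, w = x i ^ 2) ∨ w = z ^ 2 ∨ (∃ i, w = (x i)⁻¹ * z⁻¹ * x i * z) ∨
    (∃ i j, j ≠ i + (t : ZMod (2 * t)) ∧ w = (x i)⁻¹ * (x j)⁻¹ * x i * x j) ∨
    (∃ i j, j = i + (t : ZMod (2 * t)) ∧
      w = ((x i)⁻¹ * (x j)⁻¹ * x i * x j) * z⁻¹)}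

/-- The relators for `a` and `b`: those of the dihedral group `D_{2t}` of order `4t` in the case of
`G_t^+`, and those with `a ^ (2t) = 1` replaced by `a ^ (2t) = z` in the case of `G_t^-`. -/
def dihedralRels (t : ℕ) (ε : Sgn) : Set (FreeGroup (ExtGen t)) :=
  let z : FreeGroup (ExtGen t) := FreeGroup.of .z
  let a : FreeGroup (ExtGen t) := FreeGroup.of .a
  let b : FreeGroup (ExtGen t) := FreeGroup.of .b
  {w | (match ε with
      | .plus => w = a ^ (2 * t)
      | .minus => w = a ^ (2 * t) * z⁻¹) ∨
    w = b ^ 2 ∨ w = (b⁻¹ * a * b) * a}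

/-- The relators for the action of `a` and `b` on `E_t`: `x_i^a = x_{i+1}`, `x_i^b = x_{t-1-i}`. -/
def actionRels (t : ℕ) : Set (FreeGroup (ExtGen t)) :=
  let x : ZMod (2 * t) → FreeGroup (ExtGen t) := fun i => FreeGroup.of (.x i)
  let a : FreeGroup (ExtGen t) := FreeGroup.of .a
  let b : FreeGroup (ExtGen t) := FreeGroup.of .b
  {w | (∃ i, w = (a⁻¹ * x i * a) * (x (i + 1))⁻¹) ∨
    (∃ i, w = (b⁻¹ * x i * b) * (x ((t : ZMod (2 * t)) - 1 - i))⁻¹)}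

/-- The extension `G_t^±` of `E_t` by `D_{2t}`. -/
abbrev ExtGroup (t : ℕ) (ε : Sgn) : Type :=
  PresentedGroup (extraspecialRels t ∪ dihedralRels t ε ∪ actionRels t)

/-- The image of a generator symbol in `G_t^±`. -/
def gen {t : ℕ} (ε : Sgn) (g : ExtGen t) : ExtGroup t ε := PresentedGroup.of g

/-- The subgroup `H_t^± = ⟨x_0, …, x_{t-1}, b⟩`. -/
def ExtH (t : ℕ) (ε : Sgn) : Subgroup (ExtGroup t ε) :=
  Subgroup.closure
    ({h | ∃ i : ℕ, i < t ∧ h = gen ε (.x (i : ZMod (2 * t)))} ∪ {gen ε .b})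

/-- The graph `Γ_t^± = Cos(G_t^±, H_t^±, a)`. -/
abbrev ExtGraph (t : ℕ) (ε : Sgn) : SimpleGraph (RightCosets (ExtH t ε)) :=
  cosetGraph (ExtH t ε) (gen ε .a)

/-- The action of `G_t^±` on `Γ_t^±`. -/
abbrev extAction (t : ℕ) (ε : Sgn) : ExtGroup t ε →* (ExtGraph t ε ≃g ExtGraph t ε) :=
  cosetAction (ExtH t ε) (gen ε .a)

end ExtraspecialFamily

end ArcTransitive

set_option linter.unusedSectionVars false

/-! The graph is replaced by an explicit model. A vertex is a pair `(κ, y)`: a phase `κ` in an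
abelian group `A` of order `4t` that stands for `⟨a, z⟩`, and `t` bits `y` indexed by `ZMod t`. The
image of `κ` in `ZMod (2t)` is the level. An edge climbs from level `k` to level `k + 1`; it may
rewrite only the bit at `k` modulo `t`, and the phase grows by `α` plus the twist `τ (old bit * new
bit)`. At level `k` the generators `x_i` with `i` in the window `k + t, …, k + 2t - 1` flip a bit,
while the other `t` of them add a bit to the phase, as in the monomial representation of an
extraspecial group. The twist is what makes this action preserve edges (`up_xFun`).

The defining relations hold in the model, so `G` acts on it. A normal form in `G` shows that the
stabiliser of the base vertex is exactly `H` and that the action is faithful (`action_base_iff`,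
`action_injective`). Hence the coset graph is the model (`cosetIso`), and the orders and the local
action can be read off. Forgetting the phase modulo `⟨z⟩` leaves a level and `t` bits, that is, a
path through `t` consecutive fibres of `W_{2t}`; this is the covering of `C(2t, t)` (`toArc`,
`isCentralCover`).

For the girth, levels have a parity, so cycles are even. Between two consecutive levels the 4-cycles
of `C(2t, t)` carry a nontrivial total twist and unwind to 8-cycles, so the girth is at most 8. A
closed walk of length below `2t` climbs as often as it descends, and a shorter cycle would have to
turn at a gap between levels where bits force it to backtrack. Shorter cycles exist only for small
`t`, where they wind once round the levels.

For the automorphism group, the neighbours of a vertex form two sides, upper and lower. An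
automorphism that respects all sides belongs to `G` (`exists_of_preserves_side`): up to `b` it
preserves the orientation, up to `G` it fixes the base vertex and so all levels, it then acts on
each of the `2t` fibres by a constant flip, and what remains is a power of `z`. Sides are recognised
for `t ≥ 5` by the 3-arcs that extend to octagons, and for smaller `t` by numbers of walks. They are
not invariant in `Γ_2^-`; there an automorphism induces one of three pairings of the neighbours at
each of two adjacent vertices, these determine its coset modulo `G_2^-`, and all nine combinations
occur. -/

namespace ArcTransitive

/-! ### Residues modulo `2t` and `t`, and the two halves of `ZMod (2t)`. -/

section Arithmetic

variable {t : ℕ}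

instance neZero_of_two_le [h : Fact (2 ≤ t)] : NeZero t := ⟨by have := h.out; omega⟩

instance neZero_two_mul [h : Fact (2 ≤ t)] : NeZero (2 * t) := ⟨by have := h.out; omega⟩

lemma zmod_two_cases (c : ZMod 2) : c = 0 ∨ c = 1 := by
  revert c; decide

/-- Reduction of levels modulo `t`. -/
def red (t : ℕ) : ZMod (2 * t) →+* ZMod t := ZMod.castHom (Dvd.intro_left 2 rfl) (ZMod t)

lemma red_natCast (t n : ℕ) : red t (n : ZMod (2 * t)) = n := map_natCast _ _

lemma red_t (t : ℕ) : red t (t : ZMod (2 * t)) = 0 := by rw [red_natCast, ZMod.natCast_self]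

lemma t_add_t (t : ℕ) : (t : ZMod (2 * t)) + t = 0 := by
  have h : ((2 * t : ℕ) : ZMod (2 * t)) = 0 := ZMod.natCast_self _
  push_cast at h
  linear_combination h

variable [hF : Fact (2 ≤ t)]

/-- The two halves of `ZMod (2 * t)`: `0` on the residues of `0, …, t - 1` and `1` elsewhere. -/
def half (d : ZMod (2 * t)) : ZMod 2 := if d.val < t then 0 else 1

lemma half_natCast_of_lt {n : ℕ} (h : n < t) : half (n : ZMod (2 * t)) = 0 := by
  rw [half, ZMod.val_natCast, Nat.mod_eq_of_lt (by omega), if_pos h]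

lemma half_natCast_of_le {n : ℕ} (h : t ≤ n) (h' : n < 2 * t) :
    half (n : ZMod (2 * t)) = 1 := by
  rw [half, ZMod.val_natCast, Nat.mod_eq_of_lt h', if_neg (by omega)]

lemma exists_natCast (d : ZMod (2 * t)) : ∃ n : ℕ, n < 2 * t ∧ d = n :=
  ⟨d.val, ZMod.val_lt d, (ZMod.natCast_zmod_val d).symm⟩

/-- Exchanging the halves under translation by `t` is the reason why `x_i` flips a bit exactly on
those levels where `x_{i+t}` changes the phase. -/
lemma half_add_t (d : ZMod (2 * t)) : half (d + (t : ZMod (2 * t))) = half d + 1 := by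
  obtain ⟨n, hn, rfl⟩ := exists_natCast d
  by_cases h : n < t
  · rw [half_natCast_of_lt h, ← Nat.cast_add, half_natCast_of_le (by omega) (by omega)]; rfl
  · obtain ⟨m, rfl⟩ := Nat.exists_eq_add_of_le (not_lt.1 h)
    rw [half_natCast_of_le (by omega) hn]
    have : ((t + m : ℕ) : ZMod (2 * t)) + t = m := by
      push_cast; linear_combination t_add_t t
    rw [this, half_natCast_of_lt (by omega)]; rfl

lemma red_eq_zero_iff (d : ZMod (2 * t)) : red t d = 0 ↔ d = 0 ∨ d = t := by
  constructor
  · obtain ⟨n, hn, rfl⟩ := exists_natCast d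
    rw [red_natCast, ZMod.natCast_eq_zero_iff]
    rintro ⟨c, rfl⟩
    have : c < 2 := by
      by_contra hc
      have := Nat.mul_le_mul_left t (not_lt.1 hc)
      omega
    interval_cases c <;> simp
  · rintro (rfl | rfl)
    · exact map_zero _
    · exact red_t t

lemma half_zero : half (0 : ZMod (2 * t)) = 0 := by
  have := half_natCast_of_lt (t := t) (n := 0) (by have := hF.out; omega)
  simpa using this

lemma half_t : half (t : ZMod (2 * t)) = 1 := by
  have := half_add_t (0 : ZMod (2 * t))
  rw [zero_add, half_zero] at this
  exact this

lemma half_neg_one : half (-1 : ZMod (2 * t)) = 1 := by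
  have h : (-1 : ZMod (2 * t)) = (2 * t - 1 : ℕ) := by
    have := hF.out
    rw [Nat.cast_sub (by omega), ZMod.natCast_self]; simp
  rw [h]
  exact half_natCast_of_le (by have := hF.out; omega) (by have := hF.out; omega)

/-- The halves meet only at the multiples of `t`. So a step of one level changes whether the fibre
`i` is visible only at levels congruent to `i` modulo `t`. -/
lemma half_sub_one_of_ne {d : ZMod (2 * t)} (h : red t d ≠ 0) : half (d - 1) = half d := by
  obtain ⟨n, hn, rfl⟩ := exists_natCast d
  have h0 : n ≠ 0 := by rintro rfl; simp at h
  have ht : n ≠ t := by rintro rfl; exact h (red_t _)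
  obtain ⟨m, rfl⟩ := Nat.exists_eq_succ_of_ne_zero h0
  have : ((m + 1 : ℕ) : ZMod (2 * t)) - 1 = m := by push_cast; ring
  rw [Nat.succ_eq_add_one, this]
  by_cases h1 : m + 1 < t
  · rw [half_natCast_of_lt h1, half_natCast_of_lt (by omega)]
  · rw [half_natCast_of_le (by omega) (by omega), half_natCast_of_le (by omega) (by omega)]

lemma half_sub_one_of_eq {d : ZMod (2 * t)} (h : red t d = 0) : half (d - 1) = half d + 1 := by
  rcases (red_eq_zero_iff d).1 h with rfl | rfl
  · rw [zero_sub, half_neg_one, half_zero]; rfl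
  · rw [half_t]
    have : ((t : ZMod (2 * t)) - 1) = (t - 1 : ℕ) := by
      have := hF.out
      rw [Nat.cast_sub (by omega)]; simp
    rw [this, half_natCast_of_lt (by have := hF.out; omega)]; rfl

/-- The reflection maps `0, …, t - 1` onto itself. Since `b` acts on indices in this way, it
respects visibility. -/
lemma half_t_sub_one_sub (d : ZMod (2 * t)) : half ((t : ZMod (2 * t)) - 1 - d) = half d := by
  obtain ⟨n, hn, rfl⟩ := exists_natCast d
  have ht := hF.out
  by_cases h : n < t
  · have : (t : ZMod (2 * t)) - 1 - n = (t - 1 - n : ℕ) := by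
      rw [Nat.cast_sub (by omega), Nat.cast_sub (by omega)]; simp
    rw [this, half_natCast_of_lt h, half_natCast_of_lt (by omega)]
  · obtain ⟨m, rfl⟩ := Nat.exists_eq_add_of_le (not_lt.1 h)
    have : (t : ZMod (2 * t)) - 1 - (t + m : ℕ) = (2 * t - 1 - m : ℕ) := by
      rw [Nat.cast_sub (by omega), Nat.cast_sub (by omega), ZMod.natCast_self]; push_cast; ring
    rw [this, half_natCast_of_le (by omega) hn, half_natCast_of_le (by omega) (by omega)]

lemma one_ne_neg_one : (1 : ZMod (2 * t)) ≠ -1 := by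
  intro h
  have h2 : ((2 : ℕ) : ZMod (2 * t)) = 0 := by push_cast; linear_combination h
  rw [ZMod.natCast_eq_zero_iff] at h2
  have := Nat.le_of_dvd (by norm_num) h2
  have := hF.out
  omega

lemma one_ne_zero_level : (1 : ZMod (2 * t)) ≠ 0 := by
  intro h
  have h2 : ((1 : ℕ) : ZMod (2 * t)) = 0 := by push_cast; exact h
  rw [ZMod.natCast_eq_zero_iff] at h2
  have := Nat.le_of_dvd (by norm_num) h2
  have := hF.out
  omega

end Arithmetic

/-! ### The explicit model and the automorphisms attached to the generators. -/

/-- The exponent of `z` in the relation for `a ^ (2 * t)`. -/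
def Sgn.exponent : Sgn → ZMod 2
  | .plus => 0
  | .minus => 1

/-- An abstract copy of the abelian group `⟨a, z⟩` of order `4 t` in `G_t^±`. -/
structure PhaseGroup (t : ℕ) (ε : Sgn) (A : Type) [AddCommGroup A] where
  /-- The image of `a`. -/
  α : A
  /-- The inclusion of `⟨z⟩`. -/
  τ : ZMod 2 →+ A
  /-- The reduction modulo `⟨z⟩`. -/
  π : A →+ ZMod (2 * t)
  π_α : π α = 1
  π_τ : ∀ c, π (τ c) = 0
  exists_of_π_eq_zero : ∀ κ, π κ = 0 → ∃ c, κ = τ c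
  τ_injective : Function.Injective τ
  nsmul_α : (2 * t) • α = τ ε.exponent

namespace PhaseGroup

variable {t : ℕ} {ε : Sgn} {A : Type} [AddCommGroup A] (D : PhaseGroup t ε A)

/-- The level of a phase modulo `t`. -/
def res (κ : A) : ZMod t := red t (D.π κ)

/-- `Up u v`: there is an edge from `u` to `v`, which lies one level higher. -/
def Up (u v : A × (ZMod t → ZMod 2)) : Prop :=
  v.1 = u.1 + D.α + D.τ (u.2 (D.res u.1) * v.2 (D.res u.1)) ∧
    ∀ j, j ≠ D.res u.1 → v.2 j = u.2 j

/-- The explicit model of the graph `Γ_t^±`. -/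
def graph : SimpleGraph (A × (ZMod t → ZMod 2)) := SimpleGraph.fromRel D.Up

lemma π_of_up {u v : A × (ZMod t → ZMod 2)} (h : D.Up u v) : D.π v.1 = D.π u.1 + 1 := by
  rw [h.1, map_add, map_add, D.π_α, D.π_τ, add_zero]

lemma res_of_up {u v : A × (ZMod t → ZMod 2)} (h : D.Up u v) : D.res v.1 = D.res u.1 + 1 := by
  rw [res, D.π_of_up h, map_add, map_one, res]

variable [hF : Fact (2 ≤ t)]

lemma ne_of_up {u v : A × (ZMod t → ZMod 2)} (h : D.Up u v) : u ≠ v := by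
  rintro rfl
  have := D.π_of_up h
  exact one_ne_zero_level (t := t) (by linear_combination -this)

lemma not_up_of_up {u v : A × (ZMod t → ZMod 2)} (h : D.Up u v) : ¬ D.Up v u := by
  intro h'
  have h1 := D.π_of_up h
  have h2 := D.π_of_up h'
  exact one_ne_neg_one (t := t) (by linear_combination - h1 - h2)

lemma adj_iff {u v : A × (ZMod t → ZMod 2)} : D.graph.Adj u v ↔ D.Up u v ∨ D.Up v u := by
  rw [graph, SimpleGraph.fromRel_adj]
  refine ⟨fun h => h.2, fun h => ⟨?_, h⟩⟩
  rcases h with h | h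
  · exact D.ne_of_up h
  · exact (D.ne_of_up h).symm

/-- Adding phases in `⟨z⟩` depends only on their sum. -/
lemma τ_mul_self (c : ZMod 2) : D.τ c + D.τ c = 0 := by
  rw [← map_add, CharTwo.add_self_eq_zero, map_zero]

/-- An automorphism of the model from a permutation preserving `Up` along with its inverse. -/
def autOfUp (f : Equiv.Perm (A × (ZMod t → ZMod 2)))
    (h : ∀ u v, D.Up (f u) (f v) ↔ D.Up u v) : D.graph ≃g D.graph where
  toEquiv := f
  map_rel_iff' := by
    intro u v
    rw [D.adj_iff, D.adj_iff, h, h]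

/-- An automorphism of the model from a permutation reversing `Up`. -/
def autOfDown (f : Equiv.Perm (A × (ZMod t → ZMod 2)))
    (h : ∀ u v, D.Up (f u) (f v) ↔ D.Up v u) : D.graph ≃g D.graph where
  toEquiv := f
  map_rel_iff' := by
    intro u v
    rw [D.adj_iff, D.adj_iff, h, h, or_comm]

/-- The action of `x_i`: a change of phase or of the bit at `i`, according to the level. -/
def xFun (i : ZMod (2 * t)) (v : A × (ZMod t → ZMod 2)) : A × (ZMod t → ZMod 2) :=
  (v.1 + D.τ ((1 + half (i - D.π v.1)) * v.2 (red t i)),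
    v.2 + Pi.single (red t i) (half (i - D.π v.1)))

lemma π_xFun (i : ZMod (2 * t)) (v : A × (ZMod t → ZMod 2)) :
    D.π (D.xFun i v).1 = D.π v.1 := by
  rw [xFun, map_add, D.π_τ, add_zero]

lemma xFun_xFun (i : ZMod (2 * t)) (v : A × (ZMod t → ZMod 2)) :
    D.xFun i (D.xFun i v) = v := by
  have h := D.π_xFun i v
  rw [xFun, h]
  refine Prod.ext ?_ ?_
  · simp only [xFun, Pi.add_apply, Pi.single_eq_same, add_assoc, ← map_add]
    generalize half (i - D.π v.1) = f
    generalize v.2 (red t i) = y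
    rw [show (1 + f) * y + (1 + f) * (y + f) = 0 by revert f y; decide, map_zero, add_zero]
  · funext j
    simp only [xFun, Pi.add_apply, add_assoc, CharTwo.add_self_eq_zero, add_zero]

/-- The index `i` can enter or leave the window only on an edge that rewrites the bit at `i` modulo
`t`. On such an edge `x_i` flips the bit at one end and adds to the phase at the other end, and the
product of old and new bit changes by exactly that phase. -/
lemma up_xFun (i : ZMod (2 * t)) {u v : A × (ZMod t → ZMod 2)} (h : D.Up u v) :
    D.Up (D.xFun i u) (D.xFun i v) := by
  have hπ := D.π_of_up h
  have hk : D.res (D.xFun i u).1 = D.res u.1 := by rw [res, π_xFun, res]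
  have hd : i - D.π v.1 = (i - D.π u.1) - 1 := by rw [hπ]; ring
  obtain ⟨h1, h2⟩ := h
  have hr : red t (i - D.π u.1) = red t i - D.res u.1 := by rw [map_sub, res]
  refine ⟨?_, fun j hj => ?_⟩
  · rw [hk]
    simp only [xFun, Pi.add_apply, hd]
    by_cases hi : red t i = D.res u.1
    · rw [half_sub_one_of_eq (by rw [hr, hi, sub_self]), hi, Pi.single_eq_same,
        Pi.single_eq_same, h1]
      generalize half (i - D.π u.1) = f
      generalize u.2 (D.res u.1) = y
      generalize v.2 (D.res u.1) = w
      -- Here `y` is the old bit, `w` the new bit, and `f` tells whether `i` is visible at the lower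
      -- end. For `f = 1` this reads `(y + 1) w = y w + w`, for `f = 0` it reads `y (w + 1) = y w +
      -- y`.
      have : y * w + (1 + (f + 1)) * w = (1 + f) * y + (y + f) * (w + (f + 1)) := by
        revert f y w; decide
      have := congrArg D.τ this
      rw [map_add, map_add] at this
      rw [add_assoc, this]
      abel
    · rw [half_sub_one_of_ne (by rw [hr]; exact sub_ne_zero.2 hi), h2 _ hi, h1,
        Pi.single_eq_of_ne (Ne.symm hi), add_zero, add_zero]
      abel
  · rw [hk] at hj
    simp only [xFun, Pi.add_apply, hd]
    rw [h2 j hj]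
    by_cases hi : j = red t i
    · subst hi
      rw [half_sub_one_of_ne (by rw [hr]; exact sub_ne_zero.2 hj)]
    · rw [Pi.single_eq_of_ne hi, Pi.single_eq_of_ne hi]

/-- The automorphism of the model induced by `x_i`. -/
def xIso (i : ZMod (2 * t)) : D.graph ≃g D.graph :=
  D.autOfUp ⟨D.xFun i, D.xFun i, D.xFun_xFun i, D.xFun_xFun i⟩ fun u v =>
    ⟨fun h => by simpa only [Equiv.coe_fn_mk, xFun_xFun] using D.up_xFun i h, D.up_xFun i⟩

lemma xIso_apply (i : ZMod (2 * t)) (v : A × (ZMod t → ZMod 2)) : D.xIso i v = D.xFun i v := rfl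

/-- The automorphism of the model induced by `z`. -/
def zIso : D.graph ≃g D.graph :=
  D.autOfUp
    ⟨fun v => (v.1 + D.τ 1, v.2), fun v => (v.1 + D.τ 1, v.2),
      fun v => Prod.ext (by simp [add_assoc, D.τ_mul_self]) rfl,
      fun v => Prod.ext (by simp [add_assoc, D.τ_mul_self]) rfl⟩ fun u v => by
    have : D.res (u.1 + D.τ 1) = D.res u.1 := by rw [res, map_add, D.π_τ, add_zero, res]
    simp only [Up, Equiv.coe_fn_mk, this]
    rw [show u.1 + D.τ 1 + D.α + D.τ (u.2 (D.res u.1) * v.2 (D.res u.1)) =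
      u.1 + D.α + D.τ (u.2 (D.res u.1) * v.2 (D.res u.1)) + D.τ 1 by abel, add_left_inj]

lemma zIso_apply (v : A × (ZMod t → ZMod 2)) : D.zIso v = (v.1 + D.τ 1, v.2) := rfl

/-- The automorphism of the model induced by `a`; it lowers levels by one since right actions are
encoded as left actions. -/
def aIso : D.graph ≃g D.graph :=
  D.autOfUp
    ⟨fun v => (v.1 - D.α, fun j => v.2 (j + 1)), fun v => (v.1 + D.α, fun j => v.2 (j - 1)),
      fun v => Prod.ext (by simp) (by simp),
      fun v => Prod.ext (by simp) (by simp)⟩ fun u v => by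
    have : D.res (u.1 - D.α) = D.res u.1 - 1 := by
      rw [res, map_sub, D.π_α, map_sub, map_one, res]
    simp only [Up, Equiv.coe_fn_mk, this, sub_add_cancel]
    rw [sub_eq_iff_eq_add, show u.1 + D.τ (u.2 (D.res u.1) * v.2 (D.res u.1)) + D.α =
      u.1 + D.α + D.τ (u.2 (D.res u.1) * v.2 (D.res u.1)) by abel]
    refine and_congr_right fun _ => ⟨fun h j hj => ?_, fun h j hj => h _ ?_⟩
    · have := h (j - 1) (fun h' => hj (by simpa using h'))
      simpa using this
    · exact fun h' => hj (eq_sub_of_add_eq h')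

lemma aIso_apply (v : A × (ZMod t → ZMod 2)) :
    D.aIso v = (v.1 - D.α, fun j => v.2 (j + 1)) := rfl

/-- The action of `b`. -/
def bFun (v : A × (ZMod t → ZMod 2)) : A × (ZMod t → ZMod 2) := (-v.1, fun j => v.2 (-1 - j))

lemma bFun_bFun (v : A × (ZMod t → ZMod 2)) : bFun (bFun v) = v :=
  Prod.ext (by simp [bFun]) (by simp [bFun])

lemma up_bFun {u v : A × (ZMod t → ZMod 2)} (h : D.Up u v) : D.Up (bFun v) (bFun u) := by
  have hk : D.res (bFun v).1 = -1 - D.res u.1 := by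
    have := D.res_of_up h
    simp only [bFun, res, map_neg] at this ⊢
    rw [this]; ring
  obtain ⟨h1, h2⟩ := h
  refine ⟨?_, fun j hj => ?_⟩
  · rw [hk]
    simp only [bFun, sub_sub_cancel]
    rw [h1, mul_comm (v.2 _)]
    generalize D.τ (u.2 (D.res u.1) * v.2 (D.res u.1)) = c
    abel
  · rw [hk] at hj
    refine (h2 _ fun h => hj ?_).symm
    rw [← h]; ring

/-- The automorphism of the model induced by `b`. -/
def bIso : D.graph ≃g D.graph :=
  D.autOfDown ⟨bFun, bFun, bFun_bFun, bFun_bFun⟩ fun u v =>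
    ⟨fun h => by simpa only [Equiv.coe_fn_mk, bFun_bFun] using D.up_bFun h, D.up_bFun⟩

lemma bIso_apply (v : A × (ZMod t → ZMod 2)) : D.bIso v = (-v.1, fun j => v.2 (-1 - j)) := rfl

end PhaseGroup

/-! ### The defining relations of `G_t^±` hold in the model. -/

namespace PhaseGroup

variable {t : ℕ} {ε : Sgn} {A : Type} [AddCommGroup A] (D : PhaseGroup t ε A)
variable [hF : Fact (2 ≤ t)]

lemma aIso_pow_apply (n : ℕ) (v : A × (ZMod t → ZMod 2)) :
    (D.aIso ^ n) v = (v.1 - n • D.α, fun j => v.2 (j + n)) := by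
  induction n generalizing v with
  | zero => simp
  | succ n ih =>
    rw [pow_succ, RelIso.mul_apply, ih, aIso_apply]
    refine Prod.ext ?_ ?_
    · simp only [succ_nsmul]; abel
    · exact funext fun j => congrArg v.2 (by push_cast; ring)

/-- The action of the generators of `G_t^±` on the model. -/
def genIso : ExtGen t → (D.graph ≃g D.graph)
  | .x i => D.xIso i
  | .z => D.zIso
  | .a => D.aIso
  | .b => D.bIso

lemma xIso_sq (i : ZMod (2 * t)) : D.xIso i * D.xIso i = 1 :=
  RelIso.ext fun v => D.xFun_xFun i v

lemma zIso_sq : D.zIso * D.zIso = 1 := by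
  refine RelIso.ext fun v => ?_
  rw [RelIso.mul_apply, zIso_apply, zIso_apply]
  exact Prod.ext (by simp [add_assoc, D.τ_mul_self]) rfl

lemma bIso_sq : D.bIso * D.bIso = 1 := RelIso.ext fun v => bFun_bFun v

lemma xIso_mul_zIso (i : ZMod (2 * t)) : D.xIso i * D.zIso = D.zIso * D.xIso i := by
  refine RelIso.ext fun v => ?_
  simp only [RelIso.mul_apply, zIso_apply, xIso_apply, xFun, map_add, D.π_τ, add_zero]
  exact Prod.ext (by simp only; abel) rfl

/-- Distinct indices that do not differ by `t` have different residues modulo `t`, so the two maps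
read and write different bits. -/
lemma xIso_mul_xIso_of_ne {i j : ZMod (2 * t)} (h : j ≠ i + (t : ZMod (2 * t))) :
    D.xIso i * D.xIso j = D.xIso j * D.xIso i := by
  by_cases hij : i = j
  · rw [hij]
  have hr : red t i ≠ red t j := by
    intro hr
    rcases (red_eq_zero_iff (j - i)).1 (by rw [map_sub, hr, sub_self]) with h' | h'
    · exact hij (by linear_combination -h')
    · exact h (by linear_combination h')
  refine RelIso.ext fun v => ?_
  simp only [RelIso.mul_apply, xIso_apply]
  rw [xFun, π_xFun, xFun, xFun.eq_1 D j, π_xFun, xFun]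
  simp only [Pi.add_apply, Pi.single_eq_of_ne hr, Pi.single_eq_of_ne hr.symm, add_zero]
  exact Prod.ext (by simp only; abel) (by simp only; abel)

/-- On every level one of the two maps flips the bit `y` and the other adds `τ y` to the phase.
Changing the order replaces `y` by `y + 1` and costs `τ 1`. -/
lemma xIso_mul_xIso_add_t (i : ZMod (2 * t)) :
    D.xIso i * D.xIso (i + (t : ZMod (2 * t))) =
      D.xIso (i + (t : ZMod (2 * t))) * D.xIso i * D.zIso := by
  refine RelIso.ext fun v => ?_
  simp only [RelIso.mul_apply, xIso_apply, zIso_apply, xFun, map_add, D.π_τ, add_zero, red_t,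
    Pi.add_apply, Pi.single_eq_same, add_sub_right_comm, half_add_t]
  refine Prod.ext ?_ ?_
  · simp only [add_assoc, ← map_add]
    generalize half (i - D.π v.1) = f
    generalize v.2 (red t i) = y
    refine congrArg (fun c => v.1 + D.τ c) ?_
    revert f y; decide
  · simp only; abel

lemma aIso_conj_xIso (i : ZMod (2 * t)) : D.xIso i * D.aIso = D.aIso * D.xIso (i + 1) := by
  refine RelIso.ext fun v => ?_
  have h : i - (D.π v.1 - 1) = i + 1 - D.π v.1 := by ring
  simp only [RelIso.mul_apply, xIso_apply, aIso_apply, xFun, map_sub, D.π_α, h, map_add, map_one,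
    Pi.add_apply]
  refine Prod.ext (by simp only; abel) ?_
  funext j
  by_cases hj : j = red t i
  · subst hj; simp
  · simp [hj]

lemma bIso_conj_xIso (i : ZMod (2 * t)) :
    D.xIso i * D.bIso = D.bIso * D.xIso ((t : ZMod (2 * t)) - 1 - i) := by
  refine RelIso.ext fun v => ?_
  have h : i - -(D.π v.1) = (t : ZMod (2 * t)) - 1 - (t - 1 - i - D.π v.1) := by ring
  have hr : red t ((t : ZMod (2 * t)) - 1 - i) = -1 - red t i := by
    rw [map_sub, map_sub, red_t, map_one, zero_sub]
  simp only [RelIso.mul_apply, xIso_apply, bIso_apply, xFun, map_neg, h, half_t_sub_one_sub, hr,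
    Pi.add_apply]
  have hτ : ∀ c, - D.τ c = D.τ c := fun c => neg_eq_of_add_eq_zero_left (D.τ_mul_self c)
  refine Prod.ext ?_ ?_
  · simp only [neg_add, hτ]
  · funext j
    simp only [Pi.add_apply, Pi.single_apply]
    by_cases hj : j = red t i
    · simp [hj]
    · have : ¬ (-1 - j = -1 - red t i) := fun h => hj (by linear_combination -h)
      simp [hj]

/-- The bits return because they are indexed modulo `t`; the phase moves by `-(2t) • α`, and the
sign disappears because values of `τ` are their own negatives. -/
lemma aIso_pow_two_mul : D.aIso ^ (2 * t) = if ε.exponent = 0 then 1 else D.zIso := by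
  have key : ∀ v, (D.aIso ^ (2 * t)) v = (v.1 + D.τ ε.exponent, v.2) := fun v => by
    rw [aIso_pow_apply, D.nsmul_α, sub_eq_add_neg,
      neg_eq_of_add_eq_zero_left (D.τ_mul_self ε.exponent)]
    simp
  refine RelIso.ext fun v => ?_
  rw [key]
  rcases zmod_two_cases ε.exponent with h | h
  · rw [h, if_pos rfl, map_zero, add_zero]; rfl
  · rw [h, if_neg (by decide)]; rfl

lemma genIso_rels :
    ∀ w ∈ extraspecialRels t ∪ dihedralRels t ε ∪ actionRels t,
      FreeGroup.lift D.genIso w = 1 := by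
  rintro w (((⟨i, rfl⟩ | rfl | ⟨i, rfl⟩ | ⟨i, j, h, rfl⟩ | ⟨i, j, rfl, rfl⟩) | (h | rfl | rfl)) |
    (⟨i, rfl⟩ | ⟨i, rfl⟩))
  · rw [map_pow, FreeGroup.lift_apply_of, pow_two]
    exact D.xIso_sq i
  · rw [map_pow, FreeGroup.lift_apply_of, pow_two]
    exact D.zIso_sq
  · simp only [map_mul, map_inv, FreeGroup.lift_apply_of, genIso]
    rw [mul_assoc, mul_assoc, inv_mul_eq_iff_eq_mul, mul_one, inv_mul_eq_iff_eq_mul,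
      xIso_mul_zIso]
  · simp only [map_mul, map_inv, FreeGroup.lift_apply_of, genIso]
    rw [mul_assoc, mul_assoc, inv_mul_eq_iff_eq_mul, mul_one, inv_mul_eq_iff_eq_mul,
      D.xIso_mul_xIso_of_ne h]
  · simp only [map_mul, map_inv, FreeGroup.lift_apply_of, genIso]
    rw [mul_inv_eq_one, mul_assoc, mul_assoc, inv_mul_eq_iff_eq_mul, inv_mul_eq_iff_eq_mul,
      xIso_mul_xIso_add_t, mul_assoc]
  · have hp := D.aIso_pow_two_mul
    cases ε
    · change w = _ at h
      subst h
      simpa only [map_pow, FreeGroup.lift_apply_of, genIso, Sgn.exponent, if_true] using hp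
    · change w = _ at h
      subst h
      rw [Sgn.exponent, if_neg (by decide)] at hp
      simp only [map_mul, map_inv, map_pow, FreeGroup.lift_apply_of, genIso, hp, mul_inv_cancel]
  · rw [map_pow, FreeGroup.lift_apply_of, pow_two]
    exact D.bIso_sq
  · simp only [map_mul, map_inv, FreeGroup.lift_apply_of, genIso]
    rw [mul_assoc, mul_assoc, inv_mul_eq_iff_eq_mul, mul_one]
    refine RelIso.ext fun v => ?_
    simp only [RelIso.mul_apply, aIso_apply, bIso_apply]
    exact Prod.ext (by simp) (funext fun j => congrArg v.2 (by ring))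
  · simp only [map_mul, map_inv, FreeGroup.lift_apply_of, genIso]
    rw [mul_inv_eq_one, mul_assoc, inv_mul_eq_iff_eq_mul, aIso_conj_xIso]
  · simp only [map_mul, map_inv, FreeGroup.lift_apply_of, genIso]
    rw [mul_inv_eq_one, mul_assoc, inv_mul_eq_iff_eq_mul, bIso_conj_xIso]

/-- The action of `G_t^±` on the model. -/
def action : ExtGroup t ε →* (D.graph ≃g D.graph) := PresentedGroup.toGroup D.genIso_rels

lemma action_gen (g : ExtGen t) : D.action (gen ε g) = D.genIso g := PresentedGroup.toGroup.of _

end PhaseGroup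

/-! ### Consequences of the defining relations inside `G_t^±`. -/

section Relations

variable {t : ℕ} (ε : Sgn)

lemma rel_eq_one {w : FreeGroup (ExtGen t)}
    (h : w ∈ extraspecialRels t ∪ dihedralRels t ε ∪ actionRels t) :
    (PresentedGroup.mk (extraspecialRels t ∪ dihedralRels t ε ∪ actionRels t)) w = 1 :=
  PresentedGroup.one_of_mem h

/-- The generators `x_i` of `G_t^±`. -/
abbrev gx (i : ZMod (2 * t)) : ExtGroup t ε := gen ε (.x i)
/-- The generator `z` of `G_t^±`. -/
abbrev gz : ExtGroup t ε := gen ε .z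
/-- The generator `a` of `G_t^±`. -/
abbrev ga : ExtGroup t ε := gen ε .a
/-- The generator `b` of `G_t^±`. -/
abbrev gb : ExtGroup t ε := gen ε .b

lemma gx_sq (i : ZMod (2 * t)) : gx ε i * gx ε i = 1 := by
  have := rel_eq_one ε (Or.inl (Or.inl (Or.inl ⟨i, rfl⟩)))
  rw [map_pow, pow_two] at this
  exact this

lemma gz_sq : gz (t := t) ε * gz ε = 1 := by
  have := rel_eq_one (t := t) ε (Or.inl (Or.inl (Or.inr (Or.inl rfl))))
  rw [map_pow, pow_two] at this
  exact this

lemma gb_sq : gb (t := t) ε * gb ε = 1 := by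
  have := rel_eq_one (t := t) ε (Or.inl (Or.inr (Or.inr (Or.inl rfl))))
  rw [map_pow, pow_two] at this
  exact this

lemma gx_mul_gz (i : ZMod (2 * t)) : gx ε i * gz ε = gz ε * gx ε i := by
  have := rel_eq_one ε (Or.inl (Or.inl (Or.inr (Or.inr (Or.inl ⟨i, rfl⟩)))))
  simp only [map_mul, map_inv] at this
  rwa [mul_assoc, mul_assoc, inv_mul_eq_iff_eq_mul, mul_one, inv_mul_eq_iff_eq_mul] at this

lemma gx_mul_gx_of_ne {i j : ZMod (2 * t)} (h : j ≠ i + (t : ZMod (2 * t))) :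
    gx ε i * gx ε j = gx ε j * gx ε i := by
  have := rel_eq_one ε (Or.inl (Or.inl (Or.inr (Or.inr (Or.inr (Or.inl ⟨i, j, h, rfl⟩))))))
  simp only [map_mul, map_inv] at this
  rwa [mul_assoc, mul_assoc, inv_mul_eq_iff_eq_mul, mul_one, inv_mul_eq_iff_eq_mul] at this

lemma gx_mul_gx_add_t (i : ZMod (2 * t)) :
    gx ε i * gx ε (i + (t : ZMod (2 * t))) = gx ε (i + (t : ZMod (2 * t))) * gx ε i * gz ε := by
  have := rel_eq_one ε (Or.inl (Or.inl (Or.inr (Or.inr (Or.inr (Or.inr ⟨i, _, rfl, rfl⟩))))))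
  simp only [map_mul, map_inv] at this
  rwa [mul_inv_eq_one, mul_assoc, mul_assoc, inv_mul_eq_iff_eq_mul, inv_mul_eq_iff_eq_mul,
    ← mul_assoc] at this

lemma ga_pow : ga (t := t) ε ^ (2 * t) = if ε.exponent = 0 then 1 else gz ε := by
  cases ε
  · have := rel_eq_one (t := t) .plus (Or.inl (Or.inr (Or.inl rfl)))
    rw [map_pow] at this
    exact this
  · have := rel_eq_one (t := t) .minus (Or.inl (Or.inr (Or.inl rfl)))
    rw [map_mul, map_inv, mul_inv_eq_one, map_pow] at this
    exact this

lemma gb_conj_ga : ga (t := t) ε * gb ε = gb ε * (ga ε)⁻¹ := by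
  have := rel_eq_one (t := t) ε (Or.inl (Or.inr (Or.inr (Or.inr rfl))))
  simp only [map_mul, map_inv] at this
  rw [mul_assoc, mul_assoc, inv_mul_eq_iff_eq_mul, mul_one, ← mul_assoc] at this
  exact eq_mul_inv_of_mul_eq this

lemma gx_mul_ga (i : ZMod (2 * t)) : gx ε i * ga ε = ga ε * gx ε (i + 1) := by
  have := rel_eq_one ε (Or.inr (Or.inl ⟨i, rfl⟩))
  simp only [map_mul, map_inv] at this
  rwa [mul_inv_eq_one, mul_assoc, inv_mul_eq_iff_eq_mul] at this

lemma gx_mul_gb (i : ZMod (2 * t)) :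
    gx ε i * gb ε = gb ε * gx ε ((t : ZMod (2 * t)) - 1 - i) := by
  have := rel_eq_one ε (Or.inr (Or.inr ⟨i, rfl⟩))
  simp only [map_mul, map_inv] at this
  rwa [mul_inv_eq_one, mul_assoc, inv_mul_eq_iff_eq_mul] at this

/-- No relator mentions `z` together with conjugation by `a`. The relation follows because `z` is
the commutator of `x_i` and `x_{i+t}` for every `i`, and conjugation by `a` shifts `i`. -/
lemma gz_mul_ga : gz (t := t) ε * ga ε = ga ε * gz ε := by
  have h := gx_mul_gx_add_t ε (0 : ZMod (2 * t))
  have h1 := gx_mul_gx_add_t ε (0 + 1 : ZMod (2 * t))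
  have e : ∀ i : ZMod (2 * t), gx ε (i + 1) = (ga ε)⁻¹ * gx ε i * ga ε := fun i => by
    rw [mul_assoc, gx_mul_ga, inv_mul_cancel_left]
  rw [add_right_comm, e, e] at h1
  have h2 : (ga ε)⁻¹ * (gx ε 0 * gx ε (0 + (t : ZMod (2 * t)))) * ga ε =
      (ga ε)⁻¹ * (gx ε (0 + (t : ZMod (2 * t))) * gx ε 0) * ga ε * gz ε := by
    simpa only [mul_assoc, mul_inv_cancel_left] using h1
  rw [h] at h2
  simp only [mul_assoc, mul_right_inj] at h2
  exact h2

/-- Conjugation by `b` takes the pair `x_0, x_t` to a pair of the same kind in the opposite order,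
so it sends `z` to its inverse, which is `z`. -/
lemma gz_mul_gb : gz (t := t) ε * gb ε = gb ε * gz ε := by
  have h := gx_mul_gx_add_t ε (0 : ZMod (2 * t))
  have h1 := gx_mul_gx_add_t ε ((t : ZMod (2 * t)) - 1 - (0 + (t : ZMod (2 * t))))
  have e : ∀ i : ZMod (2 * t), gx ε ((t : ZMod (2 * t)) - 1 - i) = (gb ε)⁻¹ * gx ε i * gb ε := fun i => by
    rw [mul_assoc, gx_mul_gb, inv_mul_cancel_left]
  rw [show (t : ZMod (2 * t)) - 1 - (0 + (t : ZMod (2 * t))) + (t : ZMod (2 * t)) =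
    (t : ZMod (2 * t)) - 1 - 0 by ring, e, e] at h1
  have h2 : (gb ε)⁻¹ * (gx ε (0 + (t : ZMod (2 * t))) * gx ε 0) * gb ε =
      (gb ε)⁻¹ * (gx ε 0 * gx ε (0 + (t : ZMod (2 * t)))) * gb ε * gz ε := by
    simpa only [mul_assoc, mul_inv_cancel_left] using h1
  rw [h] at h2
  simp only [mul_assoc, mul_right_inj] at h2
  have h3 := congrArg (gz ε * ·) h2
  simp only [← mul_assoc, gz_sq, one_mul] at h3
  exact h3

lemma eq_top_of_gen_mem {S : Subgroup (ExtGroup t ε)} (h : ∀ g, gen ε g ∈ S) : S = ⊤ := by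
  rw [eq_top_iff, ← PresentedGroup.closure_range_of, Subgroup.closure_le]
  rintro _ ⟨g, rfl⟩
  exact h g

lemma gz_mem_center : gz (t := t) ε ∈ Subgroup.center (ExtGroup t ε) := by
  rw [Subgroup.mem_center_iff]
  have : Subgroup.centralizer {gz (t := t) ε} = ⊤ := by
    refine eq_top_of_gen_mem ε fun g => ?_
    rw [Subgroup.mem_centralizer_singleton_iff]
    cases g
    · exact gx_mul_gz ε _
    · rfl
    · exact (gz_mul_ga ε).symm
    · exact (gz_mul_gb ε).symm
  intro g
  have hg : g ∈ Subgroup.centralizer {gz (t := t) ε} := this ▸ Subgroup.mem_top g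
  exact Subgroup.mem_centralizer_singleton_iff.1 hg

end Relations

/-! ### Lifting residues modulo `t` to the two halves of `ZMod (2t)`. -/

section Lifts

variable {t : ℕ} [hF : Fact (2 ≤ t)]

/-- The lift of a residue modulo `t` to the first half of `ZMod (2 * t)`. -/
def lower (j : ZMod t) : ZMod (2 * t) := (j.val : ℕ)

/-- The lift of a residue modulo `t` to the second half of `ZMod (2 * t)`. -/
def upper (j : ZMod t) : ZMod (2 * t) := lower j + (t : ZMod (2 * t))

lemma red_lower (j : ZMod t) : red t (lower j) = j := by
  rw [lower, red_natCast, ZMod.natCast_zmod_val]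

lemma red_upper (j : ZMod t) : red t (upper j) = j := by
  rw [upper, map_add, red_t, red_lower, add_zero]

lemma half_lower (j : ZMod t) : half (lower j) = 0 := half_natCast_of_lt (ZMod.val_lt j)

lemma half_upper (j : ZMod t) : half (upper j) = 1 := by
  rw [upper, half_add_t, half_lower]; rfl

lemma half_upper_sub (j : ZMod t) (k : ZMod (2 * t)) :
    half (upper j - k) = half (lower j - k) + 1 := by
  rw [upper, add_sub_right_comm, half_add_t]

lemma eq_lower_or_eq_upper (p : ZMod (2 * t)) : p = lower (red t p) ∨ p = upper (red t p) := by
  have h : red t (p - lower (red t p)) = 0 := by rw [map_sub, red_lower, sub_self]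
  rcases (red_eq_zero_iff _).1 h with h | h
  · exact Or.inl (by linear_combination h)
  · exact Or.inr (by rw [upper]; linear_combination h)

lemma eq_lower_of_half_eq_zero {p : ZMod (2 * t)} (h : half p = 0) : p = lower (red t p) := by
  refine (eq_lower_or_eq_upper p).resolve_right fun h' => ?_
  rw [h', half_upper] at h
  exact absurd h (by decide)

lemma eq_upper_of_half_eq_one {p : ZMod (2 * t)} (h : half p = 1) : p = upper (red t p) := by
  refine (eq_lower_or_eq_upper p).resolve_left fun h' => ?_
  rw [h', half_lower] at h
  exact absurd h (by decide)

end Lifts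

/-- The homomorphism from the group of order two given by an involution. -/
def involutionHom {G : Type*} [Group G] (g : G) (h : g * g = 1) : Multiplicative (ZMod 2) →* G where
  toFun c := if c = 1 then 1 else g
  map_one' := if_pos rfl
  map_mul' c d := by
    have key : ∀ c : Multiplicative (ZMod 2), c = 1 ∨ c = Multiplicative.ofAdd 1 := by decide
    have h1 : Multiplicative.ofAdd (1 : ZMod 2) ≠ 1 := by decide
    have h2 : Multiplicative.ofAdd (1 : ZMod 2) * Multiplicative.ofAdd 1 = 1 := by decide
    rcases key c with rfl | rfl <;> rcases key d with rfl | rfl <;> simp [h1, h, h2]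

lemma involutionHom_ofAdd_one {G : Type*} [Group G] (g : G) (h : g * g = 1) :
    involutionHom g h (Multiplicative.ofAdd 1) = g :=
  show (if _ then 1 else g) = g from if_neg (show ¬ Multiplicative.ofAdd (1 : ZMod 2) = 1 by decide)

/-! ### A normal form for the elements of `G_t^±`. -/

section NormalForm

variable {t : ℕ} [hF : Fact (2 ≤ t)] (ε : Sgn)

lemma pairwise_commute_involutionHom (l : ZMod t → ZMod (2 * t)) (hl : ∀ j, red t (l j) = j) :
    Pairwise fun i j => ∀ c d : Multiplicative (ZMod 2),
      Commute (involutionHom (gx ε (l i)) (gx_sq ε (l i)) c)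
        (involutionHom (gx ε (l j)) (gx_sq ε (l j)) d) := by
  intro i j hij c d
  have hc : Commute (gx ε (l i)) (gx ε (l j)) := by
    refine gx_mul_gx_of_ne ε fun h => hij ?_
    have := congrArg (red t) h
    rw [map_add, red_t, add_zero, hl, hl] at this
    exact this.symm
  change Commute (if c = 1 then 1 else gx ε (l i)) (if d = 1 then 1 else gx ε (l j))
  split_ifs <;> simp [hc]

/-- Products of the commuting generators `x_{l j}` for a choice `l` of lifts. -/
def prodX (l : ZMod t → ZMod (2 * t)) (hl : ∀ j, red t (l j) = j) :
    (ZMod t → Multiplicative (ZMod 2)) →* ExtGroup t ε :=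
  MonoidHom.noncommPiCoprod (fun j => involutionHom (gx ε (l j)) (gx_sq ε (l j)))
    (pairwise_commute_involutionHom ε l hl)

lemma prodX_mulSingle (l : ZMod t → ZMod (2 * t)) (hl : ∀ j, red t (l j) = j) (j : ZMod t) :
    prodX ε l hl (Pi.mulSingle j (Multiplicative.ofAdd 1)) = gx ε (l j) := by
  rw [prodX, MonoidHom.noncommPiCoprod_mulSingle, involutionHom_ofAdd_one]

/-- Induction on products of generators. -/
lemma bits_induction {P : (ZMod t → Multiplicative (ZMod 2)) → Prop} (one : P 1)
    (single : ∀ j, P (Pi.mulSingle j (Multiplicative.ofAdd 1)))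
    (mul : ∀ f g, P f → P g → P (f * g)) (f : ZMod t → Multiplicative (ZMod 2)) : P f := by
  refine Pi.mulSingle_induction P f one mul fun j c => ?_
  have key : ∀ c : Multiplicative (ZMod 2), c = 1 ∨ c = Multiplicative.ofAdd 1 := by decide
  rcases key c with rfl | rfl
  · rwa [Pi.mulSingle_one]
  · exact single j

/-- Products of the generators `x_0, …, x_{t-1}`. -/
abbrev lowX : (ZMod t → Multiplicative (ZMod 2)) →* ExtGroup t ε := prodX ε lower red_lower

/-- Products of the generators `x_t, …, x_{2t-1}`. -/
abbrev highX : (ZMod t → Multiplicative (ZMod 2)) →* ExtGroup t ε := prodX ε upper red_upper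

/-- Only the factor with the same residue fails to commute with `x_j`, and it does so up to `z`.
Thus a generator of `H` can be moved to the left and absorbed there. -/
lemma exists_highX_mul_gx_lower (y : ZMod t → Multiplicative (ZMod 2)) (j : ZMod t) :
    ∃ m : ℤ, highX ε y * gx ε (lower j) = gx ε (lower j) * highX ε y * gz ε ^ m := by
  have hz : ∀ (m : ℤ) (g : ExtGroup t ε), gz ε ^ m * g = g * gz ε ^ m := fun m g =>
    (Subgroup.mem_center_iff.1 (Subgroup.zpow_mem _ (gz_mem_center ε) m) g).symm
  induction y using bits_induction with
  | one => exact ⟨0, by simp⟩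
  | single i =>
    rw [prodX_mulSingle]
    by_cases hij : i = j
    · subst hij
      refine ⟨1, ?_⟩
      rw [zpow_one, upper, gx_mul_gx_add_t, mul_assoc, gz_sq, mul_one]
    · refine ⟨0, ?_⟩
      rw [zpow_zero, mul_one]
      refine (gx_mul_gx_of_ne ε fun h => hij ?_).symm
      have := congrArg (red t) h
      rwa [map_add, red_t, add_zero, red_upper, red_lower] at this
  | mul f g hf hg =>
    obtain ⟨m, hm⟩ := hf
    obtain ⟨n, hn⟩ := hg
    refine ⟨m + n, ?_⟩
    rw [map_mul, mul_assoc, hn, ← mul_assoc, ← mul_assoc, hm, zpow_add]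
    simp only [mul_assoc, hz m]

lemma gx_lower_mem (j : ZMod t) : gx ε (lower j) ∈ ExtH t ε :=
  Subgroup.subset_closure (Or.inl ⟨j.val, ZMod.val_lt j, rfl⟩)

lemma gb_mem : gb ε ∈ ExtH t ε := Subgroup.subset_closure (Or.inr rfl)

lemma lowX_mem (y : ZMod t → Multiplicative (ZMod 2)) : lowX ε y ∈ ExtH t ε := by
  induction y using bits_induction with
  | one => rw [map_one]; exact one_mem _
  | single j => rw [prodX_mulSingle]; exact gx_lower_mem ε j
  | mul f g hf hg => rw [map_mul]; exact mul_mem hf hg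

lemma prodX_mul_gb (l : ZMod t → ZMod (2 * t)) (hl : ∀ j, red t (l j) = j)
    (hb : ∀ j, (t : ZMod (2 * t)) - 1 - l j = l (-1 - j)) (y : ZMod t → Multiplicative (ZMod 2)) :
    ∃ y', prodX ε l hl y * gb ε = gb ε * prodX ε l hl y' := by
  induction y using bits_induction with
  | one => exact ⟨1, by simp⟩
  | single j =>
    refine ⟨Pi.mulSingle (-1 - j) (Multiplicative.ofAdd 1), ?_⟩
    rw [prodX_mulSingle, prodX_mulSingle, gx_mul_gb, hb]
  | mul f g hf hg =>
    obtain ⟨f', hf⟩ := hf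
    obtain ⟨g', hg⟩ := hg
    exact ⟨f' * g', by rw [map_mul, mul_assoc, hg, ← mul_assoc, hf, map_mul, mul_assoc]⟩

lemma reflect_lower (j : ZMod t) : (t : ZMod (2 * t)) - 1 - lower j = lower (-1 - j) := by
  have h := eq_lower_of_half_eq_zero ((half_t_sub_one_sub (lower j)).trans (half_lower j))
  rwa [map_sub, map_sub, red_t, map_one, red_lower, zero_sub] at h

lemma reflect_upper (j : ZMod t) : (t : ZMod (2 * t)) - 1 - upper j = upper (-1 - j) := by
  have h := eq_upper_of_half_eq_one ((half_t_sub_one_sub (upper j)).trans (half_upper j))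
  rwa [map_sub, map_sub, red_t, map_one, red_upper, zero_sub] at h

/-- Every element of `H` is a product of generators `x_0, …, x_{t-1}` and a power of `b`. -/
lemma exists_of_mem_ExtH {h : ExtGroup t ε} (hh : h ∈ ExtH t ε) :
    ∃ y, h = lowX ε y ∨ h = lowX ε y * gb ε := by
  have key : ∀ g ∈ ({h | ∃ i : ℕ, i < t ∧ h = gen ε (.x (i : ZMod (2 * t)))} ∪ {gen ε .b} :
      Set (ExtGroup t ε)), g⁻¹ = g ∧ ∀ h, (∃ y, h = lowX ε y ∨ h = lowX ε y * gb ε) →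
        ∃ y, h * g = lowX ε y ∨ h * g = lowX ε y * gb ε := by
    rintro g (⟨i, hi, rfl⟩ | rfl)
    · refine ⟨inv_eq_of_mul_eq_one_left (gx_sq ε _), ?_⟩
      have hl : (i : ZMod (2 * t)) = lower (i : ZMod t) := by
        rw [lower, ZMod.val_natCast, Nat.mod_eq_of_lt hi]
      rintro h ⟨y, rfl | rfl⟩
      · refine ⟨y * Pi.mulSingle (i : ZMod t) (Multiplicative.ofAdd 1), Or.inl ?_⟩
        rw [map_mul, prodX_mulSingle, hl]
      · refine ⟨y * Pi.mulSingle (-1 - (i : ZMod t)) (Multiplicative.ofAdd 1), Or.inr ?_⟩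
        rw [map_mul, prodX_mulSingle, hl, mul_assoc, mul_assoc, gx_mul_gb, ← reflect_lower,
          sub_sub_cancel]
    · refine ⟨inv_eq_of_mul_eq_one_left (gb_sq ε), ?_⟩
      rintro h ⟨y, rfl | rfl⟩
      · exact ⟨y, Or.inr rfl⟩
      · exact ⟨y, Or.inl (by rw [mul_assoc, gb_sq, mul_one])⟩
  induction hh using Subgroup.closure_induction_right with
  | one => exact ⟨1, Or.inl (map_one _).symm⟩
  | mul_right x _ g hg ih => exact (key g hg).2 x ih
  | mul_inv_cancel x _ g hg ih => rw [(key g hg).1]; exact (key g hg).2 x ih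

lemma gx_mul_ga_inv (i : ZMod (2 * t)) : gx ε i * (ga ε)⁻¹ = (ga ε)⁻¹ * gx ε (i - 1) := by
  have := gx_mul_ga ε (i - 1)
  rw [sub_add_cancel] at this
  rw [mul_inv_eq_iff_eq_mul, mul_assoc, this, inv_mul_cancel_left]

lemma ga_zpow_mul_gx (n : ℤ) (i : ZMod (2 * t)) :
    ga ε ^ n * gx ε i = gx ε (i - (n : ZMod (2 * t))) * ga ε ^ n := by
  induction n generalizing i with
  | zero => simp
  | succ n ih =>
    have := gx_mul_ga ε (i - 1)
    rw [sub_add_cancel] at this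
    rw [zpow_add_one, mul_assoc, ← this, ← mul_assoc, ih, mul_assoc]
    congr 2
    push_cast; ring
  | pred n ih =>
    have := gx_mul_ga_inv ε (i + 1)
    rw [add_sub_cancel_right] at this
    rw [zpow_sub_one, mul_assoc, ← this, ← mul_assoc, ih, mul_assoc]
    congr 2
    push_cast; ring

lemma ga_zpow_mul_gb (n : ℤ) : ga (t := t) ε ^ n * gb ε = gb ε * ga ε ^ (-n) := by
  have h : gb (t := t) ε * ga ε * (gb ε)⁻¹ = (ga ε)⁻¹ := by
    have := gb_conj_ga (t := t) ε
    rw [inv_eq_of_mul_eq_one_left (gb_sq ε), mul_assoc, this, ← mul_assoc, gb_sq, one_mul]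
  rw [zpow_neg, ← inv_zpow, ← h, conj_zpow, inv_eq_of_mul_eq_one_left (gb_sq ε), ← mul_assoc,
    ← mul_assoc, gb_sq, one_mul]

/-- A normal form in `G_t^±`. -/
lemma exists_normalForm (g : ExtGroup t ε) :
    ∃ h ∈ ExtH t ε, ∃ (y : ZMod t → Multiplicative (ZMod 2)) (n m : ℤ),
      g = h * highX ε y * ga ε ^ n * gz ε ^ m := by
  have hz : ∀ (m : ℤ) (g : ExtGroup t ε), gz ε ^ m * g = g * gz ε ^ m := fun m g =>
    (Subgroup.mem_center_iff.1 (Subgroup.zpow_mem _ (gz_mem_center ε) m) g).symm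
  let P : ExtGroup t ε → Prop := fun g => ∃ h ∈ ExtH t ε,
    ∃ (y : ZMod t → Multiplicative (ZMod 2)) (n m : ℤ),
      g = h * highX ε y * ga ε ^ n * gz ε ^ m
  -- Moving `x_i` past `a ^ n` turns it into `x_{i-n}`. This is either a generator of `H`, absorbed
  -- on the left, or one of the upper generators, absorbed in the product.
  have hx : ∀ i g, P g → P (g * gx ε i) := by
    rintro i _ ⟨h, hh, y, n, m, rfl⟩
    have e : h * highX ε y * ga ε ^ n * gz ε ^ m * gx ε i =
        h * (highX ε y * gx ε (i - (n : ZMod (2 * t)))) * ga ε ^ n * gz ε ^ m := by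
      rw [mul_assoc _ (gz ε ^ m), hz, ← mul_assoc, mul_assoc _ (ga ε ^ n), ga_zpow_mul_gx]
      simp only [mul_assoc]
    rw [e]
    rcases eq_lower_or_eq_upper (i - (n : ZMod (2 * t))) with hi | hi
    · obtain ⟨k, hk⟩ := exists_highX_mul_gx_lower ε y (red t (i - (n : ZMod (2 * t))))
      refine ⟨h * gx ε (i - (n : ZMod (2 * t))), mul_mem hh (by rw [hi]; exact gx_lower_mem ε _), y, n, k + m, ?_⟩
      rw [← hi] at hk
      rw [hk, zpow_add]
      simp only [mul_assoc]
      rw [← mul_assoc (gz ε ^ k) (ga ε ^ n), hz k (ga ε ^ n), mul_assoc]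
    · refine ⟨h, hh, y * Pi.mulSingle (red t (i - (n : ZMod (2 * t)))) (Multiplicative.ofAdd 1),
        n, m, ?_⟩
      rw [map_mul, prodX_mulSingle, ← hi]
  have ha : ∀ (k : ℤ) g, P g → P (g * ga ε ^ k) := by
    rintro k _ ⟨h, hh, y, n, m, rfl⟩
    exact ⟨h, hh, y, n + k, m, by rw [mul_assoc, hz, zpow_add]; simp only [mul_assoc]⟩
  have hzz : ∀ (k : ℤ) g, P g → P (g * gz ε ^ k) := by
    rintro k _ ⟨h, hh, y, n, m, rfl⟩
    exact ⟨h, hh, y, n, m + k, by rw [zpow_add]; simp only [mul_assoc]⟩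
  have hb : ∀ g, P g → P (g * gb ε) := by
    rintro _ ⟨h, hh, y, n, m, rfl⟩
    obtain ⟨y', hy'⟩ := prodX_mul_gb ε upper red_upper reflect_upper y
    refine ⟨h * gb ε, mul_mem hh (gb_mem ε), y', -n, m, ?_⟩
    rw [mul_assoc _ (gz ε ^ m), hz, ← mul_assoc, mul_assoc _ (ga ε ^ n), ga_zpow_mul_gb,
      ← mul_assoc, mul_assoc h, hy']
    simp only [mul_assoc]
  have hg : g ∈ Subgroup.closure (Set.range (gen (t := t) ε)) := by
    rw [eq_top_of_gen_mem ε fun g => Subgroup.subset_closure (Set.mem_range_self g)]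
    exact Subgroup.mem_top g
  change P g
  induction hg using Subgroup.closure_induction_right with
  | one => exact ⟨1, one_mem _, 1, 0, 0, by simp⟩
  | mul_right x _ g hg ih =>
    obtain ⟨g, rfl⟩ := hg
    cases g with
    | x i => exact hx i x ih
    | z => simpa using hzz 1 x ih
    | a => simpa using ha 1 x ih
    | b => exact hb x ih
  | mul_inv_cancel x _ g hg ih =>
    obtain ⟨g, rfl⟩ := hg
    cases g with
    | x i => rw [inv_eq_of_mul_eq_one_left (gx_sq ε i)]; exact hx i x ih
    | z => simpa using hzz (-1) x ih
    | a => simpa using ha (-1) x ih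
    | b => rw [inv_eq_of_mul_eq_one_left (gb_sq ε)]; exact hb x ih

end NormalForm

/-! ### Stabiliser of the base vertex, faithfulness and transitivity. -/

namespace PhaseGroup

variable {t : ℕ} {ε : Sgn} {A : Type} [AddCommGroup A] (D : PhaseGroup t ε A)
variable [hF : Fact (2 ≤ t)]

lemma action_gz (v : A × (ZMod t → ZMod 2)) : D.action (gz ε) v = (v.1 + D.τ 1, v.2) := by
  rw [action_gen]; rfl

lemma action_ga (v : A × (ZMod t → ZMod 2)) :
    D.action (ga ε) v = (v.1 - D.α, fun j => v.2 (j + 1)) := by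
  rw [action_gen]; rfl

lemma action_ga_inv (v : A × (ZMod t → ZMod 2)) :
    D.action (ga ε)⁻¹ v = (v.1 + D.α, fun j => v.2 (j - 1)) := by
  rw [map_inv, action_gen]; rfl

lemma action_gb (v : A × (ZMod t → ZMod 2)) : D.action (gb ε) v = bFun v := by
  rw [action_gen]; rfl

lemma action_gx (i : ZMod (2 * t)) (v : A × (ZMod t → ZMod 2)) :
    D.action (gx ε i) v = D.xFun i v := by
  rw [action_gen]; rfl

lemma action_mul (g h : ExtGroup t ε) (v : A × (ZMod t → ZMod 2)) :
    D.action (g * h) v = D.action g (D.action h v) := by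
  rw [map_mul]; rfl

lemma action_one (v : A × (ZMod t → ZMod 2)) : D.action (1 : ExtGroup t ε) v = v := by
  rw [map_one]; rfl

lemma action_inv_action (g : ExtGroup t ε) (v : A × (ZMod t → ZMod 2)) :
    D.action g⁻¹ (D.action g v) = v := by
  rw [← action_mul, inv_mul_cancel, action_one]

lemma action_action_inv (g : ExtGroup t ε) (v : A × (ZMod t → ZMod 2)) :
    D.action g (D.action g⁻¹ v) = v := by
  rw [← action_mul, mul_inv_cancel, action_one]

lemma action_gz_zpow (m : ℤ) (v : A × (ZMod t → ZMod 2)) :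
    D.action (gz ε ^ m) v = (v.1 + D.τ (m : ZMod 2), v.2) := by
  have hinv : (gz (t := t) ε)⁻¹ = gz ε := inv_eq_of_mul_eq_one_left (gz_sq ε)
  induction m generalizing v with
  | zero => simp
  | succ n ih =>
    rw [zpow_add_one, action_mul, action_gz, ih]
    exact Prod.ext (by push_cast; rw [map_add]; abel) rfl
  | pred n ih =>
    rw [zpow_sub_one, hinv, action_mul, action_gz, ih]
    refine Prod.ext ?_ rfl
    push_cast
    rw [CharTwo.sub_eq_add, map_add]; abel

lemma action_ga_zpow (n : ℤ) (κ : A) :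
    D.action (ga ε ^ n) (κ, 0) = (κ - n • D.α, 0) := by
  induction n generalizing κ with
  | zero => simp
  | succ n ih =>
    rw [zpow_add_one, action_mul, action_ga]
    refine (ih (κ - D.α)).trans (Prod.ext ?_ rfl)
    simp only [add_zsmul, one_zsmul]; abel
  | pred n ih =>
    rw [zpow_sub_one, action_mul, action_ga_inv]
    refine (ih (κ + D.α)).trans (Prod.ext ?_ rfl)
    simp only [sub_zsmul, one_zsmul]; abel

lemma action_prodX (l : ZMod t → ZMod (2 * t)) (hl : ∀ j, red t (l j) = j)
    (y : ZMod t → Multiplicative (ZMod 2)) (v : A × (ZMod t → ZMod 2)) :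
    D.π (D.action (prodX ε l hl y) v).1 = D.π v.1 ∧
      ∀ j, (D.action (prodX ε l hl y) v).2 j =
        v.2 j + (y j).toAdd * half (l j - D.π v.1) := by
  induction y using bits_induction generalizing v with
  | one => simp
  | single i =>
    rw [prodX_mulSingle, action_gx]
    refine ⟨D.π_xFun _ _, fun j => ?_⟩
    rw [xFun]
    simp only [Pi.add_apply, hl]
    by_cases h : j = i
    · subst h; simp
    · simp [h]
  | mul f g hf hg =>
    rw [map_mul, action_mul]
    refine ⟨(hf _).1.trans (hg _).1, fun j => ?_⟩
    rw [(hf _).2, (hg _).2, (hg _).1, Pi.mul_apply, toAdd_mul]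
    ring

/-- The base vertex. -/
def base : A × (ZMod t → ZMod 2) := (0, 0)

/-- The group `⟨a, z⟩` satisfies all relations that hold in `A`: reduction modulo `⟨z⟩` forces `2t ∣
n`, and `a ^ (2t)` is the same power of `z` in both groups. -/
lemma zpow_eq_of_smul_α (n m : ℤ) (h : n • D.α = D.τ (m : ZMod 2)) :
    ga (t := t) ε ^ n * gz ε ^ m = 1 := by
  have hn : ((n : ℤ) : ZMod (2 * t)) = 0 := by
    have := congrArg D.π h
    rwa [map_zsmul, D.π_α, D.π_τ, zsmul_one] at this
  rw [ZMod.intCast_zmod_eq_zero_iff_dvd] at hn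
  obtain ⟨q, rfl⟩ := hn
  have hq : ga (t := t) ε ^ (((2 * t : ℕ) : ℤ) * q) = (if ε.exponent = 0 then 1 else gz ε) ^ q := by
    rw [zpow_mul, zpow_natCast, ga_pow]
  have hm : ((q : ℤ) : ZMod 2) * ε.exponent = m := by
    refine D.τ_injective ?_
    rw [← h, mul_comm _ q, mul_zsmul, natCast_zsmul, D.nsmul_α, ← map_zsmul, zsmul_eq_mul]
  have key : ∀ k : ℤ, ((k : ℤ) : ZMod 2) = 0 → gz (t := t) ε ^ k = 1 := fun k hk => by
    rw [ZMod.intCast_zmod_eq_zero_iff_dvd] at hk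
    obtain ⟨r, rfl⟩ := hk
    rw [zpow_mul]
    norm_cast
    rw [pow_two, gz_sq, one_zpow]
  rw [hq]
  rcases zmod_two_cases ε.exponent with h0 | h0
  · rw [if_pos h0, one_zpow, one_mul]
    exact key m (by rw [← hm, h0, mul_zero])
  · rw [h0, mul_one] at hm
    rw [if_neg (by rw [h0]; decide), ← zpow_add]
    exact key _ (by push_cast; rw [hm]; exact CharTwo.add_self_eq_zero _)

lemma action_lowX_base (y : ZMod t → Multiplicative (ZMod 2)) :
    D.action (lowX ε y) base = base := by
  induction y using bits_induction with
  | one => rw [map_one, action_one]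
  | single j =>
    rw [prodX_mulSingle, action_gx, xFun]
    simp [base, half_lower]
  | mul f g hf hg => rw [map_mul, action_mul, hg, hf]

/-- The stabiliser of the base vertex is `H`. -/
lemma action_base_iff {g : ExtGroup t ε} : D.action g base = base ↔ g ∈ ExtH t ε := by
  have hH : ∀ h ∈ ExtH t ε, D.action h base = base := by
    intro h hh
    obtain ⟨y, rfl | rfl⟩ := exists_of_mem_ExtH ε hh
    · exact D.action_lowX_base y
    · rw [action_mul, action_gb, bFun, base, neg_zero]
      exact D.action_lowX_base y
  refine ⟨fun hg => ?_, hH g⟩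
  obtain ⟨h, hh, y, n, m, rfl⟩ := exists_normalForm ε g
  have h1 : D.action (highX ε y) (D.τ (m : ZMod 2) - n • D.α, 0) = base := by
    have h2 := congrArg (D.action h⁻¹) hg
    rw [hH _ (inv_mem hh), ← action_mul] at h2
    simp only [← mul_assoc, inv_mul_cancel, one_mul] at h2
    rw [action_mul, action_gz_zpow, action_mul] at h2
    simpa only [base, zero_add, action_ga_zpow] using h2
  obtain ⟨hπ, hbits⟩ := D.action_prodX upper red_upper y (D.τ (m : ZMod 2) - n • D.α, 0)
  rw [h1] at hπ hbits
  -- At level 0 the window consists of the upper indices, so each upper generator flips its bit; as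
  -- no bit changes, none of them occurs.
  have hy : y = 1 := by
    funext j
    have := hbits j
    rw [← hπ] at this
    simp only [base, map_zero, sub_zero, half_upper, mul_one, Pi.zero_apply, zero_add] at this
    exact this.symm
  rw [hy, map_one, action_one] at h1
  have h2 : n • D.α = D.τ (m : ZMod 2) := (sub_eq_zero.1 (congrArg Prod.fst h1)).symm
  rw [hy, map_one, mul_one, mul_assoc, D.zpow_eq_of_smul_α n m h2, mul_one]
  exact hh

/-- At level `t` the window is `0, …, t - 1`, so the generators of `H` act there by independent
flips. -/
lemma eq_one_of_action_lowX {y : ZMod t → Multiplicative (ZMod 2)}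
    (h : ∀ v, D.action (lowX ε y) v = v) : y = 1 := by
  funext j
  have h1 := (D.action_prodX lower red_lower y (t • D.α, 0)).2 j
  rw [h] at h1
  have h2 : half (lower j - (t : ZMod (2 * t))) = 1 := by
    have : lower j - (t : ZMod (2 * t)) = upper j := by
      rw [upper]; linear_combination -t_add_t t
    rw [this, half_upper]
  simp only [map_nsmul, D.π_α, nsmul_one, h2, Pi.zero_apply, zero_add, mul_one] at h1
  exact h1.symm

/-- The kernel lies in `H`. Elements of `H` involving `b` move level `1` to level `-1`, and the
others are seen on level `t`. -/
lemma action_injective : Function.Injective D.action := by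
  rw [injective_iff_map_eq_one]
  intro g hg
  have hv : ∀ v, D.action g v = v := fun v => by rw [hg]; rfl
  obtain ⟨y, rfl | rfl⟩ := exists_of_mem_ExtH ε (D.action_base_iff.1 (hv base))
  · rw [D.eq_one_of_action_lowX hv, map_one]
  · exfalso
    have h1 := (D.action_prodX lower red_lower y (bFun (D.α, 0))).1
    have h2 := hv (D.α, 0)
    rw [action_mul, action_gb] at h2
    rw [h2] at h1
    simp only [bFun, map_neg, D.π_α] at h1
    exact one_ne_neg_one h1

/-- The elements of `G` that preserve the orientation of the edges. -/
def Oriented (g : ExtGroup t ε) : Prop :=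
  ∀ u v, D.Up u v → D.Up (D.action g u) (D.action g v)

lemma oriented_one : D.Oriented 1 := fun u v h => by rwa [action_one, action_one]

lemma Oriented.mul {D : PhaseGroup t ε A} {g h : ExtGroup t ε} (hg : D.Oriented g)
    (hh : D.Oriented h) : D.Oriented (g * h) := fun u v huv => by
  rw [action_mul, action_mul]
  exact hg _ _ (hh _ _ huv)

lemma Oriented.inv {D : PhaseGroup t ε A} {g : ExtGroup t ε} (hg : D.Oriented g) :
    D.Oriented g⁻¹ := fun u v h => by
  have hadj : D.graph.Adj (D.action g⁻¹ u) (D.action g⁻¹ v) :=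
    (D.action g⁻¹).map_rel_iff.2 (D.adj_iff.2 (Or.inl h))
  refine (D.adj_iff.1 hadj).resolve_right fun h' => ?_
  have h2 := hg _ _ h'
  rw [action_action_inv, action_action_inv] at h2
  exact D.not_up_of_up h h2

lemma oriented_gx (i : ZMod (2 * t)) : D.Oriented (gx ε i) := fun u v h => by
  rw [action_gx, action_gx]; exact D.up_xFun i h

lemma oriented_gz : D.Oriented (gz ε) := fun u v h => by
  have : D.res (u.1 + D.τ 1) = D.res u.1 := by rw [res, map_add, D.π_τ, add_zero, res]
  rw [action_gz, action_gz]
  refine ⟨?_, ?_⟩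
  · simp only [this]
    rw [h.1]
    generalize D.τ (_ * _) = c
    abel
  · simp only [this]
    exact h.2

lemma oriented_ga : D.Oriented (ga ε) := fun u v h => by
  have : D.res (u.1 - D.α) = D.res u.1 - 1 := by
    rw [res, map_sub, D.π_α, map_sub, map_one, res]
  rw [action_ga, action_ga]
  refine ⟨?_, ?_⟩
  · simp only [this, sub_add_cancel]
    rw [h.1]
    generalize D.τ (_ * _) = c
    abel
  · simp only [this]
    exact fun j hj => h.2 _ fun h' => hj (eq_sub_of_add_eq h')

lemma Oriented.pow {D : PhaseGroup t ε A} {g : ExtGroup t ε} (hg : D.Oriented g) (n : ℕ) :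
    D.Oriented (g ^ n) := by
  induction n with
  | zero => rw [pow_zero]; exact D.oriented_one
  | succ n ih => rw [pow_succ]; exact ih.mul hg

lemma oriented_prodX (l : ZMod t → ZMod (2 * t)) (hl : ∀ j, red t (l j) = j)
    (y : ZMod t → Multiplicative (ZMod 2)) : D.Oriented (prodX ε l hl y) := by
  induction y using bits_induction with
  | one => rw [map_one]; exact D.oriented_one
  | single i => rw [prodX_mulSingle]; exact D.oriented_gx _
  | mul f g hf hg => rw [map_mul]; exact hf.mul hg

lemma action_ga_pow (n : ℕ) (v : A × (ZMod t → ZMod 2)) :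
    D.action (ga ε ^ n) v = (v.1 - n • D.α, fun j => v.2 (j + n)) := by
  rw [map_pow, action_gen]; exact D.aIso_pow_apply n v

/-- Elements acting on vertices with prescribed changes of the bits. -/
lemma exists_flip (c : ZMod (2 * t) → ZMod 2) :
    ∃ g : ExtGroup t ε, D.Oriented g ∧ ∀ v, D.π (D.action g v).1 = D.π v.1 ∧
      ∀ p, half (p - D.π v.1) = 1 → (D.action g v).2 (red t p) = v.2 (red t p) + c p := by
  refine ⟨lowX ε (fun j => Multiplicative.ofAdd (c (lower j))) *
    highX ε (fun j => Multiplicative.ofAdd (c (upper j))),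
    (D.oriented_prodX _ _ _).mul (D.oriented_prodX _ _ _), fun v => ?_⟩
  rw [action_mul]
  obtain ⟨h1, h2⟩ := D.action_prodX upper red_upper
    (fun j => Multiplicative.ofAdd (c (upper j))) v
  obtain ⟨h3, h4⟩ := D.action_prodX lower red_lower
    (fun j => Multiplicative.ofAdd (c (lower j)))
    (D.action (highX ε (fun j => Multiplicative.ofAdd (c (upper j)))) v)
  refine ⟨h3.trans h1, fun p hp => ?_⟩
  rw [h4, h1, h2, toAdd_ofAdd, toAdd_ofAdd, half_upper_sub]
  -- Of the two lifts of a residue exactly one is visible, so only the change prescribed for that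
  -- lift takes effect.
  rcases eq_lower_or_eq_upper p with h | h
  · rw [← h, hp, show (1 : ZMod 2) + 1 = 0 from rfl]; ring
  · have hl : half (lower (red t p) - D.π v.1) = 0 := by
      rw [h, half_upper_sub] at hp
      linear_combination hp
    rw [← h, hl]; ring

lemma exists_window (k : ZMod (2 * t)) (j : ZMod t) : ∃ p, half (p - k) = 1 ∧ red t p = j := by
  rcases zmod_two_cases (half (lower j - k)) with h | h
  · exact ⟨upper j, by rw [half_upper_sub, h, zero_add], red_upper j⟩
  · exact ⟨lower j, h, red_lower j⟩

/-- The orientation-preserving elements of `G` are transitive on the vertices. -/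
lemma exists_oriented_to_base (v : A × (ZMod t → ZMod 2)) :
    ∃ g : ExtGroup t ε, D.Oriented g ∧ D.action g v = base := by
  -- A power of `a` corrects the level and a flip clears the bits. The phase left over is in the
  -- kernel of `π`, which `z` corrects.
  obtain ⟨n, -, hn⟩ := exists_natCast (D.π v.1)
  set w := D.action (ga ε ^ n) v with hw
  have hw0 : D.π w.1 = 0 := by
    rw [hw, action_ga_pow, map_sub, map_nsmul, D.π_α, nsmul_one, hn, sub_self]
  obtain ⟨g, hg, hg'⟩ := D.exists_flip (fun p => w.2 (red t p))
  obtain ⟨h1, h2⟩ := hg' w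
  set u := D.action g w with hu
  have hu2 : u.2 = 0 := by
    funext j
    obtain ⟨p, hp, rfl⟩ := exists_window (D.π w.1) j
    rw [h2 p hp]; exact CharTwo.add_self_eq_zero _
  obtain ⟨c, hc⟩ := D.exists_of_π_eq_zero u.1 (h1.trans hw0)
  rcases zmod_two_cases c with rfl | rfl
  · refine ⟨g * ga ε ^ n, hg.mul (D.oriented_ga.pow n), ?_⟩
    rw [action_mul, ← hw, ← hu]
    exact Prod.ext (by rw [hc, map_zero]; rfl) hu2
  · refine ⟨gz ε * (g * ga ε ^ n), D.oriented_gz.mul (hg.mul (D.oriented_ga.pow n)), ?_⟩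
    rw [action_mul, action_mul, ← hw, ← hu, action_gz]
    exact Prod.ext (by simp only; rw [hc, D.τ_mul_self]; rfl) hu2

/-- The upper neighbour of `v` with new bit `w`. -/
def up (w : ZMod 2) (v : A × (ZMod t → ZMod 2)) : A × (ZMod t → ZMod 2) :=
  (v.1 + D.α + D.τ (v.2 (D.res v.1) * w), Function.update v.2 (D.res v.1) w)

lemma up_up (w : ZMod 2) (v : A × (ZMod t → ZMod 2)) : D.Up v (D.up w v) :=
  ⟨by simp [up], fun j hj => by simp [up, hj]⟩

lemma up_iff {u v : A × (ZMod t → ZMod 2)} : D.Up u v ↔ v = D.up (v.2 (D.res u.1)) u := by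
  constructor
  · rintro ⟨h1, h2⟩
    refine Prod.ext h1 (funext fun j => ?_)
    by_cases hj : j = D.res u.1
    · subst hj; simp [up]
    · simp [up, hj, h2 j hj]
  · intro h; rw [h]; exact D.up_up _ _

/-- The lower neighbour of `v` with new bit `w`. -/
def dn (w : ZMod 2) (v : A × (ZMod t → ZMod 2)) : A × (ZMod t → ZMod 2) :=
  (v.1 - D.α - D.τ (v.2 (D.res v.1 - 1) * w), Function.update v.2 (D.res v.1 - 1) w)

lemma res_dn (w : ZMod 2) (v : A × (ZMod t → ZMod 2)) :
    D.res (D.dn w v).1 = D.res v.1 - 1 := by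
  simp only [res, dn, map_sub, D.π_τ, D.π_α, sub_zero, map_one]

lemma up_dn (w : ZMod 2) (v : A × (ZMod t → ZMod 2)) : D.Up (D.dn w v) v := by
  refine ⟨?_, fun j hj => ?_⟩
  · rw [res_dn]
    simp only [dn, Function.update_self]
    rw [mul_comm w]; abel
  · rw [res_dn] at hj
    simp [dn, hj]

lemma dn_iff {u v : A × (ZMod t → ZMod 2)} :
    D.Up u v ↔ u = D.dn (u.2 (D.res v.1 - 1)) v := by
  constructor
  · intro h
    have hr : D.res u.1 = D.res v.1 - 1 := by rw [D.res_of_up h, add_sub_cancel_right]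
    obtain ⟨h1, h2⟩ := h
    refine Prod.ext ?_ (funext fun j => ?_)
    · rw [dn, ← hr, h1, mul_comm (v.2 _)]; simp only; abel
    · rw [hr] at h2
      by_cases hj : j = D.res v.1 - 1
      · subst hj; simp [dn]
      · simp [dn, hj, h2 j hj]
  · intro h; rw [h]; exact D.up_dn _ _

/-- `G` is transitive on upward arcs, through orientation-preserving elements. -/
lemma exists_oriented_arc {u v : A × (ZMod t → ZMod 2)} (h : D.Up u v) :
    ∃ g : ExtGroup t ε, D.Oriented g ∧ D.action g u = base ∧ D.action g v = (D.α, 0) := by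
  obtain ⟨g, hg, hgu⟩ := D.exists_oriented_to_base u
  have h1 := hg _ _ h
  rw [hgu] at h1
  rw [up_iff] at h1
  have hr : D.res (base : A × (ZMod t → ZMod 2)).1 = 0 := by simp [res, base]
  rcases zmod_two_cases ((D.action g v).2 (D.res (base : A × (ZMod t → ZMod 2)).1)) with h0 | h0
  · refine ⟨g, hg, hgu, ?_⟩
    rw [h1, h0, up, hr]
    simp [base]
  · have hl : lower (0 : ZMod t) = 0 := by simp [lower]
    -- `x_0` fixes the base vertex and exchanges its two upper neighbours.
    refine ⟨gx ε 0 * g, (D.oriented_gx 0).mul hg, ?_, ?_⟩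
    · rw [action_mul, hgu, D.action_base_iff, ← hl]
      exact gx_lower_mem ε 0
    · rw [action_mul, h1, h0, action_gx, up, hr]
      have hh : half (0 - 1 : ZMod (2 * t)) = 1 := by rw [zero_sub, half_neg_one]
      simp only [base, xFun, Pi.zero_apply, zero_mul, map_zero, add_zero, zero_add, D.π_α, hh,
        show (1 + 1 : ZMod 2) = 0 from rfl]
      refine Prod.ext rfl (funext fun j => ?_)
      by_cases hj : j = 0
      · subst hj; simp; rfl
      · simp [hj]

end PhaseGroup

/-! ### The coset graph is the model; orders of vertex set and stabilisers. -/

namespace PhaseGroup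

variable {t : ℕ} {ε : Sgn} {A : Type} [AddCommGroup A] (D : PhaseGroup t ε A)
variable [hF : Fact (2 ≤ t)]

/-- The coset `H g` corresponds to the image of the base vertex under `g`. -/
def ofCoset : RightCosets (ExtH t ε) → A × (ZMod t → ZMod 2) :=
  Quotient.lift (fun x => D.action x⁻¹ base) (by
    intro x y h
    have h' := D.action_base_iff.2 (QuotientGroup.rightRel_apply.1 h)
    change D.action x⁻¹ base = D.action y⁻¹ base
    rw [action_mul] at h'
    rw [← D.action_inv_action y (D.action x⁻¹ base), h'])

lemma ofCoset_rightCoset (x : ExtGroup t ε) :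
    D.ofCoset (rightCoset (ExtH t ε) x) = D.action x⁻¹ base := rfl

lemma ofCoset_bijective : Function.Bijective D.ofCoset := by
  constructor
  · rintro ⟨x⟩ ⟨y⟩ h
    change D.action x⁻¹ base = D.action y⁻¹ base at h
    refine Quotient.sound (QuotientGroup.rightRel_apply.2 (D.action_base_iff.1 ?_))
    rw [action_mul, h, action_action_inv]
  · intro v
    obtain ⟨g, -, hg⟩ := D.exists_oriented_to_base v
    refine ⟨rightCoset _ g, ?_⟩
    rw [ofCoset_rightCoset, ← hg, action_inv_action]

lemma ofCoset_action (g : ExtGroup t ε) (v : RightCosets (ExtH t ε)) :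
    D.ofCoset (extAction t ε g v) = D.action g (D.ofCoset v) := by
  obtain ⟨x⟩ := v
  change D.action (x * g⁻¹)⁻¹ base = D.action g (D.action x⁻¹ base)
  rw [mul_inv_rev, inv_inv, action_mul]

/-- Since `a⁻¹` sends the base vertex to `(α, 0)`, the edge `{H g, H a g}` corresponds to the image
under `g⁻¹` of the basic arc, and `exists_oriented_arc` says that every upward arc is such an image.
-/
lemma up_ofCoset_iff (p q : RightCosets (ExtH t ε)) :
    D.Up (D.ofCoset p) (D.ofCoset q) ∨ D.Up (D.ofCoset q) (D.ofCoset p) ↔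
      (∃ g : ExtGroup t ε, p = rightCoset (ExtH t ε) g ∧ q = rightCoset (ExtH t ε) (ga ε * g)) ∨
      ∃ g : ExtGroup t ε, q = rightCoset (ExtH t ε) g ∧ p = rightCoset (ExtH t ε) (ga ε * g) := by
  have ha : D.action (ga ε)⁻¹ base = (D.α, 0) := by
    rw [action_ga_inv]
    exact Prod.ext (zero_add _) rfl
  have hup : D.Up (base : A × (ZMod t → ZMod 2)) (D.α, 0) := by
    refine ⟨?_, fun _ _ => rfl⟩
    simp [base]
  have h1 : ∀ p q : RightCosets (ExtH t ε), D.Up (D.ofCoset p) (D.ofCoset q) →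
      ∃ g : ExtGroup t ε, p = rightCoset (ExtH t ε) g ∧ q = rightCoset (ExtH t ε) (ga ε * g) := by
    intro p q h
    obtain ⟨g, -, h1, h2⟩ := D.exists_oriented_arc h
    refine ⟨g, D.ofCoset_bijective.1 ?_, D.ofCoset_bijective.1 ?_⟩
    · rw [ofCoset_rightCoset, ← h1, action_inv_action]
    · rw [ofCoset_rightCoset, mul_inv_rev, action_mul, ha, ← h2, action_inv_action]
  have h2 : ∀ p q : RightCosets (ExtH t ε), (∃ g : ExtGroup t ε, p = rightCoset (ExtH t ε) g ∧
      q = rightCoset (ExtH t ε) (ga ε * g)) → D.graph.Adj (D.ofCoset p) (D.ofCoset q) := by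
    rintro _ _ ⟨g, rfl, rfl⟩
    rw [ofCoset_rightCoset, ofCoset_rightCoset, mul_inv_rev, action_mul, ha]
    exact (D.action g⁻¹).map_rel_iff.2 (D.adj_iff.2 (Or.inl hup))
  constructor
  · rintro (h | h)
    · exact Or.inl (h1 _ _ h)
    · exact Or.inr (h1 _ _ h)
  · rintro (h | h)
    · exact D.adj_iff.1 (h2 _ _ h)
    · exact D.adj_iff.1 (h2 _ _ h).symm

/-- The graph `Γ_t^±` is isomorphic to the model. -/
noncomputable def cosetIso : ExtGraph t ε ≃g D.graph where
  toEquiv := Equiv.ofBijective D.ofCoset D.ofCoset_bijective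
  map_rel_iff' := by
    intro p q
    rw [D.adj_iff]
    change D.Up (D.ofCoset p) (D.ofCoset q) ∨ D.Up (D.ofCoset q) (D.ofCoset p) ↔ _
    have h0 := D.adj_iff (u := D.ofCoset p) (v := D.ofCoset q)
    rw [up_ofCoset_iff]
    rw [up_ofCoset_iff] at h0
    simp only [ExtGraph, cosetGraph, SimpleGraph.fromRel_adj]
    refine ⟨fun h => ⟨fun hpq => ?_, h⟩, fun h => h.2⟩
    rw [hpq] at h0 h
    exact D.graph.loopless.irrefl _ (h0.2 h)

lemma cosetIso_apply (v : RightCosets (ExtH t ε)) : D.cosetIso v = D.ofCoset v := rfl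

lemma cosetIso_action (g : ExtGroup t ε) (v : RightCosets (ExtH t ε)) :
    D.cosetIso (extAction t ε g v) = D.action g (D.cosetIso v) := D.ofCoset_action g v

include D in
lemma extAction_injective : Function.Injective (extAction t ε) := by
  refine fun g h hgh => D.action_injective (RelIso.ext fun v => ?_)
  obtain ⟨u, rfl⟩ := D.cosetIso.surjective v
  rw [← cosetIso_action, ← cosetIso_action, hgh]

include D in
-- The level map has index `2t`, and its kernel is the image of `τ`, of order 2.
lemma card_phase : Nat.card A = 4 * t := by
  have h1 := AddSubgroup.card_mul_index D.π.ker
  have h2 : D.π.ker.index = 2 * t := by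
    rw [AddSubgroup.index_ker, AddMonoidHom.range_eq_top.2, AddSubgroup.card_top, Nat.card_zmod]
    intro k
    obtain ⟨n, -, rfl⟩ := exists_natCast k
    exact ⟨n • D.α, by rw [map_nsmul, D.π_α, nsmul_one]⟩
  have h3 : Nat.card D.π.ker = 2 := by
    have : D.π.ker = D.τ.range := by
      ext κ
      constructor
      · intro h
        obtain ⟨c, rfl⟩ := D.exists_of_π_eq_zero κ h
        exact ⟨c, rfl⟩
      · rintro ⟨c, rfl⟩
        exact D.π_τ c
    rw [this, ← Nat.card_congr (AddMonoidHom.ofInjective D.τ_injective).toEquiv, Nat.card_zmod]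
  rw [← h1, h2, h3]; ring

include D in
lemma card_rightCosets : Nat.card (RightCosets (ExtH t ε)) = t * 2 ^ (t + 2) := by
  rw [Nat.card_congr D.cosetIso.toEquiv, Nat.card_prod, D.card_phase, Nat.card_fun, Nat.card_zmod,
    Nat.card_zmod]
  ring

include D in
lemma card_ExtH : Nat.card (ExtH t ε) = 2 ^ (t + 1) := by
  let f : (ZMod t → Multiplicative (ZMod 2)) × ZMod 2 → ExtH t ε := fun p =>
    ⟨lowX ε p.1 * gb ε ^ p.2.val, mul_mem (lowX_mem ε _) (pow_mem (gb_mem ε) _)⟩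
  have key : ∀ y y' : ZMod t → Multiplicative (ZMod 2), lowX ε y ≠ lowX ε y' * gb ε := by
    intro y y' h
    have h1 : D.action (lowX ε y) (D.α, 0) = D.action (lowX ε y' * gb ε) (D.α, 0) := by rw [h]
    have h2 := (D.action_prodX lower red_lower y (D.α, 0)).1
    have h3 := (D.action_prodX lower red_lower y' (bFun (D.α, 0))).1
    rw [h1, action_mul, action_gb, h3] at h2
    simp only [bFun, map_neg, D.π_α] at h2
    exact one_ne_neg_one h2.symm
  have key2 : ∀ y y' : ZMod t → Multiplicative (ZMod 2), lowX ε y = lowX ε y' → y = y' := by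
    intro y y' h
    refine (div_eq_one.1 (D.eq_one_of_action_lowX fun v => ?_))
    rw [map_div, h, div_self', action_one]
  have hf : Function.Bijective f := by
    constructor
    · rintro ⟨y, c⟩ ⟨y', c'⟩ h
      have h' : lowX ε y * gb ε ^ c.val = lowX ε y' * gb ε ^ c'.val := congrArg Subtype.val h
      rcases zmod_two_cases c with rfl | rfl <;> rcases zmod_two_cases c' with rfl | rfl <;>
        simp only [ZMod.val_zero, ZMod.val_one, pow_zero, pow_one, mul_one, mul_left_inj] at h'
      · rw [key2 _ _ h']
      · exact absurd h' (key _ _)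
      · exact absurd h'.symm (key _ _)
      · rw [key2 _ _ h']
    · rintro ⟨h, hh⟩
      obtain ⟨y, rfl | rfl⟩ := exists_of_mem_ExtH ε hh
      · exact ⟨(y, 0), Subtype.ext (by simp [f])⟩
      · exact ⟨(y, 1), Subtype.ext (by simp [f, ZMod.val_one])⟩
  rw [← Nat.card_congr (Equiv.ofBijective f hf), Nat.card_prod, Nat.card_fun, Nat.card_zmod,
    Nat.card_zmod]
  change Nat.card (ZMod 2) ^ t * 2 = _
  rw [Nat.card_zmod, pow_succ]

include D in
lemma card_vertexStabilizer (v : RightCosets (ExtH t ε)) :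
    Nat.card (vertexStabilizer (extAction t ε) v) = 2 ^ (t + 1) := by
  rw [← D.card_ExtH]
  obtain ⟨x, hx⟩ : ∃ x, rightCoset (ExtH t ε) x = v := by
    obtain ⟨x⟩ := v
    exact ⟨x, rfl⟩
  refine Nat.card_congr ((MulAut.conj x).toEquiv.subtypeEquiv fun g => ?_)
  have h1 : g ∈ vertexStabilizer (extAction t ε) v ↔ extAction t ε g v = v := Iff.rfl
  rw [h1, ← D.cosetIso.injective.eq_iff, cosetIso_action, ← hx, cosetIso_apply,
    ofCoset_rightCoset, ← D.action_base_iff]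
  change _ ↔ D.action (x * g * x⁻¹) base = base
  rw [action_mul, action_mul]
  constructor
  · intro h; rw [h, action_action_inv]
  · intro h
    have := congrArg (D.action x⁻¹) h
    rwa [action_inv_action] at this

end PhaseGroup

/-! ### Automorphisms that respect upper and lower neighbours belong to `G`. -/

namespace PhaseGroup

variable {t : ℕ} {ε : Sgn} {A : Type} [AddCommGroup A] (D : PhaseGroup t ε A)
variable [hF : Fact (2 ≤ t)]

lemma up_base : D.Up (base : A × (ZMod t → ZMod 2)) (D.α, 0) :=
  ⟨by simp [base], fun _ _ => rfl⟩

/-- The elements that keep the base vertex in its component form a subgroup. It contains `H` and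
`a`, and these generate `G`: the conjugates of `x_0` under `a` are all the `x_i`, and `z` is a
commutator of two of them. -/
lemma reachable_base (g : ExtGroup t ε) : D.graph.Reachable base (D.action g base) := by
  let S : Subgroup (ExtGroup t ε) :=
    { carrier := {g | D.graph.Reachable base (D.action g base)}
      one_mem' := by
        change D.graph.Reachable base (D.action 1 base)
        rw [action_one]
      mul_mem' := by
        intro g h hg hh
        change D.graph.Reachable base (D.action (g * h) base)
        rw [action_mul]
        exact SimpleGraph.Reachable.trans hg (hh.map (D.action g).toHom)
      inv_mem' := by
        intro g hg
        have h := SimpleGraph.Reachable.map (D.action g⁻¹).toHom hg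
        change D.graph.Reachable (D.action g⁻¹ base) (D.action g⁻¹ (D.action g base)) at h
        rw [action_inv_action] at h
        exact h.symm }
  have hH : ∀ h ∈ ExtH t ε, h ∈ S := fun h hh => by
    change D.graph.Reachable base (D.action h base)
    rw [D.action_base_iff.2 hh]
  have ha : ga ε ∈ S := by
    rw [← S.inv_mem_iff]
    change D.graph.Reachable base (D.action (ga ε)⁻¹ base)
    have e : D.action (ga ε)⁻¹ base = (D.α, 0) := by
      rw [action_ga_inv]
      exact Prod.ext (zero_add _) rfl
    rw [e]
    exact (D.adj_iff.2 (Or.inl D.up_base)).reachable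
  have hx : ∀ i, gx ε i ∈ S := by
    intro i
    obtain ⟨n, -, rfl⟩ := exists_natCast i
    have h := ga_zpow_mul_gx (t := t) ε (-n) 0
    have e : (0 : ZMod (2 * t)) - ((-n : ℤ) : ZMod (2 * t)) = n := by push_cast; ring
    rw [e] at h
    rw [eq_mul_inv_of_mul_eq h.symm]
    refine mul_mem (mul_mem (zpow_mem ha _) (hH _ ?_)) (inv_mem (zpow_mem ha _))
    have := gx_lower_mem (t := t) ε 0
    simpa [lower] using this
  have hz : gz ε ∈ S := by
    have h := gx_mul_gx_add_t (t := t) ε 0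
    rw [eq_inv_mul_of_mul_eq h.symm]
    exact mul_mem (inv_mem (mul_mem (hx _) (hx _))) (mul_mem (hx _) (hx _))
  have : S = ⊤ := eq_top_of_gen_mem ε fun g => by
    cases g with
    | x i => exact hx i
    | z => exact hz
    | a => exact ha
    | b => exact hH _ (gb_mem ε)
  have hg : g ∈ S := this ▸ Subgroup.mem_top g
  exact hg

lemma connected : D.graph.Connected := by
  have h : ∀ v, D.graph.Reachable base v := fun v => by
    obtain ⟨g, -, hg⟩ := D.exists_oriented_to_base v
    rw [← D.action_inv_action g v, hg]
    exact D.reachable_base g⁻¹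
  have : Nonempty (A × (ZMod t → ZMod 2)) := ⟨base⟩
  exact ⟨fun u v => (h u).symm.trans (h v)⟩

/-- This is how local information is made global: a quantity that is the same at both ends of every
edge is constant by connectedness. -/
lemma eq_of_forall_up {β : Type*} (f : A × (ZMod t → ZMod 2) → β)
    (h : ∀ u v, D.Up u v → f u = f v) (u v : A × (ZMod t → ZMod 2)) : f u = f v := by
  obtain ⟨p⟩ := D.connected.preconnected u v
  induction p with
  | nil => rfl
  | cons hadj _ ih =>
    refine Eq.trans ?_ ih
    rcases D.adj_iff.1 hadj with h' | h'
    · exact h _ _ h'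
    · exact (h _ _ h').symm

/-- `w` and `w'` are both upper or both lower neighbours of `v`. -/
def Side (v w w' : A × (ZMod t → ZMod 2)) : Prop :=
  (D.Up v w ∧ D.Up v w') ∨ (D.Up w v ∧ D.Up w' v)

lemma eq_of_three_upper {v a b c : A × (ZMod t → ZMod 2)} (ha : D.Up v a) (hb : D.Up v b)
    (hc : D.Up v c) : a = b ∨ a = c ∨ b = c := by
  rw [up_iff] at ha hb hc
  rw [ha, hb, hc]
  rcases zmod_two_cases (a.2 (D.res v.1)) with h1 | h1 <;>
  rcases zmod_two_cases (b.2 (D.res v.1)) with h2 | h2 <;>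
  rcases zmod_two_cases (c.2 (D.res v.1)) with h3 | h3 <;> simp [h1, h2, h3]

lemma eq_of_three_lower {v a b c : A × (ZMod t → ZMod 2)} (ha : D.Up a v) (hb : D.Up b v)
    (hc : D.Up c v) : a = b ∨ a = c ∨ b = c := by
  rw [dn_iff] at ha hb hc
  rw [ha, hb, hc]
  rcases zmod_two_cases (a.2 (D.res v.1 - 1)) with h1 | h1 <;>
  rcases zmod_two_cases (b.2 (D.res v.1 - 1)) with h2 | h2 <;>
  rcases zmod_two_cases (c.2 (D.res v.1 - 1)) with h3 | h3 <;> simp [h1, h2, h3]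

lemma up_zero_ne_up_one (v : A × (ZMod t → ZMod 2)) : D.up 0 v ≠ D.up 1 v := by
  intro h
  have := congrFun (congrArg Prod.snd h) (D.res v.1)
  simp [up] at this

lemma dn_zero_ne_dn_one (v : A × (ZMod t → ZMod 2)) : D.dn 0 v ≠ D.dn 1 v := by
  intro h
  have := congrFun (congrArg Prod.snd h) (D.res v.1 - 1)
  simp [dn] at this

/-- `φ` sends upper neighbours of `v` to upper neighbours, and lower ones to lower ones. -/
def Direct (φ : D.graph ≃g D.graph) (v : A × (ZMod t → ZMod 2)) : Prop :=
  (∀ w, D.Up v w → D.Up (φ v) (φ w)) ∧ ∀ w, D.Up w v → D.Up (φ w) (φ v)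

/-- `φ` exchanges upper and lower neighbours of `v`. -/
def Reverse (φ : D.graph ≃g D.graph) (v : A × (ZMod t → ZMod 2)) : Prop :=
  (∀ w, D.Up v w → D.Up (φ w) (φ v)) ∧ ∀ w, D.Up w v → D.Up (φ v) (φ w)

lemma map_up {φ : D.graph ≃g D.graph} {u v : A × (ZMod t → ZMod 2)} (h : D.Up u v) :
    D.Up (φ u) (φ v) ∨ D.Up (φ v) (φ u) :=
  D.adj_iff.1 (φ.map_rel_iff.2 (D.adj_iff.2 (Or.inl h)))

/-- The images of the two upper neighbours of `v` lie on one side of `φ v` and fill it, as a side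
has only two vertices. The lower neighbours are left with the other side. -/
lemma direct_or_reverse {φ : D.graph ≃g D.graph}
    (hφ : ∀ v w w', D.Side v w w' → D.Side (φ v) (φ w) (φ w')) (v : A × (ZMod t → ZMod 2)) :
    D.Direct φ v ∨ D.Reverse φ v := by
  have hne : φ (D.up 0 v) ≠ φ (D.up 1 v) := φ.injective.ne (D.up_zero_ne_up_one v)
  have hne' : ∀ {w}, D.Up w v → ∀ c, φ w ≠ φ (D.up c v) := fun {w} hw c h => by
    rw [φ.injective h] at hw
    exact D.not_up_of_up hw (D.up_up c v)
  have hc : ∀ w, D.Up v w → D.Side (φ v) (φ (D.up 0 v)) (φ w) := fun w hw =>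
    hφ _ _ _ (Or.inl ⟨D.up_up 0 v, hw⟩)
  rcases D.map_up (φ := φ) (D.up_up 0 v) with h0 | h0
  · left
    have h1 : ∀ w, D.Up v w → D.Up (φ v) (φ w) := fun w hw =>
      ((hc w hw).resolve_right fun h => D.not_up_of_up h0 h.1).2
    refine ⟨h1, fun w hw => (D.map_up hw).resolve_right fun h => ?_⟩
    rcases D.eq_of_three_upper h0 (h1 _ (D.up_up 1 v)) h with h' | h' | h'
    · exact hne h'
    · exact hne' hw 0 h'.symm
    · exact hne' hw 1 h'.symm
  · right
    have h1 : ∀ w, D.Up v w → D.Up (φ w) (φ v) := fun w hw =>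
      ((hc w hw).resolve_left fun h => D.not_up_of_up h0 h.1).2
    refine ⟨h1, fun w hw => (D.map_up hw).resolve_left fun h => ?_⟩
    rcases D.eq_of_three_lower h0 (h1 _ (D.up_up 1 v)) h with h' | h' | h'
    · exact hne h'
    · exact hne' hw 0 h'.symm
    · exact hne' hw 1 h'.symm

/-- An automorphism preserving the two sides of every neighbourhood preserves or reverses the
orientation of all edges. -/
lemma preserves_or_reverses_up {φ : D.graph ≃g D.graph}
    (hφ : ∀ v w w', D.Side v w w' → D.Side (φ v) (φ w) (φ w')) :
    (∀ u v, D.Up u v → D.Up (φ u) (φ v)) ∨ (∀ u v, D.Up u v → D.Up (φ v) (φ u)) := by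
  have hex : ∀ v, D.Reverse φ v → ¬ D.Direct φ v := fun v h h' =>
    D.not_up_of_up (h.1 _ (D.up_up 0 v)) (h'.1 _ (D.up_up 0 v))
  -- An edge joining a vertex of one kind to a vertex of the other would have an image directed both
  -- ways.
  have hstep : ∀ u v, D.Up u v → D.Direct φ u = D.Direct φ v := by
    intro u v h
    refine propext ⟨fun hu => (D.direct_or_reverse hφ v).resolve_right fun hv => ?_,
      fun hv => (D.direct_or_reverse hφ u).resolve_right fun hu => ?_⟩
    · exact D.not_up_of_up (hu.1 _ h) (hv.2 _ h)
    · exact D.not_up_of_up (hu.1 _ h) (hv.2 _ h)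
  have hconst := D.eq_of_forall_up _ hstep
  rcases D.direct_or_reverse hφ base with h | h
  · refine Or.inl fun u v huv => ?_
    have hu : D.Direct φ u := hconst base u ▸ h
    exact hu.1 _ huv
  · refine Or.inr fun u v huv => ?_
    have hu : ¬ D.Direct φ u := hconst base u ▸ hex _ h
    exact ((D.direct_or_reverse hφ u).resolve_left hu).1 _ huv

/-- On the vertices of level `k`, the last `m` of the levels are reached by `m` upward steps with
new bits `0`. -/
lemma zero_steps (p : ZMod (2 * t)) {β : Type*} (f : A × (ZMod t → ZMod 2) → β)
    (hf : ∀ u v, D.Up u v → half (p - D.π u.1) = 1 → half (p - D.π v.1) = 1 → f u = f v)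
    {v : A × (ZMod t → ZMod 2)} (hv : D.π v.1 = p + 1) (m : ℕ) (hm : m + 1 ≤ t) :
    f v = f (v.1 + m • D.α, fun i => if (i - red t p - 1).val < m then 0 else v.2 i) := by
  induction m with
  | zero => simp
  | succ m ih =>
    have hhalf : ∀ n : ℕ, n + 1 ≤ t → half (p - D.π (v.1 + n • D.α)) = 1 := by
      intro n hn
      have e : p - D.π (v.1 + n • D.α) = (2 * t - 1 - n : ℕ) := by
        rw [map_add, map_nsmul, D.π_α, nsmul_one, hv, Nat.cast_sub (by omega),
          Nat.cast_sub (by omega), ZMod.natCast_self]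
        push_cast; ring
      rw [e]
      exact half_natCast_of_le (by omega) (by omega)
    rw [ih (by omega)]
    refine hf _ _ ?_ (hhalf m (by omega)) (hhalf (m + 1) hm)
    -- A new bit `0` gives no twist, so the phase grows by exactly `α`.
    rw [up_iff]
    have hr : D.res (v.1 + m • D.α) = red t p + 1 + m := by
      rw [res, map_add, map_nsmul, D.π_α, nsmul_one, hv, map_add, map_add, map_one, red_natCast]
    have hval : ((red t p + 1 + m) - red t p - 1 : ZMod t).val = m := by
      rw [show (red t p + 1 + m) - red t p - 1 = (m : ZMod t) by ring, ZMod.val_natCast,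
        Nat.mod_eq_of_lt (by omega)]
    refine Prod.ext ?_ ?_
    · simp only [up, hr, hval, Nat.lt_succ_self, if_true, mul_zero, map_zero, add_zero, succ_nsmul]
      abel
    · funext i
      simp only [up, hr]
      by_cases hi : i = red t p + 1 + m
      · subst hi
        simp only [Function.update_self]
      · rw [Function.update_of_ne hi]
        have : (i - red t p - 1).val ≠ m := by
          intro h
          apply hi
          have h' := ZMod.natCast_zmod_val (i - red t p - 1)
          rw [h] at h'
          linear_combination -h'
        have e : (i - red t p - 1).val < m + 1 ↔ (i - red t p - 1).val < m := by omega
        simp only [e]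

/-- On the `t` levels on which the bit `p` is visible, a function that is constant along edges
depends on the bit `p` only. -/
lemma depends_on_bit (p : ZMod (2 * t)) {β : Type*} (f : A × (ZMod t → ZMod 2) → β)
    (hf : ∀ u v, D.Up u v → half (p - D.π u.1) = 1 → half (p - D.π v.1) = 1 → f u = f v)
    {u v : A × (ZMod t → ZMod 2)} (hu : half (p - D.π u.1) = 1) (hv : half (p - D.π v.1) = 1)
    (huv : u.2 (red t p) = v.2 (red t p)) : f u = f v := by
  have ht := hF.out
  -- The bit `p` is visible on the levels `p + 1, …, p + t`. Climbing through all of them with new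
  -- bits `0` clears every other bit.
  have hbit : ∀ v : A × (ZMod t → ZMod 2), D.π v.1 = p + 1 →
      f v = f (v.1 + (t - 1) • D.α, Pi.single (red t p) (v.2 (red t p))) := by
    intro v hv
    rw [D.zero_steps p f hf hv (t - 1) (by omega)]
    congr 2
    funext i
    have hlt := ZMod.val_lt (i - red t p - 1)
    by_cases hi : i = red t p
    · subst hi
      rw [Pi.single_eq_same, if_neg]
      rw [show (red t p) - red t p - 1 = ((t - 1 : ℕ) : ZMod t) by
        rw [Nat.cast_sub (by omega), ZMod.natCast_self]; simp, ZMod.val_natCast,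
        Nat.mod_eq_of_lt (by omega)]
      exact lt_irrefl _
    · rw [Pi.single_eq_of_ne hi, if_pos]
      refine lt_of_le_of_ne (by omega) fun h => hi ?_
      have h' := ZMod.natCast_zmod_val (i - red t p - 1)
      rw [h, Nat.cast_sub (by omega), ZMod.natCast_self] at h'
      push_cast at h'
      linear_combination -h'
  -- With `y` the bit about to be rewritten, climbing with new bit `1` and returning to the lower
  -- neighbour with bit `y + 1` changes the phase by `τ y + τ (y + 1) = τ 1`. The altered bit is not
  -- the one at `p`, so `hbit` forgets it.
  have hτ : ∀ v : A × (ZMod t → ZMod 2), D.π v.1 = p + 1 → f v = f (v.1 + D.τ 1, v.2) := by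
    intro v hv
    have hr : D.res v.1 = red t p + 1 := by rw [res, hv, map_add, map_one]
    have hne : red t p ≠ red t p + 1 := by
      intro h
      have h1 : ((1 : ℕ) : ZMod t) = 0 := by push_cast; linear_combination -h
      rw [ZMod.natCast_eq_zero_iff] at h1
      have := Nat.le_of_dvd (by norm_num) h1
      omega
    have h1 := D.up_up 1 v
    have h2 := D.up_dn (v.2 (D.res v.1) + 1) (D.up 1 v)
    have hπ1 := D.π_of_up h1
    have hπ2 := D.π_of_up h2
    have e1 : half (p - D.π v.1) = 1 := by
      rw [hv, show p - (p + 1) = -1 by ring]; exact half_neg_one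
    have e2 : half (p - D.π (D.up 1 v).1) = 1 := by
      rw [hπ1, hv, ← sub_sub, half_sub_one_of_ne, show p - (p + 1) = -1 by ring]
      · exact half_neg_one
      · rw [show p - (p + 1) = -1 by ring, map_neg, map_one]
        exact fun h => hne (by linear_combination h)
    have e3 : D.π (D.dn (v.2 (D.res v.1) + 1) (D.up 1 v)).1 = p + 1 := by
      rw [hπ1, hv] at hπ2; linear_combination -hπ2
    rw [hf _ _ h1 e1 e2, ← hf _ _ h2 (by rw [e3, ← hv]; exact e1) e2, hbit _ e3]
    rw [hbit (v.1 + D.τ 1, v.2) (by rw [map_add, D.π_τ, add_zero, hv])]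
    have hru : D.res (D.up 1 v).1 - 1 = D.res v.1 := by
      rw [D.res_of_up h1, add_sub_cancel_right]
    have c1 : (D.dn (v.2 (D.res v.1) + 1) (D.up 1 v)).1 = v.1 + D.τ 1 := by
      simp only [dn, hru]
      simp only [up, Function.update_self, one_mul, mul_one, map_add]
      have := D.τ_mul_self (1 : ZMod 2)
      rw [show v.1 + D.τ 1 = v.1 + D.τ 1 - (D.τ 1 + D.τ 1) by rw [this, sub_zero]]
      abel
    have c2 : (D.dn (v.2 (D.res v.1) + 1) (D.up 1 v)).2 (red t p) = v.2 (red t p) := by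
      rw [← h2.2 _ (by rw [res_dn, hru, hr]; exact hne), h1.2 _ (by rw [hr]; exact hne)]
    rw [c1, c2]
  -- Descending through visible levels never rewrites the bit `p`, so all values of `f` are already
  -- taken on level `p + 1`.
  have hdown : ∀ (m : ℕ), m < t → ∀ v : A × (ZMod t → ZMod 2), D.π v.1 = p + 1 + m →
      ∃ v', D.π v'.1 = p + 1 ∧ v'.2 (red t p) = v.2 (red t p) ∧ f v = f v' := by
    intro m
    induction m with
    | zero => exact fun _ v hv => ⟨v, by simpa using hv, rfl, rfl⟩
    | succ m ih =>
      intro hm v hv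
      have h1 := D.up_dn 0 v
      have hπ := D.π_of_up h1
      have hd : D.π (D.dn 0 v).1 = p + 1 + m := by
        rw [hv] at hπ; push_cast at hπ; linear_combination -hπ
      have hhalf : ∀ n : ℕ, n < t → half (p - (p + 1 + (n : ZMod (2 * t)))) = 1 := by
        intro n hn
        have e : p - (p + 1 + (n : ZMod (2 * t))) = (2 * t - 1 - n : ℕ) := by
          rw [Nat.cast_sub (by omega), Nat.cast_sub (by omega), ZMod.natCast_self]
          push_cast; ring
        rw [e]
        exact half_natCast_of_le (by omega) (by omega)
      obtain ⟨v', h2, h3, h4⟩ := ih (by omega) _ hd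
      refine ⟨v', h2, h3.trans ?_, ?_⟩
      · rw [h1.2]
        intro h
        have hr : D.res (D.dn 0 v).1 = red t p + 1 + m := by
          rw [res, hd, map_add, map_add, map_one, red_natCast]
        rw [hr] at h
        have h5 : ((1 + m : ℕ) : ZMod t) = 0 := by push_cast; linear_combination -h
        rw [ZMod.natCast_eq_zero_iff] at h5
        have := Nat.le_of_dvd (by omega) h5
        omega
      · rw [← h4]
        refine (hf _ _ h1 ?_ ?_).symm
        · rw [hd]; exact hhalf m (by omega)
        · rw [hv]; exact hhalf (m + 1) hm
  have hlevel : ∀ v : A × (ZMod t → ZMod 2), half (p - D.π v.1) = 1 →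
      ∃ v', D.π v'.1 = p + 1 ∧ v'.2 (red t p) = v.2 (red t p) ∧ f v = f v' := by
    intro v hv
    obtain ⟨n, hn, hn'⟩ := exists_natCast (D.π v.1 - p - 1)
    have hlt : n < t := by
      by_contra hc
      have e : p - D.π v.1 = (2 * t - 1 - n : ℕ) := by
        rw [Nat.cast_sub (by omega), Nat.cast_sub (by omega), ZMod.natCast_self, ← hn']
        push_cast; ring
      rw [e, half_natCast_of_lt (by omega)] at hv
      exact absurd hv (by decide)
    exact hdown n hlt v (by rw [← hn']; ring)
  obtain ⟨u', hu1, hu2, hu3⟩ := hlevel u hu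
  obtain ⟨v', hv1, hv2, hv3⟩ := hlevel v hv
  rw [hu3, hv3, hbit u' hu1, hbit v' hv1, hu2, hv2, huv]
  obtain ⟨c, hc⟩ := D.exists_of_π_eq_zero (u'.1 - v'.1) (by rw [map_sub, hu1, hv1, sub_self])
  rw [sub_eq_iff_eq_add] at hc
  rcases zmod_two_cases c with rfl | rfl
  · rw [hc, map_zero, zero_add]
  · have h1 := hτ v' hv1
    rw [hbit v' hv1, hbit (v'.1 + D.τ 1, v'.2) (by rw [map_add, D.π_τ, add_zero, hv1]), hv2] at h1
    rw [h1, hc, add_comm (D.τ 1)]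

/-- An automorphism preserving levels and bits is a power of `z`. -/
lemma exists_of_bits_eq {φ : D.graph ≃g D.graph}
    (hφ : ∀ u v, D.Up u v → D.Up (φ u) (φ v)) (hπ : ∀ v, D.π (φ v).1 = D.π v.1)
    (hbits : ∀ v, (φ v).2 = v.2) : ∃ m : ℕ, φ = D.action (gz ε ^ m) := by
  -- Equal bits give equal twists, so the displacement of the phase does not change along an edge.
  have hstep : ∀ u v, D.Up u v → (φ u).1 - u.1 = (φ v).1 - v.1 := by
    intro u v h
    have h1 := (hφ u v h).1
    have hr : D.res (φ u).1 = D.res u.1 := by rw [res, hπ, res]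
    rw [hbits, hbits, hr] at h1
    rw [h1, h.1]; abel
  obtain ⟨c, hc⟩ := D.exists_of_π_eq_zero ((φ base).1 - (base : A × (ZMod t → ZMod 2)).1)
    (by rw [map_sub, hπ, sub_self])
  have hv : ∀ v, φ v = (v.1 + D.τ c, v.2) := fun v => by
    refine Prod.ext ?_ (hbits v)
    have := D.eq_of_forall_up _ hstep v base
    rw [hc] at this
    rw [← this]; simp
  rcases zmod_two_cases c with rfl | rfl
  · refine ⟨0, RelIso.ext fun v => ?_⟩
    rw [hv, pow_zero, action_one, map_zero, add_zero]
  · refine ⟨1, RelIso.ext fun v => ?_⟩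
    rw [hv, pow_one, action_gz]

/-- After composition with an element of `G` the base vertex is fixed, hence every level. The bit
`p` of the image does not change along edges with `p` visible at both ends, so by `depends_on_bit`
it is a function of the bit `p` alone; this function is onto `ZMod 2` and therefore a translation.
The element from `exists_flip` undoes the translations for all `p` at once, and a power of `z`
remains. -/
lemma exists_of_preserves_up {φ : D.graph ≃g D.graph}
    (hφ : ∀ u v, D.Up u v → D.Up (φ u) (φ v)) : ∃ g, φ = D.action g := by
  obtain ⟨g, hg, hgb⟩ := D.exists_oriented_to_base (φ base)
  set ψ := D.action g * φ with hψ
  have hψup : ∀ u v, D.Up u v → D.Up (ψ u) (ψ v) := fun u v h => hg _ _ (hφ _ _ h)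
  have hψb : ψ base = base := hgb
  have hπ : ∀ v, D.π (ψ v).1 = D.π v.1 := by
    intro v
    have := D.eq_of_forall_up (fun v => D.π (ψ v).1 - D.π v.1) (fun u v h => by
      rw [D.π_of_up h, D.π_of_up (hψup _ _ h)]; ring) v base
    simp only [hψb, sub_self] at this
    exact sub_eq_zero.1 this
  have hbit : ∀ p : ZMod (2 * t), ∃ c : ZMod 2, ∀ v : A × (ZMod t → ZMod 2),
      half (p - D.π v.1) = 1 → (ψ v).2 (red t p) = v.2 (red t p) + c := by
    intro p
    let f : A × (ZMod t → ZMod 2) → ZMod 2 := fun v => (ψ v).2 (red t p)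
    have hf : ∀ u v, D.Up u v → half (p - D.π u.1) = 1 → half (p - D.π v.1) = 1 → f u = f v := by
      intro u v h hu hv
      refine ((hψup _ _ h).2 _ fun h' => ?_).symm
      rw [res, hπ] at h'
      rw [D.π_of_up h, ← sub_sub, half_sub_one_of_eq (by rw [map_sub, h', sub_self]), hu] at hv
      exact absurd hv (by decide)
    have hdep := fun u v => D.depends_on_bit p f hf (u := u) (v := v)
    obtain ⟨κ, hκ⟩ : ∃ κ, D.π κ = p + 1 := by
      obtain ⟨n, -, hn⟩ := exists_natCast (p + 1)
      exact ⟨n • D.α, by rw [map_nsmul, D.π_α, nsmul_one, hn]⟩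
    have hhalf : half (p - (p + 1)) = 1 := by
      rw [show p - (p + 1) = -1 by ring]; exact half_neg_one
    let w : ZMod 2 → A × (ZMod t → ZMod 2) := fun c => (κ, Pi.single (red t p) c)
    have hw : ∀ c, half (p - D.π (w c).1) = 1 := fun c => by rw [hκ]; exact hhalf
    have hwb : ∀ c, (w c).2 (red t p) = c := fun c => Pi.single_eq_same _ _
    have hsurj : ∀ c, ∃ c', f (w c') = c := by
      intro c
      have h1 : ψ (ψ.symm (w c)) = w c := ψ.apply_symm_apply _
      have h2 : D.π (ψ.symm (w c)).1 = D.π (w c).1 := by rw [← hπ, h1]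
      refine ⟨(ψ.symm (w c)).2 (red t p), ?_⟩
      rw [hdep _ (ψ.symm (w c)) (hw _) (by rw [h2]; exact hw c) (hwb _)]
      change (ψ (ψ.symm (w c))).2 (red t p) = c
      rw [h1, hwb]
    have key : ∀ F : ZMod 2 → ZMod 2, (∀ c, ∃ c', F c' = c) → ∀ c, F c = c + F 0 := by decide
    refine ⟨f (w 0), fun v hv => ?_⟩
    rw [← key (fun c => f (w c)) hsurj (v.2 (red t p))]
    exact hdep v _ hv (hw _) (hwb _).symm
  choose c hc using hbit
  obtain ⟨h, hh, hh'⟩ := D.exists_flip c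
  obtain ⟨m, hm⟩ := D.exists_of_bits_eq (φ := D.action h * ψ)
    (fun u v huv => hh _ _ (hψup _ _ huv)) (fun v => (hh' _).1.trans (hπ v)) (fun v => by
      funext j
      obtain ⟨p, hp, rfl⟩ := exists_window (D.π v.1) j
      change (D.action h (ψ v)).2 _ = _
      rw [(hh' _).2 p (by rw [hπ]; exact hp), hc p v hp, add_assoc, CharTwo.add_self_eq_zero,
        add_zero])
  refine ⟨g⁻¹ * (h⁻¹ * gz ε ^ m), ?_⟩
  rw [map_mul, map_mul, ← hm, hψ, map_inv, map_inv]
  simp only [inv_mul_cancel_left]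

/-- An automorphism preserving the two sides of every neighbourhood lies in `G`. -/
lemma exists_of_preserves_side {φ : D.graph ≃g D.graph}
    (hφ : ∀ v w w', D.Side v w w' → D.Side (φ v) (φ w) (φ w')) : ∃ g, φ = D.action g := by
  rcases D.preserves_or_reverses_up hφ with h | h
  · exact D.exists_of_preserves_up h
  · obtain ⟨g, hg⟩ := D.exists_of_preserves_up (φ := D.action (gb ε) * φ) fun u v huv => by
      change D.Up (D.action (gb ε) (φ u)) (D.action (gb ε) (φ v))
      rw [action_gb, action_gb]
      exact D.up_bFun (h _ _ huv)
    exact ⟨(gb ε)⁻¹ * g, by rw [map_mul, ← hg, map_inv, inv_mul_cancel_left]⟩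

end PhaseGroup

/-! ### Numbers of walks as invariants that distinguish the sides. -/

namespace PhaseGroup

variable {t : ℕ} {ε : Sgn} {A : Type} [AddCommGroup A] (D : PhaseGroup t ε A)
variable [hF : Fact (2 ≤ t)]

/-- The four neighbours of a vertex. -/
def nbrs (v : A × (ZMod t → ZMod 2)) : List (A × (ZMod t → ZMod 2)) :=
  [D.up 0 v, D.up 1 v, D.dn 0 v, D.dn 1 v]

lemma up_iff_eq_up {v w : A × (ZMod t → ZMod 2)} : D.Up v w ↔ w = D.up 0 v ∨ w = D.up 1 v := by
  constructor
  · intro h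
    rw [up_iff] at h
    rcases zmod_two_cases (w.2 (D.res v.1)) with h' | h' <;> rw [h'] at h
    · exact Or.inl h
    · exact Or.inr h
  · rintro (rfl | rfl) <;> exact D.up_up _ _

lemma up_iff_eq_dn {v w : A × (ZMod t → ZMod 2)} : D.Up w v ↔ w = D.dn 0 v ∨ w = D.dn 1 v := by
  constructor
  · intro h
    rw [dn_iff] at h
    rcases zmod_two_cases (w.2 (D.res v.1 - 1)) with h' | h' <;> rw [h'] at h
    · exact Or.inl h
    · exact Or.inr h
  · rintro (rfl | rfl) <;> exact D.up_dn _ _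

lemma up_ne_dn (c d : ZMod 2) (v : A × (ZMod t → ZMod 2)) : D.up c v ≠ D.dn d v := fun h =>
  D.not_up_of_up (D.up_dn d v) (h ▸ D.up_up c v)

lemma mem_nbrs {v w : A × (ZMod t → ZMod 2)} : w ∈ D.nbrs v ↔ D.graph.Adj v w := by
  rw [adj_iff, up_iff_eq_up, up_iff_eq_dn, nbrs]
  simp [or_assoc]

lemma nodup_nbrs (v : A × (ZMod t → ZMod 2)) : (D.nbrs v).Nodup := by
  simp [nbrs, up_zero_ne_up_one, dn_zero_ne_dn_one, up_ne_dn]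

section WalkCount

variable {β : Type} [DecidableEq β] (code : A × (ZMod t → ZMod 2) → β)

/-- The end vertices of the walks of length `n` from `v`. -/
def ends : ℕ → A × (ZMod t → ZMod 2) → List (A × (ZMod t → ZMod 2))
  | 0, v => [v]
  | n + 1, v => (D.nbrs v).flatMap fun w => ends n w

/-- The number of walks of length `2 * n` from `u` to `v`; vertices are compared through a code. -/
def walkCount (n : ℕ) (u v : A × (ZMod t → ZMod 2)) : ℕ :=
  (((D.ends n u).map code).map fun x => ((D.ends n v).map code).count x).sum

lemma ends_map (φ : D.graph ≃g D.graph) (n : ℕ) (v : A × (ZMod t → ZMod 2)) :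
    (D.ends n (φ v)).Perm ((D.ends n v).map φ) := by
  induction n generalizing v with
  | zero => simp [ends]
  | succ n ih =>
    have hp : (D.nbrs (φ v)).Perm ((D.nbrs v).map φ) := by
      rw [List.perm_ext_iff_of_nodup (D.nodup_nbrs _) ((D.nodup_nbrs v).map φ.injective)]
      intro w
      obtain ⟨x, rfl⟩ := φ.surjective w
      rw [mem_nbrs, List.mem_map_of_injective φ.injective, mem_nbrs, φ.map_adj_iff]
    rw [ends, ends, List.map_flatMap]
    refine (hp.flatMap_right _).trans ?_
    rw [List.flatMap_map]
    exact List.Perm.flatMap_left _ fun w _ => ih w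

variable {code} (hcode : Function.Injective code)

include hcode in
lemma walkCount_map (φ : D.graph ≃g D.graph) (n : ℕ) (u v : A × (ZMod t → ZMod 2)) :
    D.walkCount code n (φ u) (φ v) = D.walkCount code n u v := by
  classical
  have h1 : ∀ x, ((D.ends n (φ v)).map code).count (code (φ x)) =
      ((D.ends n v).map code).count (code x) := fun x => by
    rw [List.count_map_of_injective _ _ hcode, List.count_map_of_injective _ _ hcode,
      (D.ends_map φ n v).count_eq, List.count_map_of_injective _ _ φ.injective]
  rw [walkCount, walkCount, List.map_map, List.map_map, ((D.ends_map φ n u).map _).sum_eq,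
    List.map_map]
  congr 1
  exact List.map_congr_left fun w _ => h1 w

include hcode in
-- `G` is transitive on upward arcs and each side has two vertices, so one pair represents all pairs
-- of distinct vertices on a common side.
lemma walkCount_side (n : ℕ) {v w w' : A × (ZMod t → ZMod 2)} (h : D.Side v w w') (hne : w ≠ w') :
    D.walkCount code n w w' = D.walkCount code n (D.α, 0) (D.up 1 base) := by
  have key : ∀ v w w', D.Up v w → D.Up v w' → w ≠ w' →
      D.walkCount code n w w' = D.walkCount code n (D.α, 0) (D.up 1 base) := by
    intro v w w' h h' hne
    obtain ⟨g, hg, h1, h2⟩ := D.exists_oriented_arc h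
    rw [← D.walkCount_map hcode (D.action g), h2]
    congr 1
    have h3 := hg _ _ h'
    have h4 := hg _ _ (D.up_up 1 v)
    rw [h1, up_iff_eq_up] at h3
    refine h3.resolve_left fun h5 => hne ((D.action g).injective ?_)
    rw [h5, h2]
    have := D.up_base
    rw [up_iff] at this
    exact this
  rcases h with ⟨h, h'⟩ | ⟨h, h'⟩
  · exact key _ _ _ h h' hne
  · rw [← D.walkCount_map hcode (D.action (gb ε)), action_gb, action_gb]
    exact key _ _ _ (D.up_bFun h) (D.up_bFun h') fun e => hne (by
      rw [← bFun_bFun w, e, bFun_bFun])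

include hcode in
-- Moving the arc `v, w'` to the basic one leaves two possibilities for the lower neighbour,
-- recorded by `c`.
lemma walkCount_through (n : ℕ) {v w w' : A × (ZMod t → ZMod 2)} (h : D.Up w v) (h' : D.Up v w') :
    ∃ c, D.walkCount code n w w' = D.walkCount code n (D.dn c base) (D.α, 0) := by
  obtain ⟨g, hg, h1, h2⟩ := D.exists_oriented_arc h'
  have h3 := hg _ _ h
  rw [h1, dn_iff] at h3
  exact ⟨_, by rw [← D.walkCount_map hcode (D.action g), h2, ← h3]⟩

include hcode in
/-- A criterion for automorphisms to preserve the sides of neighbourhoods. -/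
lemma preserves_side_of_walkCount (n : ℕ)
    (h : ∀ c, D.walkCount code n (D.dn c base) (D.α, 0) ≠ D.walkCount code n (D.α, 0) (D.up 1 base))
    (φ : D.graph ≃g D.graph) (v w w' : A × (ZMod t → ZMod 2)) (hs : D.Side v w w') :
    D.Side (φ v) (φ w) (φ w') := by
  have h1 : D.graph.Adj (φ v) (φ w) := φ.map_rel_iff.2
    (D.adj_iff.2 (hs.elim (fun h => Or.inl h.1) (fun h => Or.inr h.1)))
  have h2 : D.graph.Adj (φ v) (φ w') := φ.map_rel_iff.2
    (D.adj_iff.2 (hs.elim (fun h => Or.inl h.2) (fun h => Or.inr h.2)))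
  by_cases hne : w = w'
  · subst hne
    exact (D.adj_iff.1 h1).imp (fun h => ⟨h, h⟩) (fun h => ⟨h, h⟩)
  have hc := (D.walkCount_map hcode φ n w w').trans (D.walkCount_side hcode n hs hne)
  rcases D.adj_iff.1 h1 with h1 | h1 <;> rcases D.adj_iff.1 h2 with h2 | h2
  · exact Or.inl ⟨h1, h2⟩
  · have h3 := D.walkCount_map hcode (D.action (gb ε)) n (φ w) (φ w')
    rw [action_gb, action_gb] at h3
    obtain ⟨c, hc'⟩ := D.walkCount_through hcode n (D.up_bFun h1) (D.up_bFun h2)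
    exact absurd (hc'.symm.trans (h3.trans hc)) (h c)
  · obtain ⟨c, hc'⟩ := D.walkCount_through hcode n h1 h2
    exact absurd (hc'.symm.trans hc) (h c)
  · exact Or.inr ⟨h1, h2⟩

end WalkCount

end PhaseGroup

/-! ### The two phase groups: the split product for `G_t^+` and a cyclic group for `G_t^-`. -/

/-- The phase group in the case of `G_t^+`. -/
def plusPhase (t : ℕ) : PhaseGroup t .plus (ZMod (2 * t) × ZMod 2) where
  α := (1, 0)
  τ := AddMonoidHom.inr _ _
  π := AddMonoidHom.fst _ _
  π_α := rfl
  π_τ _ := rfl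
  exists_of_π_eq_zero κ h := ⟨κ.2, Prod.ext h rfl⟩
  τ_injective := fun a b h => (Prod.ext_iff.1 h).2
  nsmul_α := by
    have : ((2 * t : ℕ) : ZMod (2 * t)) = 0 := ZMod.natCast_self _
    refine Prod.ext ?_ ?_
    · simp
    · simp [Sgn.exponent]

/-- The phase group in the case of `G_t^-`. -/
def minusPhase (t : ℕ) [hF : Fact (2 ≤ t)] : PhaseGroup t .minus (ZMod (2 * (2 * t))) where
  α := 1
  τ := AddMonoidHom.mk' (fun c => if c = 0 then 0 else ((2 * t : ℕ) : ZMod (2 * (2 * t)))) (by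
    have h : ((2 * t : ℕ) : ZMod (2 * (2 * t))) + ((2 * t : ℕ) : ZMod (2 * (2 * t))) = 0 :=
      t_add_t (2 * t)
    intro a b
    rcases zmod_two_cases a with rfl | rfl <;> rcases zmod_two_cases b with rfl | rfl
    · simp
    · simp
    · simp
    · simpa [show (1 : ZMod 2) + 1 = 0 from rfl] using h.symm)
  π := (red (2 * t)).toAddMonoidHom
  π_α := map_one (red (2 * t))
  π_τ c := by
    rcases zmod_two_cases c with rfl | rfl
    · simp
    · simpa using red_t (2 * t)
  exists_of_π_eq_zero κ h := by
    have : Fact (2 ≤ 2 * t) := ⟨by have := hF.out; omega⟩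
    rcases (red_eq_zero_iff κ).1 h with rfl | rfl
    · exact ⟨0, by simp⟩
    · exact ⟨1, by simp⟩
  τ_injective a b h := by
    have h0 : ((2 * t : ℕ) : ZMod (2 * (2 * t))) ≠ 0 := by
      have := hF.out
      rw [Ne, ZMod.natCast_eq_zero_iff]
      exact fun h => absurd (Nat.le_of_dvd (by omega) h) (by omega)
    rcases zmod_two_cases a with rfl | rfl <;> rcases zmod_two_cases b with rfl | rfl
    · rfl
    · simp at h
      exact absurd h.symm (by simpa using h0)
    · simp at h
      exact absurd h (by simpa using h0)
    · rfl
  nsmul_α := by simp [Sgn.exponent]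

/-! ### Finite computations for `t ≤ 4`. -/

section Small

instance two_le_two : Fact (2 ≤ 2) := ⟨by norm_num⟩
instance two_le_three : Fact (2 ≤ 3) := ⟨by norm_num⟩
instance two_le_four : Fact (2 ≤ 4) := ⟨by norm_num⟩

set_option maxRecDepth 100000

/-- An encoding of the vertices by natural numbers in the case `t = 3`. -/
def codeThree {A : Type} (f : A → ℕ) (v : A × (ZMod 3 → ZMod 2)) : ℕ :=
  (v.2 0).val + 2 * ((v.2 1).val + 2 * ((v.2 2).val + 2 * f v.1))

/-- An encoding of the vertices by natural numbers in the case `t = 4`. -/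
def codeFour {A : Type} (f : A → ℕ) (v : A × (ZMod 4 → ZMod 2)) : ℕ :=
  (v.2 0).val + 2 * ((v.2 1).val + 2 * ((v.2 2).val + 2 * ((v.2 3).val + 2 * f v.1)))

lemma codeThree_injective {A : Type} {f : A → ℕ} (hf : Function.Injective f) :
    Function.Injective (codeThree f) := by
  rintro ⟨κ, y⟩ ⟨κ', y'⟩ h
  simp only [codeThree] at h
  have hlt : ∀ (y : ZMod 3 → ZMod 2) j, (y j).val < 2 := fun y j => ZMod.val_lt _
  have h0 := hlt y 0; have h1 := hlt y 1; have h2 := hlt y 2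
  have h0' := hlt y' 0; have h1' := hlt y' 1; have h2' := hlt y' 2
  refine Prod.ext (hf (by simp only; omega)) (funext fun j => ZMod.val_injective 2 ?_)
  have hj : j = 0 ∨ j = 1 ∨ j = 2 := by revert j; decide
  rcases hj with rfl | rfl | rfl <;> simp only <;> omega

lemma codeFour_injective {A : Type} {f : A → ℕ} (hf : Function.Injective f) :
    Function.Injective (codeFour f) := by
  rintro ⟨κ, y⟩ ⟨κ', y'⟩ h
  simp only [codeFour] at h
  have hlt : ∀ (y : ZMod 4 → ZMod 2) j, (y j).val < 2 := fun y j => ZMod.val_lt _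
  have h0 := hlt y 0; have h1 := hlt y 1; have h2 := hlt y 2; have h3 := hlt y 3
  have h0' := hlt y' 0; have h1' := hlt y' 1; have h2' := hlt y' 2; have h3' := hlt y' 3
  refine Prod.ext (hf (by simp only; omega)) (funext fun j => ZMod.val_injective 2 ?_)
  have hj : j = 0 ∨ j = 1 ∨ j = 2 ∨ j = 3 := by revert j; decide
  rcases hj with rfl | rfl | rfl | rfl <;> simp only <;> omega

/-- An encoding of the phases by natural numbers in the case of `G_t^+`. -/
def codePlus (n : ℕ) (κ : ZMod n × ZMod 2) : ℕ := κ.2.val + 2 * κ.1.val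

lemma codePlus_injective (n : ℕ) [NeZero n] : Function.Injective (codePlus n) := by
  rintro ⟨k, c⟩ ⟨k', c'⟩ h
  simp only [codePlus] at h
  have h1 := ZMod.val_lt c
  have h2 := ZMod.val_lt c'
  exact Prod.ext (ZMod.val_injective n (by simp only; omega))
    (ZMod.val_injective 2 (by simp only; omega))

/-- For `t ≤ 4`, with `Γ_2^-` excluded, the number of walks of length `2n` with a suitable `n`
separates pairs on one side from pairs on opposite sides. In the larger cases vertices are compared
through numerical codes. -/
lemma walkCount_plus_two : ∀ c,
    (plusPhase 2).walkCount id 1 ((plusPhase 2).dn c PhaseGroup.base) ((plusPhase 2).α, 0) ≠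
      (plusPhase 2).walkCount id 1 ((plusPhase 2).α, 0) ((plusPhase 2).up 1 PhaseGroup.base) := by
  decide +kernel

lemma walkCount_plus_three : ∀ c,
    (plusPhase 3).walkCount id 2 ((plusPhase 3).dn c PhaseGroup.base) ((plusPhase 3).α, 0) ≠
      (plusPhase 3).walkCount id 2 ((plusPhase 3).α, 0) ((plusPhase 3).up 1 PhaseGroup.base) := by
  decide +kernel

lemma walkCount_minus_three : ∀ c,
    (minusPhase 3).walkCount (codeThree ZMod.val) 3 ((minusPhase 3).dn c PhaseGroup.base) ((minusPhase 3).α, 0) ≠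
      (minusPhase 3).walkCount (codeThree ZMod.val) 3 ((minusPhase 3).α, 0) ((minusPhase 3).up 1 PhaseGroup.base) := by
  decide +kernel

lemma walkCount_plus_four : ∀ c,
    (plusPhase 4).walkCount (codeFour (codePlus _)) 3 ((plusPhase 4).dn c PhaseGroup.base) ((plusPhase 4).α, 0) ≠
      (plusPhase 4).walkCount (codeFour (codePlus _)) 3 ((plusPhase 4).α, 0) ((plusPhase 4).up 1 PhaseGroup.base) := by
  decide +kernel

lemma walkCount_minus_four : ∀ c,
    (minusPhase 4).walkCount (codeFour ZMod.val) 3 ((minusPhase 4).dn c PhaseGroup.base) ((minusPhase 4).α, 0) ≠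
      (minusPhase 4).walkCount (codeFour ZMod.val) 3 ((minusPhase 4).α, 0) ((minusPhase 4).up 1 PhaseGroup.base) := by
  decide +kernel

end Small

/-! ### Recognising sides by octagons when `t ≥ 5`. -/

section Octagons

variable {V : Type*}

/-- The 3-arc `x, w, v, w'` extends to a closed walk of length `8` without backtracking. -/
def ExtendsToOctagon (Γ : SimpleGraph V) (x w v w' : V) : Prop :=
  ∃ p q r s, Γ.Adj w' p ∧ Γ.Adj p q ∧ Γ.Adj q r ∧ Γ.Adj r s ∧ Γ.Adj s x ∧
    p ≠ v ∧ q ≠ w' ∧ r ≠ p ∧ s ≠ q ∧ x ≠ r ∧ w ≠ s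

lemma ExtendsToOctagon.map {Γ : SimpleGraph V} {x w v w' : V} (φ : Γ ≃g Γ)
    (h : ExtendsToOctagon Γ x w v w') : ExtendsToOctagon Γ (φ x) (φ w) (φ v) (φ w') := by
  obtain ⟨p, q, r, s, h1, h2, h3, h4, h5, n1, n2, n3, n4, n5, n6⟩ := h
  exact ⟨φ p, φ q, φ r, φ s, φ.map_rel_iff.2 h1, φ.map_rel_iff.2 h2, φ.map_rel_iff.2 h3,
    φ.map_rel_iff.2 h4, φ.map_rel_iff.2 h5, φ.injective.ne n1, φ.injective.ne n2,
    φ.injective.ne n3, φ.injective.ne n4, φ.injective.ne n5, φ.injective.ne n6⟩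

end Octagons

namespace PhaseGroup

variable {t : ℕ} {ε : Sgn} {A : Type} [AddCommGroup A] (D : PhaseGroup t ε A)
variable [hF : Fact (2 ≤ t)]

/-- An upward edge is determined by its upper end and the bit it overwrites. With the mirror
statement `eq_of_up_of_bit'`, agreement of bits becomes backtracking. -/
lemma eq_of_up_of_bit {u u' v : A × (ZMod t → ZMod 2)} (h : D.Up u v) (h' : D.Up u' v)
    (hb : u.2 (D.res u.1) = u'.2 (D.res u.1)) : u = u' := by
  have hr : D.res u.1 = D.res v.1 - 1 := by rw [D.res_of_up h, add_sub_cancel_right]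
  rw [hr] at hb
  rw [dn_iff] at h h'
  rw [h, h', hb]

lemma eq_of_up_of_bit' {u v v' : A × (ZMod t → ZMod 2)} (h : D.Up u v) (h' : D.Up u v')
    (hb : v.2 (D.res u.1) = v'.2 (D.res u.1)) : v = v' := by
  rw [up_iff] at h h'
  rw [h, h', hb]

lemma natCast_ne_zero {n : ℕ} (h0 : 0 < n) (hn : n < t) : (n : ZMod t) ≠ 0 := by
  rw [Ne, ZMod.natCast_eq_zero_iff]
  exact fun h => absurd (Nat.le_of_dvd h0 h) (by omega)

lemma natCast_level_ne_zero {n : ℕ} (h0 : 0 < n) (hn : n < 2 * t) : (n : ZMod (2 * t)) ≠ 0 := by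
  rw [Ne, ZMod.natCast_eq_zero_iff]
  exact fun h => absurd (Nat.le_of_dvd h0 h) (by omega)

/-- The distance `n` with `0 < n < t` certifies that `j` is not the residue which the edge rewrites.
-/
lemma bit_of_up {u v : A × (ZMod t → ZMod 2)} (h : D.Up u v) {j : ZMod t} (n : ℕ) (h0 : 0 < n)
    (hn : n < t) (hj : j - D.res u.1 = n ∨ D.res u.1 - j = n) : v.2 j = u.2 j := by
  refine h.2 j fun h' => natCast_ne_zero h0 hn ?_
  rcases hj with hj | hj <;> rw [← hj, h', sub_self]

/-- A directed 3-arc does not extend to an octagon. -/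
lemma not_extendsToOctagon (ht : 5 ≤ t) {x w v w' : A × (ZMod t → ZMod 2)} (h1 : D.Up x w)
    (h2 : D.Up w v) (h3 : D.Up v w') : ¬ ExtendsToOctagon D.graph x w v w' := by
  rintro ⟨p, q, r, s, h4, h5, h6, h7, h8, n1, n2, n3, n4, n5, n6⟩
  have z2 := natCast_level_ne_zero (t := t) (n := 2) (by omega) (by omega)
  have z4 := natCast_level_ne_zero (t := t) (n := 4) (by omega) (by omega)
  have z6 := natCast_level_ne_zero (t := t) (n := 6) (by omega) (by omega)
  have z8 := natCast_level_ne_zero (t := t) (n := 8) (by omega) (by omega)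
  push_cast at z2 z4 z6 z8
  have l1 := D.π_of_up h1
  have l2 := D.π_of_up h2
  have l3 := D.π_of_up h3
  have r1 := D.res_of_up h1
  have r2 := D.res_of_up h2
  have r3 := D.res_of_up h3
  have level : ∀ {a b : A × (ZMod t → ZMod 2)}, D.graph.Adj a b →
      (D.Up a b ∧ D.π b.1 = D.π a.1 + 1) ∨ (D.Up b a ∧ D.π b.1 = D.π a.1 - 1) := by
    intro a b h
    rcases D.adj_iff.1 h with h | h
    · exact Or.inl ⟨h, D.π_of_up h⟩
    · exact Or.inr ⟨h, by rw [D.π_of_up h]; ring⟩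
  -- Since `2t > 8`, a closed walk of length 8 climbs as often as it descends, so exactly one of the
  -- five remaining steps goes up. In each of the five orders, a highest or lowest gap between
  -- levels is crossed only by the two edges meeting at its extreme vertex. The rest of the walk
  -- does not rewrite the bit of that gap, so the two edges coincide, against the absence of
  -- backtracking.
  rcases level h4 with ⟨h4, l4⟩ | ⟨h4, l4⟩ <;> rcases level h5 with ⟨h5, l5⟩ | ⟨h5, l5⟩ <;>
  rcases level h6 with ⟨h6, l6⟩ | ⟨h6, l6⟩ <;> rcases level h7 with ⟨h7, l7⟩ | ⟨h7, l7⟩ <;>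
  rcases level h8 with ⟨h8, l8⟩ | ⟨h8, l8⟩ <;>
  first
  | exact absurd (by linear_combination -(l1 + l2 + l3 + l4 + l5 + l6 + l7 + l8)) z2
  | exact absurd (by linear_combination -(l1 + l2 + l3 + l4 + l5 + l6 + l7 + l8)) z4
  | exact absurd (by linear_combination -(l1 + l2 + l3 + l4 + l5 + l6 + l7 + l8)) z6
  | exact absurd (by linear_combination -(l1 + l2 + l3 + l4 + l5 + l6 + l7 + l8)) z8
  | exact absurd (by linear_combination (l1 + l2 + l3 + l4 + l5 + l6 + l7 + l8)) z2
  | skip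
  · have r4 := D.res_of_up h4
    have r5 := D.res_of_up h5
    have r6 := D.res_of_up h6
    have r7 := D.res_of_up h7
    have r8 := D.res_of_up h8
    refine n2 (D.eq_of_up_of_bit h5 h4 ?_)
    rw [D.bit_of_up h6 1 (by omega) (by omega) (Or.inl (by push_cast; linear_combination r6)),
      D.bit_of_up h7 2 (by omega) (by omega) (Or.inl (by push_cast; linear_combination r6 + r7)),
      D.bit_of_up h8 3 (by omega) (by omega)
        (Or.inl (by push_cast; linear_combination r6 + r7 + r8)),
      D.bit_of_up h3 1 (by omega) (by omega)
        (Or.inl (by push_cast; linear_combination r6 + r7 + r8 - r1 - r2)),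
      D.bit_of_up h2 2 (by omega) (by omega)
        (Or.inl (by push_cast; linear_combination r6 + r7 + r8 - r1)),
      D.bit_of_up h1 3 (by omega) (by omega)
        (Or.inl (by push_cast; linear_combination r6 + r7 + r8))]
  · have r4 := D.res_of_up h4
    have r5 := D.res_of_up h5
    have r6 := D.res_of_up h6
    have r7 := D.res_of_up h7
    refine n6 (D.eq_of_up_of_bit' h1 h8 ?_)
    rw [← D.bit_of_up h2 1 (by omega) (by omega) (Or.inr (by push_cast; linear_combination r1)),
      ← D.bit_of_up h3 2 (by omega) (by omega)
        (Or.inr (by push_cast; linear_combination r1 + r2)),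
      D.bit_of_up h4 2 (by omega) (by omega)
        (Or.inr (by push_cast; linear_combination r1 + r2 + r3 - r4)),
      ← D.bit_of_up h5 2 (by omega) (by omega)
        (Or.inr (by push_cast; linear_combination r1 + r2 + r3 - r4)),
      D.bit_of_up h6 2 (by omega) (by omega)
        (Or.inr (by push_cast; linear_combination r1 + r2 + r3 - r4 + r5 - r6)),
      D.bit_of_up h7 1 (by omega) (by omega)
        (Or.inr (by push_cast; linear_combination r1 + r2 + r3 - r4 + r5 - r6 - r7))]
  · have r4 := D.res_of_up h4
    have r5 := D.res_of_up h5
    have r6 := D.res_of_up h6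
    have r7 := D.res_of_up h7
    refine n6 (D.eq_of_up_of_bit' h1 h8 ?_)
    rw [← D.bit_of_up h2 1 (by omega) (by omega) (Or.inr (by push_cast; linear_combination r1)),
      ← D.bit_of_up h3 2 (by omega) (by omega)
        (Or.inr (by push_cast; linear_combination r1 + r2)),
      D.bit_of_up h4 2 (by omega) (by omega)
        (Or.inr (by push_cast; linear_combination r1 + r2 + r3 - r4)),
      D.bit_of_up h5 1 (by omega) (by omega)
        (Or.inr (by push_cast; linear_combination r1 + r2 + r3 - r4 - r5)),
      ← D.bit_of_up h6 1 (by omega) (by omega)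
        (Or.inr (by push_cast; linear_combination r1 + r2 + r3 - r4 - r5)),
      D.bit_of_up h7 1 (by omega) (by omega)
        (Or.inr (by push_cast; linear_combination r1 + r2 + r3 - r4 - r5 + r6 - r7))]
  · have r4 := D.res_of_up h4
    have r5 := D.res_of_up h5
    have r6 := D.res_of_up h6
    have r7 := D.res_of_up h7
    have r8 := D.res_of_up h8
    refine n1 (D.eq_of_up_of_bit h4 h3 ?_)
    rw [D.bit_of_up h5 1 (by omega) (by omega) (Or.inl (by push_cast; linear_combination r5)),
      D.bit_of_up h6 2 (by omega) (by omega) (Or.inl (by push_cast; linear_combination r5 + r6)),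
      ← D.bit_of_up h7 2 (by omega) (by omega)
        (Or.inl (by push_cast; linear_combination r5 + r6)),
      D.bit_of_up h8 2 (by omega) (by omega)
        (Or.inl (by push_cast; linear_combination r5 + r6 - r7 + r8)),
      D.bit_of_up h2 1 (by omega) (by omega)
        (Or.inl (by push_cast; linear_combination r5 + r6 - r7 + r8 - r1)),
      D.bit_of_up h1 2 (by omega) (by omega)
        (Or.inl (by push_cast; linear_combination r5 + r6 - r7 + r8))]
  · have r4 := D.res_of_up h4
    have r5 := D.res_of_up h5
    have r6 := D.res_of_up h6
    have r7 := D.res_of_up h7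
    have r8 := D.res_of_up h8
    refine n1 (D.eq_of_up_of_bit h4 h3 ?_)
    rw [D.bit_of_up h5 1 (by omega) (by omega) (Or.inl (by push_cast; linear_combination r5)),
      D.bit_of_up h6 2 (by omega) (by omega) (Or.inl (by push_cast; linear_combination r5 + r6)),
      D.bit_of_up h7 3 (by omega) (by omega)
        (Or.inl (by push_cast; linear_combination r5 + r6 + r7)),
      ← D.bit_of_up h8 3 (by omega) (by omega)
        (Or.inl (by push_cast; linear_combination r5 + r6 + r7)),
      D.bit_of_up h2 1 (by omega) (by omega)
        (Or.inl (by push_cast; linear_combination r5 + r6 + r7 - r8 - r1)),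
      D.bit_of_up h1 2 (by omega) (by omega)
        (Or.inl (by push_cast; linear_combination r5 + r6 + r7 - r8))]

lemma bFun_ne {u v : A × (ZMod t → ZMod 2)} (h : u ≠ v) : bFun u ≠ bFun v := fun e => h (by
  rw [← bFun_bFun u, e, bFun_bFun])

/-- The vertex `(κ, y)` with the bits `c` and `d` at `0` and `1` and all other bits `0`. -/
def vert (κ : A) (c d : ZMod 2) : A × (ZMod t → ZMod 2) :=
  (κ, fun j => if j = 0 then c else if j = 1 then d else 0)

lemma up_vert_zero {κ κ' : A} {c d c' : ZMod 2} (hr : D.π κ = 0)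
    (h : κ' = κ + D.α + D.τ (c * c')) : D.Up (vert κ c d) (vert κ' c' d) := by
  have hr' : D.res κ = 0 := by rw [res, hr, map_zero]
  refine ⟨?_, fun j hj => ?_⟩
  · simp only [vert, hr', if_true]; exact h
  · simp only [vert, hr'] at hj ⊢
    rw [if_neg hj, if_neg hj]

lemma up_vert_one {κ κ' : A} {c d d' : ZMod 2} (hr : D.π κ = 1)
    (h : κ' = κ + D.α + D.τ (d * d')) : D.Up (vert κ c d) (vert κ' c d') := by
  have h1 : (1 : ZMod t) ≠ 0 := by
    have := natCast_ne_zero (t := t) (n := 1) (by omega) hF.out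
    simpa using this
  have hr' : D.res κ = 1 := by rw [res, hr, map_one]
  refine ⟨?_, fun j hj => ?_⟩
  · simp only [vert, hr', h1, if_true, if_false]; exact h
  · simp only [vert, hr'] at hj ⊢
    simp only [if_neg hj]

lemma vert_ne_of_left {κ κ' : A} {c d c' d' : ZMod 2} (h : c ≠ c') :
    (vert κ c d : A × (ZMod t → ZMod 2)) ≠ vert κ' c' d' := fun e => h (by
  simpa [vert] using congrFun (congrArg Prod.snd e) 0)

lemma vert_ne_of_right {κ κ' : A} {c d c' d' : ZMod 2} (h : d ≠ d') :
    (vert κ c d : A × (ZMod t → ZMod 2)) ≠ vert κ' c' d' := fun e => h (by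
  have h1 : (1 : ZMod t) ≠ 0 := by
    have := natCast_ne_zero (t := t) (n := 1) (by omega) hF.out
    simpa using this
  simpa [vert, h1] using congrFun (congrArg Prod.snd e) 1)

lemma vert_ne_of_phase {κ κ' : A} {c d c' d' : ZMod 2} (h : κ ≠ κ') :
    (vert κ c d : A × (ZMod t → ZMod 2)) ≠ vert κ' c' d' := fun e => h (congrArg Prod.fst e)

lemma vert_zero (κ : A) : (vert κ 0 0 : A × (ZMod t → ZMod 2)) = (κ, 0) :=
  Prod.ext rfl (funext fun j => by simp [vert])

/-- Both upper neighbours of a vertex lie on octagons with any further neighbour. -/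
lemma extendsToOctagon_of_up {v w w' x : A × (ZMod t → ZMod 2)} (hw : D.Up v w) (hw' : D.Up v w')
    (hne : w ≠ w') (hx : D.graph.Adj w x) (hxv : x ≠ v) :
    ExtendsToOctagon D.graph x w v w' := by
  -- By transitivity on upward arcs `v` may be taken as the base vertex and `w` as `(α, 0)`. This
  -- fixes `w'` and leaves three choices for `x`.
  obtain ⟨g, hg, h1, h2⟩ := D.exists_oriented_arc hw
  have h0 : D.π (0 : A) = 0 := map_zero _
  have hτ1 : D.τ 1 + D.τ 1 = 0 := D.τ_mul_self 1
  have hτne : D.τ 1 ≠ 0 := fun h => absurd (D.τ_injective (h.trans (map_zero _).symm)) (by decide)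
  have h1' : D.action g v = vert 0 0 0 := by rw [h1, vert_zero]; rfl
  have h2' : D.action g w = vert D.α 0 0 := by rw [h2, vert_zero]
  have h3 : D.action g w' = vert D.α 1 0 := by
    have e1 := hg _ _ hw
    have e2 := hg _ _ hw'
    have e3 : D.Up (vert 0 0 0) (vert D.α 1 0 : A × (ZMod t → ZMod 2)) :=
      D.up_vert_zero h0 (by simp)
    rw [h1'] at e1 e2
    rcases D.eq_of_three_upper e1 e2 e3 with h | h | h
    · exact absurd ((D.action g).injective h) hne
    · rw [h2'] at h
      exact absurd h (vert_ne_of_left (by decide))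
    · exact h
  have hup : ∀ {a b : A × (ZMod t → ZMod 2)}, D.Up a b → D.graph.Adj a b := fun h =>
    D.adj_iff.2 (Or.inl h)
  suffices h : ExtendsToOctagon D.graph (D.action g x) (vert D.α 0 0) (vert 0 0 0)
      (vert D.α 1 0) by
    rw [← h1', ← h2', ← h3] at h
    have h' := h.map (D.action g⁻¹)
    simpa only [action_inv_action] using h'
  have hx' : D.action g x = vert (D.α + D.α) 0 0 ∨ D.action g x = vert (D.α + D.α) 0 1 ∨
      D.action g x = vert 0 1 0 := by
    have e0 : D.action g x ≠ vert 0 0 0 := by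
      rw [← h1']; exact (D.action g).injective.ne hxv
    have e := (D.action g).map_rel_iff.2 hx
    rw [D.adj_iff] at e
    rcases e with e | e
    · rw [h2'] at e
      have f1 : D.Up (vert D.α 0 0) (vert (D.α + D.α) 0 0 : A × (ZMod t → ZMod 2)) :=
        D.up_vert_one D.π_α (by simp)
      have f2 : D.Up (vert D.α 0 0) (vert (D.α + D.α) 0 1 : A × (ZMod t → ZMod 2)) :=
        D.up_vert_one D.π_α (by simp)
      rcases D.eq_of_three_upper e f1 f2 with h | h | h
      · exact Or.inl h
      · exact Or.inr (Or.inl h)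
      · exact absurd h (vert_ne_of_right (by decide))
    · rw [h2'] at e
      have f1 : D.Up (vert 0 0 0) (vert D.α 0 0 : A × (ZMod t → ZMod 2)) :=
        D.up_vert_zero h0 (by simp)
      have f2 : D.Up (vert 0 1 0) (vert D.α 0 0 : A × (ZMod t → ZMod 2)) :=
        D.up_vert_zero h0 (by simp)
      rcases D.eq_of_three_lower e f1 f2 with h | h | h
      · exact absurd h e0
      · exact Or.inr (Or.inr h)
      · exact absurd h (vert_ne_of_left (by decide))
  have hπz : D.π (D.τ 1) = 0 := D.π_τ 1
  have hπa : D.π (D.α + D.τ 1) = 1 := by rw [map_add, D.π_α, D.π_τ, add_zero]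
  -- For `x` above `w` the octagon runs through the levels `2, 1, 0, 1, 2, 1, 0, 1`, changing the
  -- bits 0 and 1 alternately; if `x` has bit 1 at position 1, three of the vertices chosen acquire
  -- the phase `τ 1`. For `x` below `w` it stays on the levels 0 and 1.
  rcases hx' with hx' | hx' | hx' <;> rw [hx']
  · refine ⟨vert (D.α + D.α) 1 0, vert D.α 1 1, vert 0 0 1, vert D.α 0 1,
      hup (D.up_vert_one D.π_α (by simp)), (hup (D.up_vert_one D.π_α (by simp))).symm,
      (hup (D.up_vert_zero h0 (by simp))).symm, hup (D.up_vert_zero h0 (by simp)),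
      hup (D.up_vert_one D.π_α (by simp)), vert_ne_of_left (by decide),
      vert_ne_of_right (by decide), vert_ne_of_right (by decide), vert_ne_of_left (by decide),
      vert_ne_of_right (by decide), vert_ne_of_right (by decide)⟩
  · refine ⟨vert (D.α + D.α) 1 1, vert (D.α + D.τ 1) 1 1, vert (D.τ 1) 0 1,
      vert (D.α + D.τ 1) 0 1,
      hup (D.up_vert_one D.π_α (by simp)), (hup (D.up_vert_one hπa ?_)).symm,
      (hup (D.up_vert_zero hπz (by simp [add_comm]))).symm,
      hup (D.up_vert_zero hπz (by simp [add_comm])),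
      hup (D.up_vert_one hπa ?_), vert_ne_of_left (by decide),
      vert_ne_of_right (by decide), vert_ne_of_left (by decide), vert_ne_of_left (by decide),
      vert_ne_of_phase ?_, vert_ne_of_right (by decide)⟩
    · rw [one_mul, add_right_comm D.α, add_assoc (D.α + D.α), hτ1, add_zero]
    · rw [one_mul, add_right_comm D.α, add_assoc (D.α + D.α), hτ1, add_zero]
    · intro h
      have h2 := natCast_level_ne_zero (t := t) (n := 2) (by omega) (by have := hF.out; omega)
      have h3 := congrArg D.π h
      rw [map_add, D.π_α, D.π_τ] at h3
      exact h2 (by push_cast; linear_combination h3)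
  · refine ⟨vert (D.τ 1) 1 0, vert (D.α + D.τ 1) 0 0, vert (D.τ 1) 0 0, vert (D.α + D.τ 1) 1 0,
      (hup (D.up_vert_zero hπz ?_)).symm, hup (D.up_vert_zero hπz (by simp [add_comm])),
      (hup (D.up_vert_zero hπz (by simp [add_comm]))).symm,
      hup (D.up_vert_zero hπz (by simp [add_comm])),
      (hup (D.up_vert_zero h0 (by simp))).symm, vert_ne_of_left (by decide),
      vert_ne_of_left (by decide), vert_ne_of_left (by decide), vert_ne_of_left (by decide),
      vert_ne_of_left (by decide), vert_ne_of_left (by decide)⟩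
    rw [one_mul, add_comm (D.τ 1), add_assoc, hτ1, add_zero]

lemma extendsToOctagon_bFun {x w v w' : A × (ZMod t → ZMod 2)}
    (h : ExtendsToOctagon D.graph (bFun x) (bFun w) (bFun v) (bFun w')) :
    ExtendsToOctagon D.graph x w v w' := by
  have h' := h.map D.bIso
  rw [← bFun_bFun x, ← bFun_bFun w, ← bFun_bFun v, ← bFun_bFun w']
  exact h'

lemma adj_bFun {u v : A × (ZMod t → ZMod 2)} (h : D.graph.Adj u v) :
    D.graph.Adj (bFun u) (bFun v) := D.bIso.map_rel_iff.2 h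

/-- For `t ≥ 5` automorphisms preserve the sides of neighbourhoods. -/
lemma preserves_side_of_five_le (ht : 5 ≤ t) (φ : D.graph ≃g D.graph)
    (v w w' : A × (ZMod t → ZMod 2)) (hs : D.Side v w w') : D.Side (φ v) (φ w) (φ w') := by
  have hw : D.graph.Adj v w := D.adj_iff.2 (hs.elim (fun h => Or.inl h.1) (fun h => Or.inr h.1))
  have hw' : D.graph.Adj v w' := D.adj_iff.2 (hs.elim (fun h => Or.inl h.2) (fun h => Or.inr h.2))
  by_cases hne : w = w'
  · subst hne
    exact (D.adj_iff.1 (φ.map_rel_iff.2 hw)).imp (fun h => ⟨h, h⟩) (fun h => ⟨h, h⟩)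
  have hall : ∀ x, D.graph.Adj w x → x ≠ v → ExtendsToOctagon D.graph x w v w' := by
    intro x hx hxv
    rcases hs with ⟨h, h'⟩ | ⟨h, h'⟩
    · exact D.extendsToOctagon_of_up h h' hne hx hxv
    · exact D.extendsToOctagon_bFun (D.extendsToOctagon_of_up (D.up_bFun h) (D.up_bFun h')
        (bFun_ne hne) (D.adj_bFun hx) (bFun_ne hxv))
  have hall' : ∀ x, D.graph.Adj (φ w) x → x ≠ φ v →
      ExtendsToOctagon D.graph x (φ w) (φ v) (φ w') := by
    intro x hx hxv
    obtain ⟨x, rfl⟩ := φ.surjective x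
    exact (hall x (φ.map_rel_iff.1 hx) fun h => hxv (by rw [h])).map φ
  -- If the images lay on opposite sides, a neighbour of `φ w` continuing in the same direction
  -- would give a directed 3-arc that extends to an octagon.
  rcases D.adj_iff.1 (φ.map_rel_iff.2 hw) with h1 | h1 <;>
    rcases D.adj_iff.1 (φ.map_rel_iff.2 hw') with h2 | h2
  · exact Or.inl ⟨h1, h2⟩
  · exfalso
    have h3 := D.up_up 0 (φ w)
    refine D.not_extendsToOctagon ht (D.up_bFun h3) (D.up_bFun h1) (D.up_bFun h2) ?_
    refine (hall' _ (D.adj_iff.2 (Or.inl h3)) fun e => ?_).map D.bIso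
    rw [e] at h3
    exact D.not_up_of_up h1 h3
  · exfalso
    have h3 := D.up_dn 0 (φ w)
    refine D.not_extendsToOctagon ht h3 h1 h2 (hall' _ (D.adj_iff.2 (Or.inr h3)) fun e => ?_)
    rw [e] at h3
    exact D.not_up_of_up h1 h3
  · exact Or.inr ⟨h1, h2⟩

end PhaseGroup

/-- The automorphism group of the model of `Γ_t^+`. -/
lemma plusPhase_preserves_side {t : ℕ} [hF : Fact (2 ≤ t)] :
    ∀ (φ : (plusPhase t).graph ≃g (plusPhase t).graph) v w w', (plusPhase t).Side v w w' →
      (plusPhase t).Side (φ v) (φ w) (φ w') := by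
  intro φ
  have ht := hF.out
  rcases Nat.lt_or_ge t 5 with h | h
  · interval_cases t
    · exact (plusPhase 2).preserves_side_of_walkCount Function.injective_id 1 walkCount_plus_two φ
    · exact (plusPhase 3).preserves_side_of_walkCount Function.injective_id 2
        walkCount_plus_three φ
    · exact (plusPhase 4).preserves_side_of_walkCount
        (codeFour_injective (codePlus_injective _)) 3 walkCount_plus_four φ
  · exact (plusPhase t).preserves_side_of_five_le h φ

/-- The automorphism group of the model of `Γ_t^-` for `t ≥ 3`. -/
lemma minusPhase_preserves_side {t : ℕ} [hF : Fact (2 ≤ t)] (ht : 3 ≤ t) :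
    ∀ (φ : (minusPhase t).graph ≃g (minusPhase t).graph) v w w', (minusPhase t).Side v w w' →
      (minusPhase t).Side (φ v) (φ w) (φ w') := by
  intro φ
  rcases Nat.lt_or_ge t 5 with h | h
  · interval_cases t
    · exact (minusPhase 3).preserves_side_of_walkCount
        (codeThree_injective (ZMod.val_injective _)) 3 walkCount_minus_three φ
    · exact (minusPhase 4).preserves_side_of_walkCount
        (codeFour_injective (ZMod.val_injective _)) 3 walkCount_minus_four φ
  · exact (minusPhase t).preserves_side_of_five_le h φ

/-! ### General facts about short cycles and girth. -/

section Cycles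

variable {V : Type*} {Γ : SimpleGraph V}

lemma exists_closed_walk_four {v : V} {p : Γ.Walk v v} (hp : p.IsCycle) (hl : p.length = 4) :
    ∃ v₀ v₁ v₂ v₃, Γ.Adj v₀ v₁ ∧ Γ.Adj v₁ v₂ ∧ Γ.Adj v₂ v₃ ∧ Γ.Adj v₃ v₀ ∧ v₀ ≠ v₂ ∧ v₁ ≠ v₃ := by
  have hadj : ∀ i, i < 4 → Γ.Adj (p.getVert i) (p.getVert (i + 1)) := fun i hi =>
    p.adj_getVert_succ (by omega)
  have h4 : p.getVert 4 = p.getVert 0 := by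
    rw [← hl, p.getVert_length, p.getVert_zero]
  have hinj := hp.getVert_injOn
  rw [hl] at hinj
  refine ⟨_, _, _, _, hadj 0 (by omega), hadj 1 (by omega), hadj 2 (by omega),
    h4 ▸ hadj 3 (by omega), fun h => ?_, fun h => ?_⟩
  -- Injectivity of `getVert` on a cycle concerns the indices from 1 to the length, so the start is
  -- read as the last vertex.
  · rw [← h4] at h
    exact absurd (hinj (by simp) (by simp) h) (by omega)
  · exact absurd (hinj (by simp) (by simp) h) (by omega)

lemma exists_closed_walk_six {v : V} {p : Γ.Walk v v} (hp : p.IsCycle) (hl : p.length = 6) :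
    ∃ v₀ v₁ v₂ v₃ v₄ v₅, Γ.Adj v₀ v₁ ∧ Γ.Adj v₁ v₂ ∧ Γ.Adj v₂ v₃ ∧ Γ.Adj v₃ v₄ ∧ Γ.Adj v₄ v₅ ∧
      Γ.Adj v₅ v₀ ∧ v₀ ≠ v₂ ∧ v₁ ≠ v₃ ∧ v₂ ≠ v₄ ∧ v₃ ≠ v₅ ∧ v₄ ≠ v₀ ∧ v₅ ≠ v₁ := by
  have hadj : ∀ i, i < 6 → Γ.Adj (p.getVert i) (p.getVert (i + 1)) := fun i hi =>
    p.adj_getVert_succ (by omega)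
  have h6 : p.getVert 6 = p.getVert 0 := by
    rw [← hl, p.getVert_length, p.getVert_zero]
  have hinj := hp.getVert_injOn
  rw [hl] at hinj
  refine ⟨_, _, _, _, _, _, hadj 0 (by omega), hadj 1 (by omega), hadj 2 (by omega),
    hadj 3 (by omega), hadj 4 (by omega), h6 ▸ hadj 5 (by omega), fun h => ?_, fun h => ?_,
    fun h => ?_, fun h => ?_, fun h => ?_, fun h => ?_⟩
  · rw [← h6] at h
    exact absurd (hinj (by simp) (by simp) h) (by omega)
  · exact absurd (hinj (by simp) (by simp) h) (by omega)
  · exact absurd (hinj (by simp) (by simp) h) (by omega)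
  · exact absurd (hinj (by simp) (by simp) h) (by omega)
  · rw [← h6] at h
    exact absurd (hinj (by simp) (by simp) h) (by omega)
  · exact absurd (hinj (by simp) (by simp) h) (by omega)

/-- A list of distinct vertices, consecutive ones being adjacent, is the support of a path. -/
lemma exists_isPath_of_isChain (l : List V) (v : V) (hl : List.IsChain Γ.Adj (v :: l))
    (hn : (v :: l).Nodup) : ∃ u, ∃ p : Γ.Walk v u, p.IsPath ∧ p.support = v :: l := by
  induction l generalizing v with
  | nil => exact ⟨v, .nil, .nil, rfl⟩
  | cons w l ih =>
    rw [List.isChain_cons_cons] at hl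
    obtain ⟨u, p, hp, hs⟩ := ih w hl.2 (List.nodup_cons.1 hn).2
    refine ⟨u, .cons hl.1 p, hp.cons ?_, ?_⟩
    · rw [hs]
      exact (List.nodup_cons.1 hn).1
    · rw [SimpleGraph.Walk.support_cons, hs]

/-- Cycles of length at least three from cyclic lists of distinct vertices. -/
lemma girth_le_of_isChain (l : List V) (v : V) (hl : List.IsChain Γ.Adj (v :: l))
    (hn : (v :: l).Nodup) (hlen : 2 ≤ l.length)
    (hc : Γ.Adj ((v :: l).getLast (by simp)) v) :
    Γ.girth ≤ l.length + 1 ∧ ¬ Γ.IsAcyclic := by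
  obtain ⟨u, p, hp, hs⟩ := exists_isPath_of_isChain l v hl hn
  have hu : u = (v :: l).getLast (by simp) := by
    rw [← p.getLast_support]
    simp only [hs]
  rw [← hu] at hc
  have hpl : p.length = l.length := by
    have := p.length_support
    rw [hs, List.length_cons] at this
    omega
  have hcyc : (SimpleGraph.Walk.cons hc p).IsCycle := by
    rw [SimpleGraph.Walk.isCycle_iff_isPath_tail_and_le_length]
    refine ⟨?_, by rw [SimpleGraph.Walk.length_cons]; omega⟩
    simpa using hp
  refine ⟨?_, fun h => h _ hcyc⟩
  have := SimpleGraph.girth_le_length hcyc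
  rwa [SimpleGraph.Walk.length_cons, hpl] at this

lemma le_girth_of_forall {n : ℕ} (ha : ¬ Γ.IsAcyclic)
    (h : ∀ (v : V) (p : Γ.Walk v v), p.IsCycle → n ≤ p.length) : n ≤ Γ.girth := by
  obtain ⟨v, p, hp, hl⟩ := SimpleGraph.exists_girth_eq_length.2 ha
  rw [hl]
  exact h v p hp

end Cycles

/-! ### The girth. -/

namespace PhaseGroup

variable {t : ℕ} {ε : Sgn} {A : Type} [AddCommGroup A] (D : PhaseGroup t ε A)
variable [hF : Fact (2 ≤ t)]

/-- As `2t` is even, a level has a parity, and every edge changes it. -/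
lemma even_length {u v : A × (ZMod t → ZMod 2)} (p : D.graph.Walk u v) :
    ZMod.castHom (Dvd.intro t rfl) (ZMod 2) (D.π v.1) =
      ZMod.castHom (Dvd.intro t rfl) (ZMod 2) (D.π u.1) + (p.length : ZMod 2) := by
  induction p with
  | nil => simp
  | cons h p ih =>
    rw [ih, SimpleGraph.Walk.length_cons]
    rcases D.adj_iff.1 h with h | h <;> rw [D.π_of_up h, map_add, map_one] <;> push_cast
    · ring
    · linear_combination -(CharTwo.two_eq_zero (R := ZMod 2))

lemma even_of_closed {v : A × (ZMod t → ZMod 2)} (p : D.graph.Walk v v) : Even p.length := by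
  have := D.even_length p
  rw [left_eq_add] at this
  exact (ZMod.natCast_eq_zero_iff_even).1 this

/-- The letters `u` and `d` in the names of this group of lemmas are the upward and downward steps
of a closed walk. Outside the alternating patterns the argument is always the same: the two edges at
a turn have the same bit at the residue of their gap, because no other edge of the walk rewrites it,
so they coincide. -/
lemma not_uudd {v₀ v₁ v₂ v₃ : A × (ZMod t → ZMod 2)} (h₀ : D.Up v₀ v₁) (h₁ : D.Up v₁ v₂)
    (h₂ : D.Up v₃ v₂) (h₃ : D.Up v₀ v₃) (hne : v₁ ≠ v₃) : False := by
  have ht := hF.out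
  have r₀ := D.res_of_up h₀
  have r₃ := D.res_of_up h₃
  refine hne (D.eq_of_up_of_bit' h₀ h₃ ?_)
  rw [← D.bit_of_up h₁ 1 (by omega) (by omega) (Or.inr (by push_cast; linear_combination r₀)),
    D.bit_of_up h₂ 1 (by omega) (by omega) (Or.inr (by push_cast; linear_combination r₃))]

/-- The two lower vertices have different bits `a, c` and the two upper vertices different bits `x,
y`. The total twist is then `(a + c) (x + y) = 1`, so this 4-cycle of the quotient does not lift to
a closed walk. -/
lemma not_udud {v₀ v₁ v₂ v₃ : A × (ZMod t → ZMod 2)} (h₀ : D.Up v₀ v₁) (h₁ : D.Up v₂ v₁)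
    (h₂ : D.Up v₂ v₃) (h₃ : D.Up v₀ v₃) (hne : v₀ ≠ v₂) (hne' : v₁ ≠ v₃) : False := by
  have r : D.res v₂.1 = D.res v₀.1 := by
    have := D.res_of_up h₀
    rw [D.res_of_up h₁] at this
    linear_combination this
  have b : v₀.2 (D.res v₀.1) ≠ v₂.2 (D.res v₀.1) := fun h => hne (D.eq_of_up_of_bit h₀ h₁ h)
  have b' : v₁.2 (D.res v₀.1) ≠ v₃.2 (D.res v₀.1) := fun h => hne' (D.eq_of_up_of_bit' h₀ h₃ h)
  have e₀ := h₀.1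
  have e₁ := h₁.1
  have e₂ := h₂.1
  have e₃ := h₃.1
  rw [r] at e₁ e₂
  generalize v₀.2 (D.res v₀.1) = a at *
  generalize v₂.2 (D.res v₀.1) = c at *
  generalize v₁.2 (D.res v₀.1) = x at *
  generalize v₃.2 (D.res v₀.1) = y at *
  have key : D.τ (a * x) + D.τ (c * y) = D.τ (c * x) + D.τ (a * y) := by
    rw [e₀] at e₁
    rw [e₃] at e₂
    have h1 : D.τ (a * x) = v₂.1 - v₀.1 + D.τ (c * x) := by
      have := congrArg (fun k => k - v₀.1 - D.α) e₁
      rw [show v₀.1 + D.α + D.τ (a * x) - v₀.1 - D.α = D.τ (a * x) by abel] at this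
      rw [this]; abel
    have h2 : D.τ (a * y) = v₂.1 - v₀.1 + D.τ (c * y) := by
      have := congrArg (fun k => k - v₀.1 - D.α) e₂
      rw [show v₀.1 + D.α + D.τ (a * y) - v₀.1 - D.α = D.τ (a * y) by abel] at this
      rw [this]; abel
    rw [h1, h2]; abel
  rw [← map_add, ← map_add] at key
  have := D.τ_injective key
  clear key e₀ e₁ e₂ e₃
  revert a c x y
  decide

lemma not_uuuddd (ht : 3 ≤ t) {v₀ v₁ v₂ v₃ v₄ v₅ : A × (ZMod t → ZMod 2)} (h₀ : D.Up v₀ v₁)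
    (h₁ : D.Up v₁ v₂) (h₂ : D.Up v₂ v₃) (h₃ : D.Up v₄ v₃) (h₄ : D.Up v₅ v₄) (h₅ : D.Up v₀ v₅)
    (hne : v₁ ≠ v₅) : False := by
  have r₀ := D.res_of_up h₀
  have r₁ := D.res_of_up h₁
  have r₄ := D.res_of_up h₄
  have r₅ := D.res_of_up h₅
  refine hne (D.eq_of_up_of_bit' h₀ h₅ ?_)
  rw [← D.bit_of_up h₁ 1 (by omega) (by omega) (Or.inr (by push_cast; linear_combination r₀)),
    ← D.bit_of_up h₂ 2 (by omega) (by omega) (Or.inr (by push_cast; linear_combination r₀ + r₁)),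
    D.bit_of_up h₃ 2 (by omega) (by omega) (Or.inr (by push_cast; linear_combination r₅ + r₄)),
    D.bit_of_up h₄ 1 (by omega) (by omega) (Or.inr (by push_cast; linear_combination r₅))]

lemma not_uududd {v₀ v₁ v₂ v₃ v₄ v₅ : A × (ZMod t → ZMod 2)} (h₀ : D.Up v₀ v₁)
    (h₁ : D.Up v₁ v₂) (h₂ : D.Up v₃ v₂) (h₃ : D.Up v₃ v₄) (h₄ : D.Up v₅ v₄) (h₅ : D.Up v₀ v₅)
    (hne : v₁ ≠ v₅) : False := by
  have ht := hF.out
  have r₀ := D.res_of_up h₀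
  have r₁ := D.res_of_up h₁
  have r₂ := D.res_of_up h₂
  have r₅ := D.res_of_up h₅
  refine hne (D.eq_of_up_of_bit' h₀ h₅ ?_)
  rw [← D.bit_of_up h₁ 1 (by omega) (by omega) (Or.inr (by push_cast; linear_combination r₀)),
    D.bit_of_up h₂ 1 (by omega) (by omega)
      (Or.inr (by push_cast; linear_combination r₀ + r₁ - r₂)),
    ← D.bit_of_up h₃ 1 (by omega) (by omega)
      (Or.inr (by push_cast; linear_combination r₀ + r₁ - r₂)),
    D.bit_of_up h₄ 1 (by omega) (by omega) (Or.inr (by push_cast; linear_combination r₅))]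

lemma not_uuddud {v₀ v₁ v₂ v₃ v₄ v₅ : A × (ZMod t → ZMod 2)} (h₀ : D.Up v₀ v₁)
    (h₁ : D.Up v₁ v₂) (h₂ : D.Up v₃ v₂) (h₃ : D.Up v₄ v₃) (h₄ : D.Up v₄ v₅) (h₅ : D.Up v₀ v₅)
    (hne : v₁ ≠ v₃) : False := by
  have ht := hF.out
  have r₀ := D.res_of_up h₀
  have r₄ := D.res_of_up h₄
  have r₅ := D.res_of_up h₅
  refine hne (D.eq_of_up_of_bit h₁ h₂ ?_)
  rw [D.bit_of_up h₀ 1 (by omega) (by omega) (Or.inl (by push_cast; linear_combination r₀)),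
    ← D.bit_of_up h₅ 1 (by omega) (by omega) (Or.inl (by push_cast; linear_combination r₀)),
    D.bit_of_up h₄ 1 (by omega) (by omega)
      (Or.inl (by push_cast; linear_combination r₀ + r₄ - r₅)),
    ← D.bit_of_up h₃ 1 (by omega) (by omega)
      (Or.inl (by push_cast; linear_combination r₀ + r₄ - r₅))]

/-- The three vertices on the lower level would need three pairwise different bits at the same
position. -/
lemma not_ududud {v₀ v₁ v₂ v₃ v₄ v₅ : A × (ZMod t → ZMod 2)} (h₀ : D.Up v₀ v₁)
    (h₁ : D.Up v₂ v₁) (h₂ : D.Up v₂ v₃) (h₃ : D.Up v₄ v₃) (h₄ : D.Up v₄ v₅) (h₅ : D.Up v₀ v₅)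
    (hne : v₀ ≠ v₂) (hne' : v₂ ≠ v₄) (hne'' : v₄ ≠ v₀) : False := by
  have r : D.res v₂.1 = D.res v₀.1 := by
    have := D.res_of_up h₀
    rw [D.res_of_up h₁] at this
    linear_combination this
  have r' : D.res v₄.1 = D.res v₀.1 := by
    have := D.res_of_up h₅
    rw [D.res_of_up h₄] at this
    linear_combination this
  have b : v₀.2 (D.res v₀.1) ≠ v₂.2 (D.res v₀.1) := fun h => hne (D.eq_of_up_of_bit h₀ h₁ h)
  have b' : v₂.2 (D.res v₀.1) ≠ v₄.2 (D.res v₀.1) := fun h =>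
    hne' (D.eq_of_up_of_bit h₂ h₃ (by rw [r, h]))
  have b'' : v₄.2 (D.res v₀.1) ≠ v₀.2 (D.res v₀.1) := fun h =>
    hne'' (D.eq_of_up_of_bit h₄ h₅ (by rw [r', h]))
  generalize v₀.2 (D.res v₀.1) = a at *
  generalize v₂.2 (D.res v₀.1) = c at *
  generalize v₄.2 (D.res v₀.1) = x at *
  clear r r' h₀ h₁ h₂ h₃ h₄ h₅ hne hne' hne''
  revert a c x
  decide

lemma level_cases {u v : A × (ZMod t → ZMod 2)} (h : D.graph.Adj u v) :
    (D.Up u v ∧ D.π v.1 = D.π u.1 + 1) ∨ (D.Up v u ∧ D.π v.1 = D.π u.1 - 1) := by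
  rcases D.adj_iff.1 h with h | h
  · exact Or.inl ⟨h, D.π_of_up h⟩
  · exact Or.inr ⟨h, by rw [D.π_of_up h]; ring⟩

/-- A nonzero sum of four signs is at most 4 in absolute value and cannot vanish modulo `2t ≥ 6`.
The balanced patterns are the rotations of `uudd` and `udud`. -/
lemma length_ne_four (ht : 3 ≤ t) {v : A × (ZMod t → ZMod 2)} {p : D.graph.Walk v v}
    (hp : p.IsCycle) : p.length ≠ 4 := by
  intro hl
  obtain ⟨v₀, v₁, v₂, v₃, h₀, h₁, h₂, h₃, n₀, n₁⟩ := exists_closed_walk_four hp hl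
  have z2 := natCast_level_ne_zero (t := t) (n := 2) (by omega) (by omega)
  have z4 := natCast_level_ne_zero (t := t) (n := 4) (by omega) (by omega)
  push_cast at z2 z4
  rcases D.level_cases h₀ with ⟨h₀, l₀⟩ | ⟨h₀, l₀⟩ <;>
  rcases D.level_cases h₁ with ⟨h₁, l₁⟩ | ⟨h₁, l₁⟩ <;>
  rcases D.level_cases h₂ with ⟨h₂, l₂⟩ | ⟨h₂, l₂⟩ <;>
  rcases D.level_cases h₃ with ⟨h₃, l₃⟩ | ⟨h₃, l₃⟩ <;>
  first
  | exact absurd (by linear_combination -(l₀ + l₁ + l₂ + l₃)) z2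
  | exact absurd (by linear_combination l₀ + l₁ + l₂ + l₃) z2
  | exact absurd (by linear_combination -(l₀ + l₁ + l₂ + l₃)) z4
  | exact absurd (by linear_combination l₀ + l₁ + l₂ + l₃) z4
  | exact D.not_uudd h₀ h₁ h₂ h₃ n₁
  | exact D.not_uudd h₁ h₂ h₃ h₀ n₀.symm
  | exact D.not_uudd h₂ h₃ h₀ h₁ n₁.symm
  | exact D.not_uudd h₃ h₀ h₁ h₂ n₀
  | exact D.not_udud h₀ h₁ h₂ h₃ n₀ n₁
  | exact D.not_udud h₁ h₂ h₃ h₀ n₁ n₀.symm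

/-- The bound `2t ≥ 8` forces three upward and three downward steps. Up to rotation there are four
such patterns: `uuuddd`, `uududd`, `uuddud` and `ududud`. -/
lemma length_ne_six (ht : 4 ≤ t) {v : A × (ZMod t → ZMod 2)} {p : D.graph.Walk v v}
    (hp : p.IsCycle) : p.length ≠ 6 := by
  intro hl
  obtain ⟨v₀, v₁, v₂, v₃, v₄, v₅, h₀, h₁, h₂, h₃, h₄, h₅, n₀, n₁, n₂, n₃, n₄, n₅⟩ :=
    exists_closed_walk_six hp hl
  have z2 := natCast_level_ne_zero (t := t) (n := 2) (by omega) (by omega)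
  have z4 := natCast_level_ne_zero (t := t) (n := 4) (by omega) (by omega)
  have z6 := natCast_level_ne_zero (t := t) (n := 6) (by omega) (by omega)
  push_cast at z2 z4 z6
  have ht' : 3 ≤ t := by omega
  rcases D.level_cases h₀ with ⟨h₀, l₀⟩ | ⟨h₀, l₀⟩ <;>
  rcases D.level_cases h₁ with ⟨h₁, l₁⟩ | ⟨h₁, l₁⟩ <;>
  rcases D.level_cases h₂ with ⟨h₂, l₂⟩ | ⟨h₂, l₂⟩ <;>
  rcases D.level_cases h₃ with ⟨h₃, l₃⟩ | ⟨h₃, l₃⟩ <;>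
  rcases D.level_cases h₄ with ⟨h₄, l₄⟩ | ⟨h₄, l₄⟩ <;>
  rcases D.level_cases h₅ with ⟨h₅, l₅⟩ | ⟨h₅, l₅⟩ <;>
  first
  | exact absurd (by linear_combination -(l₀ + l₁ + l₂ + l₃ + l₄ + l₅)) z2
  | exact absurd (by linear_combination l₀ + l₁ + l₂ + l₃ + l₄ + l₅) z2
  | exact absurd (by linear_combination -(l₀ + l₁ + l₂ + l₃ + l₄ + l₅)) z4
  | exact absurd (by linear_combination l₀ + l₁ + l₂ + l₃ + l₄ + l₅) z4
  | exact absurd (by linear_combination -(l₀ + l₁ + l₂ + l₃ + l₄ + l₅)) z6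
  | exact absurd (by linear_combination l₀ + l₁ + l₂ + l₃ + l₄ + l₅) z6
  | exact D.not_uuuddd ht' h₀ h₁ h₂ h₃ h₄ h₅ n₅.symm
  | exact D.not_uuuddd ht' h₁ h₂ h₃ h₄ h₅ h₀ n₀.symm
  | exact D.not_uuuddd ht' h₂ h₃ h₄ h₅ h₀ h₁ n₁.symm
  | exact D.not_uuuddd ht' h₃ h₄ h₅ h₀ h₁ h₂ n₂.symm
  | exact D.not_uuuddd ht' h₄ h₅ h₀ h₁ h₂ h₃ n₃.symm
  | exact D.not_uuuddd ht' h₅ h₀ h₁ h₂ h₃ h₄ n₄.symm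
  | exact D.not_uududd h₀ h₁ h₂ h₃ h₄ h₅ n₅.symm
  | exact D.not_uududd h₁ h₂ h₃ h₄ h₅ h₀ n₀.symm
  | exact D.not_uududd h₂ h₃ h₄ h₅ h₀ h₁ n₁.symm
  | exact D.not_uududd h₃ h₄ h₅ h₀ h₁ h₂ n₂.symm
  | exact D.not_uududd h₄ h₅ h₀ h₁ h₂ h₃ n₃.symm
  | exact D.not_uududd h₅ h₀ h₁ h₂ h₃ h₄ n₄.symm
  | exact D.not_uuddud h₀ h₁ h₂ h₃ h₄ h₅ n₁
  | exact D.not_uuddud h₁ h₂ h₃ h₄ h₅ h₀ n₂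
  | exact D.not_uuddud h₂ h₃ h₄ h₅ h₀ h₁ n₃
  | exact D.not_uuddud h₃ h₄ h₅ h₀ h₁ h₂ n₄
  | exact D.not_uuddud h₄ h₅ h₀ h₁ h₂ h₃ n₅
  | exact D.not_uuddud h₅ h₀ h₁ h₂ h₃ h₄ n₀
  | exact D.not_ududud h₀ h₁ h₂ h₃ h₄ h₅ n₀ n₂ n₄
  | exact D.not_ududud h₁ h₂ h₃ h₄ h₅ h₀ n₁ n₃ n₅

lemma length_ge_three_even {v : A × (ZMod t → ZMod 2)} {p : D.graph.Walk v v}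
    (hp : p.IsCycle) : ∃ n, 2 ≤ n ∧ p.length = n + n := by
  obtain ⟨n, hn⟩ := D.even_of_closed p
  exact ⟨n, by have := hp.three_le_length; omega, hn⟩

/-- The graph always contains a cycle of length eight. -/
lemma girth_le_eight : D.graph.girth ≤ 8 ∧ ¬ D.graph.IsAcyclic := by
  have h0 : D.π (0 : A) = 0 := map_zero _
  have hτ1 : D.τ 1 + D.τ 1 = 0 := D.τ_mul_self 1
  have hτne : D.τ 1 ≠ 0 := fun h => absurd (D.τ_injective (h.trans (map_zero _).symm)) (by decide)
  have hπz : D.π (D.τ 1) = 0 := D.π_τ 1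
  have hup : ∀ {a b : A × (ZMod t → ZMod 2)}, D.Up a b → D.graph.Adj a b := fun h =>
    D.adj_iff.2 (Or.inl h)
  have hα : ∀ c d : ZMod 2, D.τ c ≠ D.α + D.τ d := fun c d h => one_ne_zero_level (t := t) (by
    have := congrArg D.π h
    rw [map_add, D.π_τ, D.π_τ, D.π_α, add_zero] at this
    exact this.symm)
  have a1 : D.α ≠ 0 := fun h => hα 0 0 (by simp [h])
  have a2 : D.α + D.τ 1 ≠ 0 := fun h => hα 0 1 (by simp [h])
  have a3 : D.τ 1 ≠ D.α := fun h => hα 1 0 (by simp [h])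
  have a4 : D.τ 1 ≠ D.α + D.τ 1 := hα 1 1
  have a5 : D.α ≠ D.α + D.τ 1 := fun h => hτne (by simpa using h)
  -- This cycle lies between the levels 0 and 1. It is the 4-cycle formed by the old and new values
  -- of bit 0, traversed twice, since one round changes the phase by `τ 1`.
  refine girth_le_of_isChain [vert D.α 0 0, vert 0 0 0, vert D.α 1 0, vert (D.τ 1) 1 0,
    vert (D.α + D.τ 1) 0 0, vert (D.τ 1) 0 0, vert (D.α + D.τ 1) 1 0] (vert 0 1 0) ?_ ?_
    (by simp) ?_
  · simp only [List.isChain_cons_cons, List.isChain_singleton, and_true]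
    refine ⟨hup (D.up_vert_zero h0 (by simp)), (hup (D.up_vert_zero h0 (by simp))).symm,
      hup (D.up_vert_zero h0 (by simp)), (hup (D.up_vert_zero hπz ?_)).symm,
      hup (D.up_vert_zero hπz (by simp [add_comm])),
      (hup (D.up_vert_zero hπz (by simp [add_comm]))).symm,
      hup (D.up_vert_zero hπz (by simp [add_comm]))⟩
    rw [one_mul, add_comm (D.τ 1), add_assoc, hτ1, add_zero]
  · have l : ∀ {κ κ' : A} {c d c' d' : ZMod 2}, κ ≠ κ' →
        (vert κ c d : A × (ZMod t → ZMod 2)) ≠ vert κ' c' d' := vert_ne_of_phase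
    have l' : ∀ {κ κ' : A} {d d' : ZMod 2}, 
        (vert κ 0 d : A × (ZMod t → ZMod 2)) ≠ vert κ' 1 d' := vert_ne_of_left (by decide)
    simp only [List.nodup_cons, List.mem_cons, List.not_mem_nil, or_false, not_or,
      List.nodup_nil, and_true, not_false_eq_true]
    exact ⟨⟨l'.symm, l'.symm, l a1.symm, l hτne.symm, l'.symm, l'.symm, l a2.symm⟩,
      ⟨l a1, l', l', l a5, l a3.symm, l'⟩, ⟨l', l', l a2.symm, l hτne.symm, l'⟩,
      ⟨l a3.symm, l'.symm, l'.symm, l a5⟩, ⟨l'.symm, l'.symm, l a4⟩, ⟨l a4.symm, l'⟩, l'⟩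
  · exact (hup (D.up_vert_zero h0 (by simp))).symm

lemma girth_eq_eight (ht : 4 ≤ t) : D.graph.girth = 8 := by
  refine le_antisymm D.girth_le_eight.1 (le_girth_of_forall D.girth_le_eight.2 ?_)
  intro v p hp
  obtain ⟨n, h2, hn⟩ := D.length_ge_three_even hp
  have h4 := D.length_ne_four (by omega) hp
  have h6 := D.length_ne_six ht hp
  omega

/-- Cycles of length six are detected at the base vertex. -/
lemma length_ne_six_of_base
    (h : ∀ a ∈ D.nbrs base, ∀ b ∈ D.nbrs a, b ≠ base → ∀ c ∈ D.nbrs b, c ≠ a →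
      ∀ d ∈ D.nbrs c, d ≠ b → ∀ e ∈ D.nbrs d, e ≠ c → base ∈ D.nbrs e → e = a)
    {v : A × (ZMod t → ZMod 2)} {p : D.graph.Walk v v} (hp : p.IsCycle) : p.length ≠ 6 := by
  intro hl
  obtain ⟨v₀, v₁, v₂, v₃, v₄, v₅, h₀, h₁, h₂, h₃, h₄, h₅, n₀, n₁, n₂, n₃, n₄, n₅⟩ :=
    exists_closed_walk_six hp hl
  obtain ⟨g, -, hg⟩ := D.exists_oriented_to_base v₀
  simp only [mem_nbrs] at h
  rw [← hg] at h
  have hi := (D.action g).injective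
  have hm : ∀ {a b}, D.graph.Adj a b → D.graph.Adj (D.action g a) (D.action g b) := fun h =>
    (D.action g).map_rel_iff.2 h
  exact n₅ (hi (h _ (hm h₀) _ (hm h₁) (hi.ne n₀.symm) _ (hm h₂) (hi.ne n₁.symm) _ (hm h₃)
    (hi.ne n₂.symm) _ (hm h₄) (hi.ne n₃.symm) (hm h₅)))

/-- Cycles of length four are detected at the base vertex. -/
lemma length_ne_four_of_base
    (h : ∀ a ∈ D.nbrs base, ∀ b ∈ D.nbrs a, b ≠ base → ∀ c ∈ D.nbrs b, base ∈ D.nbrs c → c = a)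
    {v : A × (ZMod t → ZMod 2)} {p : D.graph.Walk v v} (hp : p.IsCycle) : p.length ≠ 4 := by
  intro hl
  obtain ⟨v₀, v₁, v₂, v₃, h₀, h₁, h₂, h₃, n₀, n₁⟩ := exists_closed_walk_four hp hl
  obtain ⟨g, -, hg⟩ := D.exists_oriented_to_base v₀
  simp only [mem_nbrs] at h
  rw [← hg] at h
  have hi := (D.action g).injective
  have hm : ∀ {a b}, D.graph.Adj a b → D.graph.Adj (D.action g a) (D.action g b) := fun h =>
    (D.action g).map_rel_iff.2 h
  exact n₁ (hi (h _ (hm h₀) _ (hm h₁) (hi.ne n₀.symm) _ (hm h₂) (hm h₃))).symm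

end PhaseGroup

/-- Testing adjacency against the list of four neighbours makes the finite checks computable. -/
instance decidableAdj {t : ℕ} {ε : Sgn} {A : Type} [AddCommGroup A] [DecidableEq A]
    (D : PhaseGroup t ε A) [Fact (2 ≤ t)] : DecidableRel D.graph.Adj := fun _ _ =>
  decidable_of_iff _ D.mem_nbrs

set_option maxRecDepth 100000

-- In `G_3^-` one has `a ^ 6 = z`, so the climb through zero bits does not close after six steps.
-- That no other cycle of length six exists is checked at the base vertex, which suffices by
-- transitivity.
set_option synthInstance.maxHeartbeats 400000 in
set_option synthInstance.maxSize 1000 in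
lemma girth_minus_three : (minusPhase 3).graph.girth = 8 := by
  refine le_antisymm (minusPhase 3).girth_le_eight.1
    (le_girth_of_forall (minusPhase 3).girth_le_eight.2 ?_)
  intro v p hp
  obtain ⟨n, h2, hn⟩ := (minusPhase 3).length_ge_three_even hp
  have h4 := (minusPhase 3).length_ne_four le_rfl hp
  have h6 := (minusPhase 3).length_ne_six_of_base (by decide +kernel) hp
  omega

/-- In `G_3^+` one has `a ^ 6 = 1`, so climbing through the six levels with all bits zero returns to
the start. -/
lemma girth_plus_three : (plusPhase 3).graph.girth = 6 := by
  obtain ⟨h, h'⟩ := girth_le_of_isChain (Γ := (plusPhase 3).graph)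
    [((1, 0), 0), ((2, 0), 0), ((3, 0), 0), ((4, 0), 0), ((5, 0), 0)] ((0, 0), 0)
    (by decide +kernel) (by decide +kernel) (by simp)
    (by decide +kernel)
  refine le_antisymm h (le_girth_of_forall h' ?_)
  intro v p hp
  obtain ⟨n, h2, hn⟩ := (plusPhase 3).length_ge_three_even hp
  have h4 := (plusPhase 3).length_ne_four le_rfl hp
  omega

/-- Here the climb with zero bits closes after four steps, as `a ^ 4 = 1`. -/
lemma girth_plus_two : (plusPhase 2).graph.girth = 4 := by
  obtain ⟨h, h'⟩ := girth_le_of_isChain (Γ := (plusPhase 2).graph)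
    [((1, 0), 0), ((2, 0), 0), ((3, 0), 0)] ((0, 0), 0)
    (by decide +kernel) (by decide +kernel) (by simp)
    (by decide +kernel)
  refine le_antisymm h (le_girth_of_forall h' ?_)
  intro v p hp
  obtain ⟨n, h2, hn⟩ := (plusPhase 2).length_ge_three_even hp
  omega

/-- The 6-cycle winds once round the four levels with five steps up and one down. The net climb
contributes the phase `4 = τ 1`, and the single twist, on the edge from phase 0 to phase 5, cancels
it. -/
lemma girth_minus_two : (minusPhase 2).graph.girth = 6 := by
  obtain ⟨h, h'⟩ := girth_le_of_isChain (Γ := (minusPhase 2).graph)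
    [(1, ![0, 0]), (0, ![1, 0]), (5, ![1, 0]), (6, ![1, 0]), (7, ![0, 0])] (0, ![0, 0])
    (by decide +kernel) (by decide +kernel) (by simp)
    (by decide +kernel)
  refine le_antisymm h (le_girth_of_forall h' ?_)
  intro v p hp
  obtain ⟨n, h2, hn⟩ := (minusPhase 2).length_ge_three_even hp
  have h4 := (minusPhase 2).length_ne_four_of_base (by decide +kernel) hp
  omega

/-! ### Cyclic labellings of a neighbourhood and the dihedral group of order 8. -/

section Frames

variable {V G : Type*} [Group G] {Γ : SimpleGraph V}

/-- A cyclic labelling of the neighbourhood of `v` on which the stabiliser of `v` induces the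
dihedral group of order `8`. -/
structure IsFrame (ρ : G →* (Γ ≃g Γ)) (v : V) (n : ZMod 4 → V) : Prop where
  injective : Function.Injective n
  range_eq : Set.range n = Γ.neighborSet v
  exists_perm : ∀ g, ρ g v = v → ∃ σ ∈ dihedralPerm, ∀ i, ρ g (n i) = n (σ i)
  rotation : ∃ g, ρ g v = v ∧ ∀ i, ρ g (n i) = n (i + 1)
  reflection : ∃ g, ρ g v = v ∧ ∀ i, ρ g (n i) = n (-i)

lemma IsFrame.exists_equiv {ρ : G →* (Γ ≃g Γ)} {v : V} {n : ZMod 4 → V} (h : IsFrame ρ v n) :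
    ∃ e : Γ.neighborSet v ≃ ZMod 4, (localGroup ρ v).map e.permCongrHom.toMonoidHom =
      dihedralPerm := by
  have hmem : ∀ i, n i ∈ Γ.neighborSet v := fun i => h.range_eq ▸ Set.mem_range_self i
  let f : ZMod 4 → Γ.neighborSet v := fun i => ⟨n i, hmem i⟩
  have hf : Function.Bijective f := by
    refine ⟨fun i j hij => h.injective (congrArg Subtype.val hij), fun u => ?_⟩
    obtain ⟨i, hi⟩ : u.1 ∈ Set.range n := by rw [h.range_eq]; exact u.2
    exact ⟨i, Subtype.ext hi⟩
  let e := (Equiv.ofBijective f hf).symm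
  have he : ∀ i, e.symm i = f i := fun i => rfl
  have key : ∀ (g : G) (σ : Equiv.Perm (ZMod 4)), ρ g v = v → (∀ i, ρ g (n i) = n (σ i)) →
      σ ∈ (localGroup ρ v).map e.permCongrHom.toMonoidHom := by
    intro g σ hg hσ
    refine ⟨e.symm.permCongr σ, ⟨g, hg, fun u => ?_⟩, ?_⟩
    · obtain ⟨i, rfl⟩ := e.symm.surjective u
      have h1 : e.symm.permCongr σ (e.symm i) = e.symm (σ i) := by simp
      rw [h1, he, he]
      exact (hσ i).symm
    · ext i
      simp [Equiv.permCongrHom]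
  refine ⟨e, le_antisymm ?_ ?_⟩
  · rintro _ ⟨π, ⟨g, hg, hπ⟩, rfl⟩
    obtain ⟨σ, hσ, hi⟩ := h.exists_perm g hg
    convert hσ
    ext i : 1
    change e (π (e.symm i)) = σ i
    rw [← Equiv.eq_symm_apply]
    refine Subtype.ext ?_
    rw [hπ, he, he]
    exact hi i
  · rw [dihedralPerm, Subgroup.closure_le]
    rintro σ (rfl | rfl)
    · obtain ⟨g, hg, hi⟩ := h.rotation
      exact key g _ hg hi
    · obtain ⟨g, hg, hi⟩ := h.reflection
      exact key g _ hg hi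

/-- Frames can be transported along equivariant isomorphisms. -/
lemma IsFrame.map {V' : Type*} {Γ' : SimpleGraph V'} {ρ : G →* (Γ ≃g Γ)} {ρ' : G →* (Γ' ≃g Γ')}
    {v : V} {n : ZMod 4 → V} (h : IsFrame ρ v n) (θ : Γ ≃g Γ') (c : G ≃* G)
    (hθ : ∀ g u, ρ' (c g) (θ u) = θ (ρ g u)) : IsFrame ρ' (θ v) (θ ∘ n) where
  injective := θ.injective.comp h.injective
  range_eq := by
    rw [Set.range_comp, h.range_eq]
    ext w
    obtain ⟨u, rfl⟩ := θ.surjective w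
    rw [Function.Injective.mem_set_image θ.injective, SimpleGraph.mem_neighborSet,
      SimpleGraph.mem_neighborSet, θ.map_adj_iff]
  exists_perm g hg := by
    obtain ⟨g, rfl⟩ := c.surjective g
    rw [hθ] at hg
    obtain ⟨σ, hσ, hi⟩ := h.exists_perm g (θ.injective hg)
    exact ⟨σ, hσ, fun i => by rw [Function.comp_apply, hθ, hi, Function.comp_apply]⟩
  rotation := by
    obtain ⟨g, hg, hi⟩ := h.rotation
    exact ⟨c g, by rw [hθ, hg], fun i => by rw [Function.comp_apply, hθ, hi, Function.comp_apply]⟩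
  reflection := by
    obtain ⟨g, hg, hi⟩ := h.reflection
    exact ⟨c g, by rw [hθ, hg], fun i => by rw [Function.comp_apply, hθ, hi, Function.comp_apply]⟩

lemma IsFrame.ncard_neighborSet {ρ : G →* (Γ ≃g Γ)} {v : V} {n : ZMod 4 → V}
    (h : IsFrame ρ v n) : (Γ.neighborSet v).ncard = 4 := by
  rw [← h.range_eq, ← Set.image_univ, Set.ncard_image_of_injective _ h.injective, Set.ncard_univ,
    Nat.card_zmod]

/-- The dihedral group is the group of all permutations of the four points that respect the pairing
of `i` with `i + 2`, a check over the 24 permutations. -/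
lemma mem_dihedralPerm {σ : Equiv.Perm (ZMod 4)} (h : ∀ i, σ (i + 2) = σ i + 2) :
    σ ∈ dihedralPerm := by
  have key : ∀ σ : Equiv.Perm (ZMod 4), (∀ i, σ (i + 2) = σ i + 2) → ∃ k l : Fin 4,
      σ = Equiv.addRight 1 ^ (k : ℕ) * Equiv.neg (ZMod 4) ^ (l : ℕ) := by
    decide +kernel
  obtain ⟨k, l, rfl⟩ := key σ h
  exact mul_mem (pow_mem (Subgroup.subset_closure (by simp)) _)
    (pow_mem (Subgroup.subset_closure (by simp)) _)

end Frames

/-! ### The local action of `G`. -/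

namespace PhaseGroup

variable {t : ℕ} {ε : Sgn} {A : Type} [AddCommGroup A] (D : PhaseGroup t ε A)
variable [hF : Fact (2 ≤ t)]

/-- Modulo orientation-preserving elements `g` lies in `H`, where every element is a product of
generators `x_i`, possibly followed by `b`. -/
lemma oriented_or (g : ExtGroup t ε) :
    D.Oriented g ∨ ∃ g', D.Oriented g' ∧ g = g' * gb ε := by
  obtain ⟨g₀, h₀, hb⟩ := D.exists_oriented_to_base (D.action g base)
  rw [← action_mul] at hb
  obtain ⟨y, hy | hy⟩ := exists_of_mem_ExtH ε (D.action_base_iff.1 hb)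
  · refine Or.inl ?_
    rw [← eq_inv_mul_iff_mul_eq] at hy
    rw [hy]
    exact h₀.inv.mul (D.oriented_prodX _ _ _)
  · refine Or.inr ⟨g₀⁻¹ * lowX ε y, h₀.inv.mul (D.oriented_prodX _ _ _), ?_⟩
    rw [mul_assoc, ← hy, inv_mul_cancel_left]

lemma side_action (g : ExtGroup t ε) {v w w' : A × (ZMod t → ZMod 2)} (h : D.Side v w w') :
    D.Side (D.action g v) (D.action g w) (D.action g w') := by
  rcases D.oriented_or g with hg | ⟨g', hg, rfl⟩
  · exact h.imp (fun h => ⟨hg _ _ h.1, hg _ _ h.2⟩) (fun h => ⟨hg _ _ h.1, hg _ _ h.2⟩)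
  · rw [action_mul, action_mul, action_mul, action_gb, action_gb, action_gb]
    exact h.symm.imp (fun h => ⟨hg _ _ (D.up_bFun h.1), hg _ _ (D.up_bFun h.2)⟩)
      (fun h => ⟨hg _ _ (D.up_bFun h.1), hg _ _ (D.up_bFun h.2)⟩)

/-- The neighbours of the base vertex in cyclic order. -/
def baseFrame : ZMod 4 → A × (ZMod t → ZMod 2) :=
  ![D.up 0 base, D.dn 0 base, D.up 1 base, D.dn 1 base]

lemma res_zero : D.res 0 = 0 := by rw [res, map_zero, map_zero]

lemma bFun_up_base (c : ZMod 2) : bFun (D.up c base) = D.dn c base := by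
  refine Prod.ext ?_ (funext fun j => ?_)
  · simp [bFun, up, dn, base]
  · simp only [bFun, up, dn, base, res_zero, zero_sub, Function.update_apply]
    have : -1 - j = 0 ↔ j = -1 := by
      constructor <;> intro h <;> linear_combination -h
    simp [this]

lemma bFun_base : bFun (base : A × (ZMod t → ZMod 2)) = base :=
  Prod.ext neg_zero rfl

lemma gx_zero_base : D.action (gx ε 0) base = base := by
  have := D.action_base_iff.2 (gx_lower_mem ε 0)
  rwa [show lower (0 : ZMod t) = 0 by simp [lower]] at this

lemma gx_zero_up (c : ZMod 2) : D.action (gx ε 0) (D.up c base) = D.up (c + 1) base := by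
  have h := D.oriented_gx 0 _ _ (D.up_up c base)
  rw [gx_zero_base, up_iff, action_gx] at h
  rw [action_gx, h]
  congr 1
  have hπ : D.π (D.up c base).1 = 1 := by
    rw [D.π_of_up (D.up_up c base)]; simp [base]
  have hr : D.res (base : A × (ZMod t → ZMod 2)).1 = 0 := D.res_zero
  simp only [xFun, hπ, hr, map_zero, zero_sub, half_neg_one]
  simp [up, hr]

lemma gx_zero_dn (c : ZMod 2) : D.action (gx ε 0) (D.dn c base) = D.dn c base := by
  have h := D.oriented_gx 0 _ _ (D.up_dn c base)
  rw [gx_zero_base, dn_iff, action_gx] at h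
  rw [action_gx, h]
  congr 1
  have hr : D.res (base : A × (ZMod t → ZMod 2)).1 = 0 := D.res_zero
  have h1 : (-1 : ZMod t) ≠ 0 := by
    have := natCast_ne_zero (t := t) (n := 1) (by omega) hF.out
    simpa using this
  simp [xFun, hr, dn, h1]

lemma isFrame_base : IsFrame D.action base D.baseFrame := by
  have hb : ∀ c, D.action (gb ε) (D.up c base) = D.dn c base := fun c => by
    rw [action_gb, bFun_up_base]
  have hb' : ∀ c, D.action (gb ε) (D.dn c base) = D.up c base := fun c => by
    rw [action_gb, ← bFun_up_base, bFun_bFun]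
  have hb0 : D.action (gb ε) base = (base : A × (ZMod t → ZMod 2)) := by
    rw [action_gb, bFun_base]
  have hinj : Function.Injective D.baseFrame := by
    have h1 := D.up_zero_ne_up_one base
    have h2 := D.dn_zero_ne_dn_one base
    have h3 := fun c d => D.up_ne_dn c d base
    intro i j h
    fin_cases i <;> fin_cases j <;> first
      | rfl
      | exact absurd h h1
      | exact absurd h.symm h1
      | exact absurd h h2
      | exact absurd h.symm h2
      | exact absurd h (h3 _ _)
      | exact absurd h.symm (h3 _ _)
  have hrange : Set.range D.baseFrame = D.graph.neighborSet base := by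
    ext w
    rw [SimpleGraph.mem_neighborSet, ← mem_nbrs]
    constructor
    · rintro ⟨i, rfl⟩
      fin_cases i <;> simp [baseFrame, nbrs]
    · simp only [nbrs, List.mem_cons, List.not_mem_nil, or_false]
      rintro (rfl | rfl | rfl | rfl)
      exacts [⟨0, rfl⟩, ⟨2, rfl⟩, ⟨1, rfl⟩, ⟨3, rfl⟩]
  -- In the chosen cyclic order the two sides are the pairs of opposite points, so that respecting
  -- sides means commuting with `i ↦ i + 2`.
  have hside : ∀ i, D.Side base (D.baseFrame i) (D.baseFrame (i + 2)) := by
    intro i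
    fin_cases i
    · exact Or.inl ⟨D.up_up _ _, D.up_up _ _⟩
    · exact Or.inr ⟨D.up_dn _ _, D.up_dn _ _⟩
    · exact Or.inl ⟨D.up_up _ _, D.up_up _ _⟩
    · exact Or.inr ⟨D.up_dn _ _, D.up_dn _ _⟩
  have hside' : ∀ i j, D.Side base (D.baseFrame i) (D.baseFrame j) → i ≠ j → j = i + 2 := by
    have h1 := fun c => D.not_up_of_up (D.up_up c base)
    have h2 := fun c => D.not_up_of_up (D.up_dn c base)
    intro i j h hne
    fin_cases i <;> fin_cases j <;> first
      | rfl
      | exact absurd rfl hne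
      | exact (h.elim (fun h => h2 _ h.2) (fun h => h1 _ h.1)).elim
      | exact (h.elim (fun h => h2 _ h.1) (fun h => h1 _ h.2)).elim
  -- `b` exchanges the sides and `x_0` swaps only the upper neighbours, so `x_0 b` induces a 4-cycle
  -- and `b x_0 b` swaps only the lower neighbours.
  refine ⟨hinj, hrange, fun g hg => ?_, ⟨gx ε 0 * gb ε, ?_, fun i => ?_⟩,
    ⟨gb ε * gx ε 0 * gb ε, ?_, fun i => ?_⟩⟩
  · have hex : ∀ i, ∃ j, D.action g (D.baseFrame i) = D.baseFrame j := by
      intro i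
      have h1 : D.baseFrame i ∈ D.graph.neighborSet base := hrange ▸ Set.mem_range_self i
      have h2 : D.graph.Adj (D.action g base) (D.action g (D.baseFrame i)) :=
        (D.action g).map_rel_iff.2 h1
      rw [hg] at h2
      obtain ⟨j, hj⟩ := (hrange ▸ h2 : D.action g (D.baseFrame i) ∈ Set.range D.baseFrame)
      exact ⟨j, hj.symm⟩
    choose f hf using hex
    have hfi : Function.Injective f := fun i j h => hinj ((D.action g).injective (by
      rw [hf, hf, h]))
    refine ⟨Equiv.ofBijective f (Finite.injective_iff_bijective.1 hfi), mem_dihedralPerm ?_, hf⟩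
    intro i
    have h3 := D.side_action g (hside i)
    rw [hg, hf, hf] at h3
    refine hside' _ _ h3 fun h => ?_
    have h4 := hfi h
    rw [left_eq_add] at h4
    exact absurd h4 (by decide)
  · rw [action_mul, hb0, gx_zero_base]
  · rw [action_mul]
    fin_cases i
    · exact (congrArg _ (hb 0)).trans (D.gx_zero_dn 0)
    · exact (congrArg _ (hb' 0)).trans (D.gx_zero_up 0)
    · exact (congrArg _ (hb 1)).trans (D.gx_zero_dn 1)
    · exact (congrArg _ (hb' 1)).trans (D.gx_zero_up 1)
  · rw [action_mul, action_mul, hb0, gx_zero_base, hb0]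
  · rw [action_mul, action_mul]
    fin_cases i
    · exact (congrArg (fun w => D.action (gb ε) (D.action (gx ε 0) w)) (hb 0)).trans
        ((congrArg _ (D.gx_zero_dn 0)).trans (hb' 0))
    · exact (congrArg (fun w => D.action (gb ε) (D.action (gx ε 0) w)) (hb' 0)).trans
        ((congrArg _ (D.gx_zero_up 0)).trans (hb 1))
    · exact (congrArg (fun w => D.action (gb ε) (D.action (gx ε 0) w)) (hb 1)).trans
        ((congrArg _ (D.gx_zero_dn 1)).trans (hb' 1))
    · exact (congrArg (fun w => D.action (gb ε) (D.action (gx ε 0) w)) (hb' 1)).trans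
        ((congrArg _ (D.gx_zero_up 1)).trans (hb 0))

lemma exists_isFrame (v : A × (ZMod t → ZMod 2)) : ∃ n, IsFrame D.action v n := by
  obtain ⟨g, -, hg⟩ := D.exists_oriented_to_base v
  -- The map `g⁻¹` intertwines the action with its conjugate by `g⁻¹`, hence the inner automorphism.
  have h := D.isFrame_base.map (D.action g⁻¹) (MulAut.conj g⁻¹) (ρ' := D.action) fun h u => by
    rw [MulAut.conj_apply, inv_inv, action_mul, action_mul, action_action_inv]
  rw [← hg, action_inv_action] at h
  exact ⟨_, h⟩

lemma isArcTransitive : IsArcTransitive D.action := by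
  have key : ∀ u v, D.graph.Adj u v → ∃ g, D.action g u = base ∧ D.action g v = (D.α, 0) := by
    intro u v h
    rcases D.adj_iff.1 h with h | h
    · obtain ⟨g, -, h1, h2⟩ := D.exists_oriented_arc h
      exact ⟨g, h1, h2⟩
    · obtain ⟨g, -, h1, h2⟩ := D.exists_oriented_arc (D.up_bFun h)
      exact ⟨g * gb ε, by rw [action_mul, action_gb, h1], by rw [action_mul, action_gb, h2]⟩
  intro u v u' v' h h'
  obtain ⟨g, h1, h2⟩ := key u v h
  obtain ⟨g', h1', h2'⟩ := key u' v' h'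
  exact ⟨g'⁻¹ * g, by rw [action_mul, h1, ← h1', action_inv_action],
    by rw [action_mul, h2, ← h2', action_inv_action]⟩

include D in
lemma isLocallyD4 : IsLocallyD4 (extAction t ε) := by
  have hframe : ∀ v, ∃ n, IsFrame (extAction t ε) v n := by
    intro v
    obtain ⟨n, hn⟩ := D.exists_isFrame (D.cosetIso v)
    have h := hn.map D.cosetIso.symm (MulEquiv.refl _) (ρ' := extAction t ε) fun g u => by
      obtain ⟨w, rfl⟩ := D.cosetIso.surjective u
      rw [← cosetIso_action, RelIso.symm_apply_apply, RelIso.symm_apply_apply]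
      rfl
    rw [RelIso.symm_apply_apply] at h
    exact ⟨_, h⟩
  refine ⟨D.extAction_injective, D.cosetIso.connected_iff.2 D.connected, fun v => ?_, ?_,
    fun v => ?_⟩
  · obtain ⟨n, hn⟩ := hframe v
    exact hn.ncard_neighborSet
  · intro u v u' v' h h'
    obtain ⟨g, h1, h2⟩ := D.isArcTransitive (D.cosetIso u) (D.cosetIso v) (D.cosetIso u')
      (D.cosetIso v') (D.cosetIso.map_rel_iff.2 h) (D.cosetIso.map_rel_iff.2 h')
    exact ⟨g, D.cosetIso.injective (by rw [cosetIso_action, h1]),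
      D.cosetIso.injective (by rw [cosetIso_action, h2])⟩
  · obtain ⟨n, hn⟩ := hframe v
    exact hn.exists_equiv

end PhaseGroup

/-! ### Transversal paths of `W_r` as labelled arcs of the cycle of fibres. -/

section Arcs

variable {r : ℕ}

lemma natCast_inj_of_lt {m n : ℕ} (hm : m < r) (hn : n < r) (h : (m : ZMod r) = n) : m = n := by
  have := (ZMod.natCast_eq_natCast_iff' _ _ _).1 h
  rwa [Nat.mod_eq_of_lt hm, Nat.mod_eq_of_lt hn] at this

lemma wreath_adj_iff (hr : 2 ≤ r) {p q : ZMod r × ZMod 2} :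
    (wreathGraph r).Adj p q ↔ q.1 = p.1 + 1 ∨ p.1 = q.1 + 1 := by
  rw [wreathGraph, SimpleGraph.fromRel_adj]
  refine ⟨fun h => h.2, fun h => ⟨?_, h⟩⟩
  rintro rfl
  rw [or_self, left_eq_add] at h
  exact absurd (natCast_inj_of_lt (r := r) (m := 1) (n := 0) (by omega) (by omega)
    (by simpa using h)) (by omega)

/-- The path of `W_r` through the points `(k + j, y (k + j))` with `j ≤ n`. -/
def arcSub [hr : Fact (2 ≤ r)] (k : ZMod r) (n : ℕ) (y : ZMod r → ZMod 2) :
    (wreathGraph r).Subgraph where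
  verts := {p | p.2 = y p.1 ∧ ∃ j : ℕ, j ≤ n ∧ p.1 = k + j}
  Adj p q := p.2 = y p.1 ∧ q.2 = y q.1 ∧ ((q.1 = p.1 + 1 ∧ ∃ j : ℕ, j < n ∧ p.1 = k + j) ∨
    (p.1 = q.1 + 1 ∧ ∃ j : ℕ, j < n ∧ q.1 = k + j))
  adj_sub := by
    rintro p q ⟨-, -, h | h⟩
    · exact (wreath_adj_iff hr.out).2 (Or.inl h.1)
    · exact (wreath_adj_iff hr.out).2 (Or.inr h.1)
  edge_vert := by
    rintro p q ⟨hp, -, ⟨-, j, hj, h⟩ | ⟨h, j, hj, h'⟩⟩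
    · exact ⟨hp, j, hj.le, h⟩
    · exact ⟨hp, j + 1, hj, by rw [h, h']; push_cast; ring⟩
  symm := ⟨fun _ _ ⟨hp, hq, h⟩ => ⟨hq, hp, h.symm⟩⟩

variable [hr : Fact (2 ≤ r)]

lemma mem_arcSub {k : ZMod r} {n : ℕ} {y : ZMod r → ZMod 2} {p : ZMod r × ZMod 2} :
    p ∈ (arcSub k n y).verts ↔ p.2 = y p.1 ∧ ∃ j : ℕ, j ≤ n ∧ p.1 = k + j := Iff.rfl

lemma arcSub_adj {k : ZMod r} {n : ℕ} {y : ZMod r → ZMod 2} {p q : ZMod r × ZMod 2} :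
    (arcSub k n y).Adj p q ↔ p.2 = y p.1 ∧ q.2 = y q.1 ∧
      ((q.1 = p.1 + 1 ∧ ∃ j : ℕ, j < n ∧ p.1 = k + j) ∨
        (p.1 = q.1 + 1 ∧ ∃ j : ℕ, j < n ∧ q.1 = k + j)) := Iff.rfl

lemma arcSub_congr {k : ZMod r} {n : ℕ} {y y' : ZMod r → ZMod 2}
    (h : ∀ j : ℕ, j ≤ n → y (k + j) = y' (k + j)) : arcSub k n y = arcSub k n y' := by
  have h' : ∀ j : ℕ, j < n → y (k + j + 1) = y' (k + j + 1) := fun j hj => by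
    have := h (j + 1) hj
    push_cast at this
    rwa [← add_assoc] at this
  refine SimpleGraph.Subgraph.ext ?_ ?_
  · ext p
    rw [mem_arcSub, mem_arcSub]
    refine and_congr_left ?_
    rintro ⟨j, hj, hp⟩
    rw [hp, h j hj]
  · ext p q
    rw [arcSub_adj, arcSub_adj, ← and_assoc, ← and_assoc]
    refine and_congr_left ?_
    rintro (⟨h1, j, hj, h2⟩ | ⟨h1, j, hj, h2⟩)
    · rw [h1, h2, h j hj.le, h' j hj]
    · rw [h1, h2, h j hj.le, h' j hj]

lemma arcSub_zero (u : ZMod r × ZMod 2) (y : ZMod r → ZMod 2) (hy : y u.1 = u.2) :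
    arcSub u.1 0 y = (wreathGraph r).singletonSubgraph u := by
  refine SimpleGraph.Subgraph.ext ?_ ?_
  · ext p
    rw [mem_arcSub, SimpleGraph.singletonSubgraph_verts, Set.mem_singleton_iff]
    constructor
    · rintro ⟨h, j, hj, h'⟩
      obtain rfl : j = 0 := by omega
      rw [Nat.cast_zero, add_zero] at h'
      exact Prod.ext h' (by rw [h, h', hy])
    · rintro rfl
      exact ⟨hy.symm, 0, le_rfl, by simp⟩
  · ext p q
    rw [arcSub_adj]
    simp

lemma arcSub_succ_left (k : ZMod r) (n : ℕ) (y : ZMod r → ZMod 2)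
    (h : (wreathGraph r).Adj (k, y k) (k + 1, y (k + 1))) :
    arcSub k (n + 1) y = (wreathGraph r).subgraphOfAdj h ⊔ arcSub (k + 1) n y := by
  refine SimpleGraph.Subgraph.ext ?_ ?_
  · ext p
    rw [SimpleGraph.Subgraph.verts_sup, Set.mem_union, mem_arcSub, mem_arcSub,
      SimpleGraph.subgraphOfAdj_verts, Set.mem_insert_iff, Set.mem_singleton_iff]
    constructor
    · rintro ⟨hp, j, hj, hk⟩
      rcases j with - | j
      · rw [Nat.cast_zero, add_zero] at hk
        exact Or.inl (Or.inl (Prod.ext hk (by rw [hp, hk])))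
      · exact Or.inr ⟨hp, j, by omega, by rw [hk]; push_cast; ring⟩
    · rintro ((rfl | rfl) | ⟨hp, j, hj, hk⟩)
      · exact ⟨rfl, 0, by omega, by simp⟩
      · exact ⟨rfl, 1, by omega, by simp⟩
      · exact ⟨hp, j + 1, by omega, by rw [hk]; push_cast; ring⟩
  · ext p q
    rw [SimpleGraph.Subgraph.sup_adj, arcSub_adj, arcSub_adj, SimpleGraph.subgraphOfAdj_adj]
    simp only [Sym2.eq_iff]
    constructor
    · rintro ⟨hp, hq, ⟨h1, j, hj, hk⟩ | ⟨h1, j, hj, hk⟩⟩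
      · rcases j with - | j
        · rw [Nat.cast_zero, add_zero] at hk
          refine Or.inl (Or.inl ⟨(Prod.ext hk (by rw [hp, hk])).symm, ?_⟩)
          exact (Prod.ext (by rw [h1, hk]) (by rw [hq, h1, hk])).symm
        · exact Or.inr ⟨hp, hq, Or.inl ⟨h1, j, by omega, by rw [hk]; push_cast; ring⟩⟩
      · rcases j with - | j
        · rw [Nat.cast_zero, add_zero] at hk
          refine Or.inl (Or.inr ⟨(Prod.ext hk (by rw [hq, hk])).symm, ?_⟩)
          exact (Prod.ext (by rw [h1, hk]) (by rw [hp, h1, hk])).symm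
        · exact Or.inr ⟨hp, hq, Or.inr ⟨h1, j, by omega, by rw [hk]; push_cast; ring⟩⟩
    · rintro ((⟨rfl, rfl⟩ | ⟨rfl, rfl⟩) | ⟨hp, hq, ⟨h1, j, hj, hk⟩ | ⟨h1, j, hj, hk⟩⟩)
      · exact ⟨rfl, rfl, Or.inl ⟨rfl, 0, by omega, by simp⟩⟩
      · exact ⟨rfl, rfl, Or.inr ⟨rfl, 0, by omega, by simp⟩⟩
      · exact ⟨hp, hq, Or.inl ⟨h1, j + 1, by omega, by rw [hk]; push_cast; ring⟩⟩
      · exact ⟨hp, hq, Or.inr ⟨h1, j + 1, by omega, by rw [hk]; push_cast; ring⟩⟩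

lemma arcSub_succ_right (k : ZMod r) (n : ℕ) (y : ZMod r → ZMod 2)
    (h : (wreathGraph r).Adj (k + n + 1, y (k + n + 1)) (k + n, y (k + n))) :
    arcSub k (n + 1) y = (wreathGraph r).subgraphOfAdj h ⊔ arcSub k n y := by
  refine SimpleGraph.Subgraph.ext ?_ ?_
  · ext p
    rw [SimpleGraph.Subgraph.verts_sup, Set.mem_union, mem_arcSub, mem_arcSub,
      SimpleGraph.subgraphOfAdj_verts, Set.mem_insert_iff, Set.mem_singleton_iff]
    constructor
    · rintro ⟨hp, j, hj, hk⟩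
      rcases hj.eq_or_lt with rfl | hj
      · push_cast at hk
        rw [← add_assoc] at hk
        exact Or.inl (Or.inl (Prod.ext hk (by rw [hp, hk])))
      · exact Or.inr ⟨hp, j, by omega, hk⟩
    · rintro ((rfl | rfl) | ⟨hp, j, hj, hk⟩)
      · exact ⟨rfl, n + 1, le_rfl, by push_cast; ring⟩
      · exact ⟨rfl, n, by omega, rfl⟩
      · exact ⟨hp, j, by omega, hk⟩
  · ext p q
    rw [SimpleGraph.Subgraph.sup_adj, arcSub_adj, arcSub_adj, SimpleGraph.subgraphOfAdj_adj]
    simp only [Sym2.eq_iff]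
    constructor
    · rintro ⟨hp, hq, ⟨h1, j, hj, hk⟩ | ⟨h1, j, hj, hk⟩⟩
      · rcases (Nat.lt_succ_iff.1 hj).eq_or_lt with rfl | hj
        · refine Or.inl (Or.inr ⟨?_, (Prod.ext hk (by rw [hp, hk])).symm⟩)
          exact (Prod.ext (by rw [h1, hk]) (by rw [hq, h1, hk])).symm
        · exact Or.inr ⟨hp, hq, Or.inl ⟨h1, j, hj, hk⟩⟩
      · rcases (Nat.lt_succ_iff.1 hj).eq_or_lt with rfl | hj
        · refine Or.inl (Or.inl ⟨?_, (Prod.ext hk (by rw [hq, hk])).symm⟩)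
          exact (Prod.ext (by rw [h1, hk]) (by rw [hp, h1, hk])).symm
        · exact Or.inr ⟨hp, hq, Or.inr ⟨h1, j, hj, hk⟩⟩
    · rintro ((⟨rfl, rfl⟩ | ⟨rfl, rfl⟩) | ⟨hp, hq, ⟨h1, j, hj, hk⟩ | ⟨h1, j, hj, hk⟩⟩)
      · exact ⟨rfl, rfl, Or.inr ⟨rfl, n, by omega, rfl⟩⟩
      · exact ⟨rfl, rfl, Or.inl ⟨rfl, n, by omega, rfl⟩⟩
      · exact ⟨hp, hq, Or.inl ⟨h1, j, by omega, hk⟩⟩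
      · exact ⟨hp, hq, Or.inr ⟨h1, j, by omega, hk⟩⟩

lemma arcSub_cons_left {u w : ZMod r × ZMod 2} (h : (wreathGraph r).Adj u w) (n : ℕ)
    {y : ZMod r → ZMod 2} (hu : y u.1 = u.2) (hw : y w.1 = w.2) (hwu : w.1 = u.1 + 1) :
    arcSub u.1 (n + 1) y = (wreathGraph r).subgraphOfAdj h ⊔ arcSub w.1 n y := by
  obtain ⟨k, c⟩ := u
  obtain ⟨k', c'⟩ := w
  simp only at hu hw hwu
  subst hu hw hwu
  exact arcSub_succ_left k n y h

lemma arcSub_cons_right {u w : ZMod r × ZMod 2} (h : (wreathGraph r).Adj u w) (n : ℕ)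
    {y : ZMod r → ZMod 2} (hu : y u.1 = u.2) (hw : y w.1 = w.2) (huw : u.1 = w.1 + 1)
    {k : ZMod r} (hk : w.1 = k + n) :
    arcSub k (n + 1) y = (wreathGraph r).subgraphOfAdj h ⊔ arcSub k n y := by
  obtain ⟨k', c⟩ := u
  obtain ⟨k'', c'⟩ := w
  simp only at hu hw huw hk
  subst hu hw huw hk
  exact arcSub_succ_right k n y h

lemma isNPath_arcSub (k : ZMod r) {n : ℕ} (hn : n < r) (y : ZMod r → ZMod 2) :
    IsNPath n (arcSub k n y) := by
  suffices h : ∃ v, ∃ p : (wreathGraph r).Walk (k, y k) v, p.IsPath ∧ p.length = n ∧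
      p.toSubgraph = arcSub k n y by
    obtain ⟨v, p, h⟩ := h
    exact ⟨_, v, p, h⟩
  induction n generalizing k with
  | zero =>
    refine ⟨_, .nil, .nil, rfl, ?_⟩
    rw [SimpleGraph.Walk.toSubgraph]
    exact (arcSub_zero (k, y k) y rfl).symm
  | succ n ih =>
    obtain ⟨v, p, hp, hl, hs⟩ := ih (k + 1) (by omega)
    have hadj : (wreathGraph r).Adj (k, y k) (k + 1, y (k + 1)) :=
      (wreath_adj_iff hr.out).2 (Or.inl rfl)
    refine ⟨v, .cons hadj p, hp.cons fun h => ?_, by rw [SimpleGraph.Walk.length_cons, hl], ?_⟩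
    · rw [← SimpleGraph.Walk.mem_verts_toSubgraph, hs, mem_arcSub] at h
      obtain ⟨-, j, hj, h⟩ := h
      have := natCast_inj_of_lt (r := r) (m := j + 1) (n := 0) (by omega) (by omega)
        (by push_cast; linear_combination -h)
      omega
    · rw [SimpleGraph.Walk.toSubgraph, hs, arcSub_succ_left]

lemma isTransversalPath_arcSub (k : ZMod r) {n : ℕ} (hn : n < r) (y : ZMod r → ZMod 2) :
    IsTransversalPath n (arcSub k n y) :=
  ⟨isNPath_arcSub k hn y, fun p hp q hq h => Prod.ext h (by
    rw [(mem_arcSub.1 hp).1, (mem_arcSub.1 hq).1, h])⟩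

/-- A path that meets each fibre at most once cannot turn round, for the step back would enter a
fibre already met. It therefore runs monotonically along the fibres; the two alternatives say
whether its start is the lower or the upper end of the arc. -/
lemma exists_arcSub_of_walk {u v : ZMod r × ZMod 2} (p : (wreathGraph r).Walk u v)
    (hp : p.IsPath) (hl : p.length < r) (hi : Set.InjOn Prod.fst p.toSubgraph.verts) :
    ∃ y : ZMod r → ZMod 2, y u.1 = u.2 ∧ (p.toSubgraph = arcSub u.1 p.length y ∨
      ∃ k, u.1 = k + p.length ∧ p.toSubgraph = arcSub k p.length y) := by
  induction p with
  | nil =>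
    rename_i u
    exact ⟨fun _ => u.2, rfl, Or.inl (arcSub_zero u _ rfl).symm⟩
  | cons h p ih =>
    rename_i u w v
    rw [SimpleGraph.Walk.length_cons] at hl
    have hsub : p.toSubgraph.verts ⊆ (SimpleGraph.Walk.cons h p).toSubgraph.verts := by
      rw [SimpleGraph.Walk.toSubgraph, SimpleGraph.Subgraph.verts_sup]
      exact Set.subset_union_right
    rw [SimpleGraph.Walk.cons_isPath_iff] at hp
    obtain ⟨y, hy, hs⟩ := ih hp.1 (by omega) (hi.mono hsub)
    have hu : ∀ q ∈ p.toSubgraph.verts, q.1 ≠ u.1 := by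
      intro q hq hqu
      have := hi (hsub hq) (SimpleGraph.Walk.start_mem_verts_toSubgraph _) hqu
      rw [this, SimpleGraph.Walk.mem_verts_toSubgraph] at hq
      exact hp.2 hq
    have hw : w.1 ≠ u.1 := hu w (SimpleGraph.Walk.start_mem_verts_toSubgraph p)
    refine ⟨Function.update y u.1 u.2, Function.update_self _ _ _, ?_⟩
    have hyw : Function.update y u.1 u.2 w.1 = w.2 := by rw [Function.update_of_ne hw, hy]
    have hyu : Function.update y u.1 u.2 u.1 = u.2 := Function.update_self _ _ _
    have up : w.1 = u.1 + 1 → p.toSubgraph = arcSub w.1 p.length y →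
        (SimpleGraph.Walk.cons h p).toSubgraph =
          arcSub u.1 (p.length + 1) (Function.update y u.1 u.2) := by
      intro hwu hs
      rw [arcSub_cons_left h _ hyu hyw hwu, SimpleGraph.Walk.toSubgraph, hs]
      congr 1
      refine arcSub_congr fun j hj => ?_
      rw [Function.update_of_ne]
      refine hu (w.1 + j, y (w.1 + j)) ?_
      rw [hs]
      exact ⟨rfl, j, hj, rfl⟩
    have down : ∀ k, u.1 = w.1 + 1 → w.1 = k + p.length → p.toSubgraph = arcSub k p.length y →
        (SimpleGraph.Walk.cons h p).toSubgraph =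
          arcSub k (p.length + 1) (Function.update y u.1 u.2) := by
      intro k huw hk hs
      rw [arcSub_cons_right h _ hyu hyw huw hk, SimpleGraph.Walk.toSubgraph, hs]
      congr 1
      refine arcSub_congr fun j hj => ?_
      rw [Function.update_of_ne]
      refine hu (k + j, y (k + j)) ?_
      rw [hs]
      exact ⟨rfl, j, hj, rfl⟩
    rw [SimpleGraph.Walk.length_cons]
    rcases (wreath_adj_iff hr.out).1 h with h1 | h1 <;> rcases hs with hs | ⟨k, hk, hs⟩
    · exact Or.inl (up h1 hs)
    · rcases Nat.eq_zero_or_pos p.length with h0 | h0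
      · rw [h0, Nat.cast_zero, add_zero] at hk
        exact Or.inl (up h1 (by rw [hs, hk]))
      -- This is the turning case: the second vertex from the upper end of the arc of `p` lies in
      -- the fibre of `u`.
      · refine absurd ?_ (hu (u.1, y u.1) ?_)
        · rfl
        · rw [hs]
          refine ⟨rfl, p.length - 1, by omega, ?_⟩
          rw [Nat.cast_sub h0]
          push_cast
          linear_combination hk - h1
    · rcases Nat.eq_zero_or_pos p.length with h0 | h0
      · exact Or.inr ⟨w.1, by rw [h0, h1]; simp, down w.1 h1 (by simp [h0]) hs⟩
      · refine absurd ?_ (hu (u.1, y u.1) ?_)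
        · rfl
        · rw [hs]
          exact ⟨rfl, 1, h0, by rw [h1]; simp⟩
    · exact Or.inr ⟨k, by rw [h1, hk]; push_cast; ring, down k h1 hk hs⟩

lemma exists_arcSub {n : ℕ} (hn : n < r) {P : (wreathGraph r).Subgraph}
    (h : IsTransversalPath n P) : ∃ k y, P = arcSub k n y := by
  obtain ⟨⟨u, v, p, hp, rfl, rfl⟩, hi⟩ := h
  obtain ⟨y, -, h | ⟨k, -, h⟩⟩ := exists_arcSub_of_walk p hp hn hi
  · exact ⟨_, _, h⟩
  · exact ⟨_, _, h⟩

/-- Each arc starts inside the other, at offsets whose sum vanishes modulo `r`. The bound `2 * n <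
r` makes both offsets zero. -/
lemma arcSub_eq_iff {n : ℕ} (hn : 2 * n < r) {k k' : ZMod r} {y y' : ZMod r → ZMod 2} :
    arcSub k n y = arcSub k' n y' ↔ k = k' ∧ ∀ j : ℕ, j ≤ n → y (k + j) = y' (k + j) := by
  constructor
  · intro h
    have h1 : (k, y k) ∈ (arcSub k' n y').verts := h ▸ ⟨rfl, 0, by omega, by simp⟩
    have h2 : (k', y' k') ∈ (arcSub k n y).verts := h ▸ ⟨rfl, 0, by omega, by simp⟩
    obtain ⟨-, j, hj, h1⟩ := h1
    obtain ⟨-, j', hj', h2⟩ := h2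
    have h3 := natCast_inj_of_lt (r := r) (m := j + j') (n := 0) (by omega) (by omega)
      (by push_cast; simp only at h1 h2; linear_combination -h1 - h2)
    obtain rfl : j = 0 := by omega
    refine ⟨by simpa using h1, fun j hj => ?_⟩
    have h4 : (k + j, y (k + j)) ∈ (arcSub k' n y').verts := h ▸ ⟨rfl, j, hj, rfl⟩
    exact h4.1
  · rintro ⟨rfl, h⟩
    exact arcSub_congr h

lemma mapSub_eq_iff {f : wreathGraph r ≃g wreathGraph r} {P Q : (wreathGraph r).Subgraph}
    (hv : ∀ p, f p ∈ Q.verts ↔ p ∈ P.verts) (ha : ∀ p q, Q.Adj (f p) (f q) ↔ P.Adj p q) :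
    mapSub f P = Q := by
  refine SimpleGraph.Subgraph.ext ?_ ?_
  · ext p
    obtain ⟨p, rfl⟩ := f.surjective p
    rw [hv]
    exact Function.Injective.mem_set_image (f := f) f.injective
  · ext p q
    obtain ⟨p, rfl⟩ := f.surjective p
    obtain ⟨q, rfl⟩ := f.surjective q
    rw [ha]
    constructor
    · rintro ⟨p', q', h, hp, hq⟩
      rwa [← f.injective hp, ← f.injective hq]
    · exact fun h => ⟨p, q, h, rfl, rfl⟩

lemma mapSub_xAut (i k : ZMod r) (n : ℕ) (y : ZMod r → ZMod 2) :
    mapSub (xAut r i).1 (arcSub k n y) = arcSub k n (fun p => if p = i then y p + 1 else y p) := by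
  have key : ∀ p : ZMod r × ZMod 2,
      ((if p.1 = i then p.2 + 1 else p.2) = if p.1 = i then y p.1 + 1 else y p.1) ↔
        p.2 = y p.1 := fun p => by split_ifs <;> simp
  refine mapSub_eq_iff (fun p => ?_) (fun p q => ?_)
  · simp only [mem_arcSub, xAut_apply, key]
  · simp only [arcSub_adj, xAut_apply, key]

lemma mapSub_aAut (k : ZMod r) (n : ℕ) (y : ZMod r → ZMod 2) :
    mapSub (aAut r).1 (arcSub k n y) = arcSub (k - 1) n (fun p => y (p + 1)) := by
  have key : ∀ (p : ZMod r) (j : ℕ), p - 1 = k - 1 + j ↔ p = k + j := fun p j => by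
    constructor <;> intro h <;> linear_combination h
  have key' : ∀ p q : ZMod r, p - 1 = q ↔ p = q + 1 := fun p q => sub_eq_iff_eq_add
  refine mapSub_eq_iff (fun p => ?_) (fun p q => ?_)
  · simp only [mem_arcSub, aAut_apply, key, sub_add_cancel]
  · simp only [arcSub_adj, aAut_apply, key, key', sub_add_cancel]

/-- The reflection reverses the arc, so the new start is the image of the old end. -/
lemma mapSub_bAut (s : ℕ) (k : ZMod r) (n : ℕ) (y : ZMod r → ZMod 2) :
    mapSub (bAut r s).1 (arcSub k n y) =
      arcSub ((r : ZMod r) - (s : ZMod r) - 1 - k - (n : ZMod r)) n (fun p => y ((r : ZMod r) - (s : ZMod r) - 1 - p)) := by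
  refine mapSub_eq_iff (fun p => ?_) (fun p q => ?_)
  · simp only [mem_arcSub, bAut_apply, sub_sub_cancel]
    generalize (r : ZMod r) - (s : ZMod r) - 1 = c
    refine and_congr_right fun _ => ⟨?_, ?_⟩
    · rintro ⟨j, hj, h⟩
      exact ⟨n - j, by omega, by rw [Nat.cast_sub hj]; linear_combination -h⟩
    · rintro ⟨j, hj, h⟩
      exact ⟨n - j, by omega, by rw [Nat.cast_sub hj]; linear_combination -h⟩
  · simp only [arcSub_adj, bAut_apply, sub_sub_cancel]
    generalize (r : ZMod r) - (s : ZMod r) - 1 = c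
    have key : ∀ p q : ZMod r, (c - q = c - p + 1 ∧ ∃ j : ℕ, j < n ∧ c - p = c - k - (n : ZMod r) + j) ↔
        (p = q + 1 ∧ ∃ j : ℕ, j < n ∧ q = k + j) := by
      intro p q
      constructor
      · rintro ⟨h, j, hj, h'⟩
        refine ⟨by linear_combination h, n - 1 - j, by omega, ?_⟩
        rw [Nat.cast_sub (by omega), Nat.cast_sub (by omega)]
        push_cast
        linear_combination -h - h'
      · rintro ⟨h, j, hj, h'⟩
        refine ⟨by linear_combination h, n - 1 - j, by omega, ?_⟩
        rw [Nat.cast_sub (by omega), Nat.cast_sub (by omega)]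
        push_cast
        linear_combination -h - h'
    rw [key, key, or_comm]

end Arcs

/-! ### Central covers from covering maps. -/

section Covers

variable {V G W K : Type*} [Group G] [Group K] {Γ : SimpleGraph V} {Δ : SimpleGraph W}

/-- A criterion for central covers in terms of a covering map. -/
lemma isCentralCover_of_covering {ρ : G →* (Γ ≃g Γ)} {N : Subgroup G} {κ : K →* (Δ ≃g Δ)}
    (hρ : Function.Injective ρ) (hκ : Function.Injective κ) (hN : N ≤ Subgroup.center G)
    (F : V → W) (hF : Function.Surjective F) (hfib : ∀ u v, F u = F v ↔ ∃ n ∈ N, ρ n u = v)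
    (hadj : ∀ u v, Γ.Adj u v → Δ.Adj (F u) (F v))
    (hlift : ∀ u w, Δ.Adj (F u) w → ∃ v, Γ.Adj u v ∧ F v = w)
    (hloc : ∀ u v v', Γ.Adj u v → Γ.Adj u v' → F v = F v' → v = v')
    (ψ : G →* K) (hψ : Function.Surjective ψ) (hker : N = ψ.ker)
    (hequiv : ∀ g v, F (ρ g v) = κ (ψ g) (F v)) : IsCentralCover ρ N κ := by
  have hproj : ∀ u v, orbitProj ρ N u = orbitProj ρ N v ↔ F u = F v := fun u v => by
    rw [hfib]
    exact Quotient.eq (r := orbitSetoid ρ N)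
  have hq : ∀ u v, (quotientGraph ρ N).Adj (orbitProj ρ N u) (orbitProj ρ N v) ↔
      Δ.Adj (F u) (F v) := by
    intro u v
    rw [quotientGraph, SimpleGraph.fromRel_adj]
    constructor
    · rintro ⟨-, ⟨u', v', h1, h2, h⟩ | ⟨v', u', h2, h1, h⟩⟩
      · rw [hproj] at h1 h2
        rw [← h1, ← h2]
        exact hadj _ _ h
      · rw [hproj] at h1 h2
        rw [← h1, ← h2]
        exact (hadj _ _ h).symm
    · intro h
      obtain ⟨v', hv, hv'⟩ := hlift _ _ h
      refine ⟨fun e => ?_, Or.inl ⟨u, v', rfl, (hproj _ _).2 hv', hv⟩⟩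
      rw [hproj] at e
      exact Δ.ne_of_adj h e
  have hnormal : N.Normal := hker ▸ MonoidHom.normal_ker ψ
  let f : OrbitSpace ρ N → W := Quotient.lift F fun u v h => (hfib u v).2 h
  have hf : ∀ v, f (orbitProj ρ N v) = F v := fun v => rfl
  have hbij : Function.Bijective f := by
    refine ⟨?_, fun w => ?_⟩
    · rintro ⟨u⟩ ⟨v⟩ h
      exact (hproj u v).2 h
    · obtain ⟨v, rfl⟩ := hF w
      exact ⟨orbitProj ρ N v, rfl⟩
  refine ⟨hρ, hκ, hN, fun v => ⟨fun w hw => (hq v w).2 (hadj _ _ hw), ?_, ?_⟩, hnormal,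
    ⟨Equiv.ofBijective f hbij, ?_⟩, QuotientGroup.liftEquiv N hψ hker, fun g v => hequiv g v⟩
  · intro w hw w' hw' h
    exact hloc v w w' hw hw' ((hproj _ _).1 h)
  · rintro ⟨w⟩ hw
    obtain ⟨w', h, h'⟩ := hlift v (F w) ((hq v w).1 hw)
    exact ⟨w', h, (hproj _ _).2 h'⟩
  · rintro ⟨u⟩ ⟨v⟩
    exact (hq u v).symm

end Covers

/-! ### Adjacency in `C(2t, t)` in terms of arcs. -/

section WindowGraph

variable {t : ℕ} [hF : Fact (2 ≤ t)]

instance two_le_two_mul : Fact (2 ≤ 2 * t) := ⟨by have := hF.out; omega⟩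

/-- The bound on `n` prevents the two arcs from meeting again on the far side of the cycle. -/
lemma arcSub_inf {r : ℕ} [hr : Fact (2 ≤ r)] (k : ZMod r) (n : ℕ) (hn : n + 2 < r)
    (y : ZMod r → ZMod 2) : arcSub k (n + 1) y ⊓ arcSub (k + 1) (n + 1) y = arcSub (k + 1) n y := by
  have key : ∀ (p : ZMod r) (m : ℕ), m + 1 ≤ n + 2 → ((∃ j : ℕ, j < m + 1 ∧ p = k + j) ∧
      (∃ j : ℕ, j < m + 1 ∧ p = k + 1 + j) ↔ ∃ j : ℕ, j < m ∧ p = k + 1 + j) := by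
    intro p m hm
    constructor
    · rintro ⟨⟨j, hj, h⟩, j', hj', h'⟩
      have := natCast_inj_of_lt (r := r) (m := j) (n := j' + 1) (by omega) (by omega)
        (by push_cast; linear_combination h' - h)
      exact ⟨j', by omega, h'⟩
    · rintro ⟨j, hj, h⟩
      exact ⟨⟨j + 1, by omega, by rw [h]; push_cast; ring⟩, j, by omega, h⟩
  refine SimpleGraph.Subgraph.ext ?_ ?_
  · ext p
    have := key p.1 (n + 1) (by omega)
    simp only [Nat.lt_succ_iff] at this
    rw [SimpleGraph.Subgraph.verts_inf, Set.mem_inter_iff, mem_arcSub, mem_arcSub, mem_arcSub,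
      ← this]
    tauto
  · ext p q
    have hne : ¬ (q.1 = p.1 + 1 ∧ p.1 = q.1 + 1) := by
      rintro ⟨h, h'⟩
      have := natCast_inj_of_lt (r := r) (m := 2) (n := 0) (by omega) (by omega)
        (by push_cast; linear_combination -h - h')
      omega
    rw [SimpleGraph.Subgraph.inf_adj, arcSub_adj, arcSub_adj, arcSub_adj, ← key p.1 n (by omega),
      ← key q.1 n (by omega)]
    generalize (∃ j : ℕ, j < n + 1 ∧ p.1 = k + j) = a₁
    generalize (∃ j : ℕ, j < n + 1 ∧ p.1 = k + 1 + j) = a₂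
    generalize (∃ j : ℕ, j < n + 1 ∧ q.1 = k + j) = a₃
    generalize (∃ j : ℕ, j < n + 1 ∧ q.1 = k + 1 + j) = a₄
    tauto

lemma arcSub_sup {r : ℕ} [hr : Fact (2 ≤ r)] (k : ZMod r) (n : ℕ) (y : ZMod r → ZMod 2) :
    arcSub k (n + 1) y ⊔ arcSub (k + 1) (n + 1) y = arcSub k (n + 2) y := by
  have key : ∀ (p : ZMod r) (m : ℕ), 1 ≤ m → ((∃ j : ℕ, j < m ∧ p = k + j) ∨
      (∃ j : ℕ, j < m ∧ p = k + 1 + j) ↔ ∃ j : ℕ, j < m + 1 ∧ p = k + j) := by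
    intro p m hm
    constructor
    · rintro (⟨j, hj, h⟩ | ⟨j, hj, h⟩)
      · exact ⟨j, by omega, h⟩
      · exact ⟨j + 1, by omega, by rw [h]; push_cast; ring⟩
    · rintro ⟨j, hj, h⟩
      rcases j with - | j
      · exact Or.inl ⟨0, by omega, h⟩
      · exact Or.inr ⟨j, by omega, by rw [h]; push_cast; ring⟩
  refine SimpleGraph.Subgraph.ext ?_ ?_
  · ext p
    have := key p.1 (n + 2) (by omega)
    simp only [Nat.lt_succ_iff, show ∀ j, j < n + 2 ↔ j ≤ n + 1 from fun j => Nat.lt_succ_iff]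
      at this
    rw [SimpleGraph.Subgraph.verts_sup, Set.mem_union, mem_arcSub, mem_arcSub, mem_arcSub,
      ← this, and_or_left]
  · ext p q
    rw [SimpleGraph.Subgraph.sup_adj, arcSub_adj, arcSub_adj, arcSub_adj,
      ← key p.1 (n + 1) (by omega), ← key q.1 (n + 1) (by omega)]
    generalize (∃ j : ℕ, j < n + 1 ∧ p.1 = k + j) = a₁
    generalize (∃ j : ℕ, j < n + 1 ∧ p.1 = k + 1 + j) = a₂
    generalize (∃ j : ℕ, j < n + 1 ∧ q.1 = k + j) = a₃
    generalize (∃ j : ℕ, j < n + 1 ∧ q.1 = k + 1 + j) = a₄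
    tauto

lemma cGraph_adj_of_succ {P Q : CVertex (2 * t) t} {k : ZMod (2 * t)}
    {y y' : ZMod (2 * t) → ZMod 2} (hP : P.1 = arcSub k (t - 1) y)
    (hQ : Q.1 = arcSub (k + 1) (t - 1) y')
    (h : ∀ j : ℕ, j + 1 < t → y (k + 1 + j) = y' (k + 1 + j)) : (CGraph (2 * t) t).Adj P Q := by
  have ht := hF.out
  obtain ⟨n, rfl⟩ : ∃ n, t = n + 2 := ⟨t - 2, by omega⟩
  -- A common labelling for both paths: `y` on the first fibre and `y'` on all others.
  set Y : ZMod (2 * (n + 2)) → ZMod 2 := fun p => if p = k then y p else y' p with hY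
  have hne : ∀ j : ℕ, j ≤ n + 1 → k + 1 + j ≠ k := fun j hj h => by
    have := natCast_inj_of_lt (r := 2 * (n + 2)) (m := j + 1) (n := 0) (by omega) (by omega)
      (by push_cast; linear_combination h)
    omega
  have hP' : P.1 = arcSub k (n + 1) Y := by
    rw [hP]
    refine arcSub_congr fun j hj => ?_
    rcases j with - | j
    · simp [hY]
    · rw [show k + ((j + 1 : ℕ) : ZMod (2 * (n + 2))) = k + 1 + j by push_cast; ring, hY]
      simp only
      rw [if_neg (hne j (by omega)), h j (by omega)]
  have hQ' : Q.1 = arcSub (k + 1) (n + 1) Y := by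
    rw [hQ]
    refine arcSub_congr fun j hj => ?_
    rw [hY]
    simp only
    rw [if_neg (hne j hj)]
  refine ⟨fun e => ?_, ?_, ?_⟩
  · have e' := congrArg Subtype.val e
    rw [hP', hQ', arcSub_eq_iff (by omega), left_eq_add] at e'
    exact one_ne_zero_level e'.1
  · rw [hP', hQ', arcSub_inf _ _ (by omega)]
    exact isNPath_arcSub _ (by omega) _
  · rw [hP', hQ', arcSub_sup]
    exact isTransversalPath_arcSub _ (by omega) _

/-- An arc of `t` fibres fits into one of `t + 1` fibres in only two positions, because the whole
cycle has `2t` fibres. -/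
lemma eq_or_eq_of_arcSub_le {k k' : ZMod (2 * t)} {y y' : ZMod (2 * t) → ZMod 2}
    (h : arcSub k (t - 1) y ≤ arcSub k' t y') :
    (k = k' ∨ k = k' + 1) ∧ ∀ j : ℕ, j ≤ t - 1 → y (k + j) = y' (k + j) := by
  have ht := hF.out
  have hmem : ∀ j : ℕ, j ≤ t - 1 → (k + (j : ZMod (2 * t)), y (k + j)) ∈ (arcSub k' t y').verts :=
    fun j hj => h.1 ⟨rfl, j, hj, rfl⟩
  refine ⟨?_, fun j hj => (hmem j hj).1⟩
  obtain ⟨-, i, hi, h1⟩ := hmem 0 (by omega)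
  obtain ⟨-, j, hj, h2⟩ := hmem (t - 1) le_rfl
  have h3 := natCast_inj_of_lt (r := 2 * t) (m := i + (t - 1)) (n := j) (by omega) (by omega)
    (by simp only [Nat.cast_zero, add_zero] at h1 h2; push_cast; linear_combination h2 - h1)
  have : i = 0 ∨ i = 1 := by omega
  rcases this with rfl | rfl
  · exact Or.inl (by simpa using h1)
  · exact Or.inr (by simpa using h1)

/-- Both paths lie in their union, which is an arc of `t + 1` fibres. They cannot occupy the same
position, as they would then be equal, so they are shifted by one and agree on the overlap. -/
lemma cGraph_adj_cases {P Q : CVertex (2 * t) t} {k k' : ZMod (2 * t)}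
    {y y' : ZMod (2 * t) → ZMod 2} (hP : P.1 = arcSub k (t - 1) y)
    (hQ : Q.1 = arcSub k' (t - 1) y') (h : (CGraph (2 * t) t).Adj P Q) :
    (k' = k + 1 ∧ ∀ j : ℕ, j + 1 < t → y (k' + j) = y' (k' + j)) ∨
      (k = k' + 1 ∧ ∀ j : ℕ, j + 1 < t → y' (k + j) = y (k + j)) := by
  have ht := hF.out
  obtain ⟨hne, -, hT⟩ := h
  obtain ⟨l, Y, hl⟩ := exists_arcSub (by omega) hT
  have h1 : arcSub k (t - 1) y ≤ arcSub l t Y := by rw [← hP, ← hl]; exact le_sup_left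
  have h2 : arcSub k' (t - 1) y' ≤ arcSub l t Y := by rw [← hQ, ← hl]; exact le_sup_right
  obtain ⟨h1, b1⟩ := eq_or_eq_of_arcSub_le h1
  obtain ⟨h2, b2⟩ := eq_or_eq_of_arcSub_le h2
  have hkk : k ≠ k' := by
    rintro rfl
    refine hne (Subtype.ext ?_)
    rw [hP, hQ]
    exact arcSub_congr fun j hj => by rw [b1 j hj, b2 j hj]
  have hs : ∀ (l : ZMod (2 * t)) (j : ℕ), l + 1 + j = l + ((j + 1 : ℕ) : ZMod (2 * t)) :=
    fun l j => by push_cast; ring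
  rcases h1 with rfl | rfl <;> rcases h2 with rfl | rfl
  · exact absurd rfl hkk
  · exact Or.inl ⟨rfl, fun j hj => by rw [b2 j (by omega), hs, b1 (j + 1) (by omega)]⟩
  · exact Or.inr ⟨rfl, fun j hj => by rw [b1 j (by omega), hs, b2 (j + 1) (by omega)]⟩
  · exact absurd rfl hkk

lemma exists_of_half_eq_one {d : ZMod (2 * t)} (h : half d = 1) :
    ∃ j : ℕ, j ≤ t - 1 ∧ d = (t : ZMod (2 * t)) + (j : ZMod (2 * t)) := by
  obtain ⟨n, hn, rfl⟩ := exists_natCast d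
  rcases Nat.lt_or_ge n t with h' | h'
  · rw [half_natCast_of_lt h'] at h
    exact absurd h (by decide)
  · exact ⟨n - t, by omega, by rw [← Nat.cast_add]; congr 1; omega⟩

lemma half_t_add {j : ℕ} (hj : j ≤ t - 1) : half ((t : ZMod (2 * t)) + (j : ZMod (2 * t))) = 1 := by
  have := hF.out
  rw [← Nat.cast_add, half_natCast_of_le (by omega) (by omega)]

end WindowGraph

/-! ### The homomorphism from `G_t^±` onto `G_{2t,t}`. -/

section QuotientHom

variable (t : ℕ)

lemma quot_rel {r s : ℕ} {w : FreeGroup (QuotGen r)} (h : w ∈ quotRels r s) :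
    (PresentedGroup.mk (quotRels r s) w) = 1 := PresentedGroup.one_of_mem h

/-- The images of the generators of `G_t^±` in `G_{2t,t}`. -/
def toQuotGen : ExtGen t → QuotGroup (2 * t) t
  | .x i => PresentedGroup.of (.x i)
  | .z => 1
  | .a => PresentedGroup.of .a
  | .b => PresentedGroup.of .b

lemma toQuotGen_rels (ε : Sgn) :
    ∀ w ∈ extraspecialRels t ∪ dihedralRels t ε ∪ actionRels t,
      FreeGroup.lift (toQuotGen t) w = 1 := by
  have hcomm : ∀ i j : ZMod (2 * t), (PresentedGroup.of (.x i) : QuotGroup (2 * t) t)⁻¹ *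
      (PresentedGroup.of (.x j))⁻¹ * PresentedGroup.of (.x i) * PresentedGroup.of (.x j) = 1 :=
    fun i j => quot_rel (Or.inr (Or.inl ⟨i, j, rfl⟩))
  have ha : (PresentedGroup.of .a : QuotGroup (2 * t) t) ^ (2 * t) = 1 :=
    quot_rel (Or.inr (Or.inr (Or.inl rfl)))
  have hb : (PresentedGroup.of .b : QuotGroup (2 * t) t) ^ 2 = 1 :=
    quot_rel (Or.inr (Or.inr (Or.inr (Or.inl rfl))))
  rintro w (((⟨i, rfl⟩ | rfl | ⟨i, rfl⟩ | ⟨i, j, h, rfl⟩ | ⟨i, j, rfl, rfl⟩) | (h | rfl | rfl)) |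
    (⟨i, rfl⟩ | ⟨i, rfl⟩))
  · rw [map_pow, FreeGroup.lift_apply_of]
    exact quot_rel (Or.inl ⟨i, rfl⟩)
  · rw [map_pow, FreeGroup.lift_apply_of, toQuotGen, one_pow]
  · simp only [map_mul, map_inv, FreeGroup.lift_apply_of, toQuotGen, inv_one, mul_one,
      inv_mul_cancel]
  · simp only [map_mul, map_inv, FreeGroup.lift_apply_of, toQuotGen]
    exact hcomm i j
  · simp only [map_mul, map_inv, FreeGroup.lift_apply_of, toQuotGen, inv_one, mul_one]
    exact hcomm i _
  · cases ε
    · change w = _ at h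
      subst h
      simpa only [map_pow, FreeGroup.lift_apply_of, toQuotGen] using ha
    · change w = _ at h
      subst h
      simpa only [map_mul, map_inv, map_pow, FreeGroup.lift_apply_of, toQuotGen, inv_one,
        mul_one] using ha
  · rw [map_pow, FreeGroup.lift_apply_of]
    exact hb
  · simp only [map_mul, map_inv, FreeGroup.lift_apply_of, toQuotGen]
    have hab : ((PresentedGroup.of .a : QuotGroup (2 * t) t) * PresentedGroup.of .b) ^ 2 = 1 :=
      quot_rel (Or.inr (Or.inr (Or.inr (Or.inr (Or.inl rfl)))))
    rw [pow_two] at hb hab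
    rw [inv_eq_of_mul_eq_one_left hb, mul_assoc, mul_assoc, ← mul_assoc,
      mul_eq_one_iff_eq_inv, ← mul_eq_one_iff_eq_inv]
    -- Conjugating `(a b) ^ 2 = 1` by `a` gives `(b a) ^ 2 = 1`, which is the relation needed.
    have h2 := congrArg (fun g => (PresentedGroup.of .a)⁻¹ * g * PresentedGroup.of .a) hab
    simpa [mul_assoc] using h2
  · simp only [map_mul, map_inv, FreeGroup.lift_apply_of, toQuotGen]
    exact quot_rel (Or.inr (Or.inr (Or.inr (Or.inr (Or.inr (Or.inl ⟨i, rfl⟩))))))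
  · simp only [map_mul, map_inv, FreeGroup.lift_apply_of, toQuotGen]
    have h2 : (2 * t : ZMod (2 * t)) - t - 1 - i = t - 1 - i := by ring
    have h3 := quot_rel (r := 2 * t) (s := t)
      (Or.inr (Or.inr (Or.inr (Or.inr (Or.inr (Or.inr ⟨i, rfl⟩))))))
    push_cast at h3
    rw [h2] at h3
    exact h3

/-- The projection of `G_t^±` onto `G_{2t,t}`. -/
def toQuot (ε : Sgn) : ExtGroup t ε →* QuotGroup (2 * t) t :=
  PresentedGroup.toGroup (toQuotGen_rels t ε)

lemma toQuot_gen (ε : Sgn) (g : ExtGen t) : toQuot t ε (gen ε g) = toQuotGen t g :=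
  PresentedGroup.toGroup.of _

lemma toQuot_surjective (ε : Sgn) : Function.Surjective (toQuot t ε) := by
  rw [← MonoidHom.range_eq_top, eq_top_iff, ← PresentedGroup.closure_range_of,
    Subgroup.closure_le]
  rintro _ ⟨g, rfl⟩
  cases g with
  | x i => exact ⟨gen ε (.x i), toQuot_gen t ε _⟩
  | a => exact ⟨gen ε .a, toQuot_gen t ε _⟩
  | b => exact ⟨gen ε .b, toQuot_gen t ε _⟩

lemma quotAction_of {r s : ℕ} (g : QuotGen r) (P : CVertex r s) :
    (quotAction r s (PresentedGroup.of g) P).1 = mapSub (quotGenAut r s g).1 P.1 := by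
  rw [quotAction, MonoidHom.comp_apply, PresentedGroup.toGroup.of]
  rfl

end QuotientHom

/-! ### The covering of `C(2t, t)` by the model. -/

namespace PhaseGroup

variable {t : ℕ} {ε : Sgn} {A : Type} [AddCommGroup A] (D : PhaseGroup t ε A)
variable [hF : Fact (2 ≤ t)]

/-- The vertex of `C(2t, t)` covered by a vertex of the model. -/
def toArc (v : A × (ZMod t → ZMod 2)) : CVertex (2 * t) t :=
  -- The fibres visible at level `k` are `k + t, …, k + 2t - 1`, so the arc starts at `k + t` and
  -- has `t - 1` edges.
  ⟨arcSub (D.π v.1 + (t : ZMod (2 * t))) (t - 1) (fun p => v.2 (red t p)),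
    isTransversalPath_arcSub _ (by have := hF.out; omega) _⟩

lemma toArc_val (v : A × (ZMod t → ZMod 2)) :
    (D.toArc v).1 = arcSub (D.π v.1 + (t : ZMod (2 * t))) (t - 1) (fun p => v.2 (red t p)) := rfl

lemma exists_index (k : ZMod (2 * t)) (i : ZMod t) :
    ∃ j : ℕ, j ≤ t - 1 ∧ red t (k + (t : ZMod (2 * t)) + (j : ZMod (2 * t))) = i := by
  obtain ⟨p, hp, hi⟩ := exists_window k i
  obtain ⟨j, hj, h⟩ := exists_of_half_eq_one hp
  exact ⟨j, hj, by rw [← hi]; congr 1; linear_combination -h⟩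

lemma toArc_eq_iff {u v : A × (ZMod t → ZMod 2)} :
    D.toArc u = D.toArc v ↔ D.π u.1 = D.π v.1 ∧ u.2 = v.2 := by
  have ht := hF.out
  rw [toArc, toArc, Subtype.mk.injEq, arcSub_eq_iff (by omega), add_left_inj]
  refine and_congr_right fun _ => ⟨fun h => funext fun i => ?_, fun h j _ => by rw [h]⟩
  obtain ⟨j, hj, rfl⟩ := exists_index (D.π u.1) i
  exact h j hj

lemma π_surjective : Function.Surjective D.π := fun k => by
  obtain ⟨n, -, rfl⟩ := exists_natCast k
  exact ⟨n • D.α, by rw [map_nsmul, D.π_α, nsmul_one]⟩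

lemma toArc_surjective : Function.Surjective D.toArc := by
  have ht := hF.out
  rintro ⟨P, hP⟩
  obtain ⟨k, y, rfl⟩ := exists_arcSub (by omega) hP
  obtain ⟨κ, hκ⟩ := D.π_surjective (k + (t : ZMod (2 * t)))
  choose f hf hf' using exists_index (t := t) (k + (t : ZMod (2 * t)))
  refine ⟨(κ, fun i => y (k + (f i : ZMod (2 * t)))), Subtype.ext ?_⟩
  have hk : D.π κ + (t : ZMod (2 * t)) = k := by rw [hκ]; linear_combination t_add_t t
  refine (D.toArc_val _).trans ?_
  simp only [hk]
  refine arcSub_congr fun j hj => ?_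
  have h1 := hf' (red t (k + (j : ZMod (2 * t))))
  have h3 := hf (red t (k + (j : ZMod (2 * t))))
  generalize f (red t (k + (j : ZMod (2 * t)))) = j' at *
  rw [add_assoc k, t_add_t, add_zero, map_add, map_add, add_right_inj, red_natCast,
    red_natCast] at h1
  rw [natCast_inj_of_lt (by omega) (by omega) h1]

lemma toArc_eq_iff_exists {u v : A × (ZMod t → ZMod 2)} :
    D.toArc u = D.toArc v ↔ ∃ g ∈ Subgroup.zpowers (gz ε), D.action g u = v := by
  rw [toArc_eq_iff]
  constructor
  · rintro ⟨h1, h2⟩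
    obtain ⟨c, hc⟩ := D.exists_of_π_eq_zero (v.1 - u.1) (by rw [map_sub, h1, sub_self])
    rcases zmod_two_cases c with rfl | rfl
    · refine ⟨1, one_mem _, ?_⟩
      rw [map_zero, sub_eq_zero] at hc
      rw [action_one]
      exact Prod.ext hc.symm h2
    · refine ⟨gz ε, Subgroup.mem_zpowers _, ?_⟩
      rw [action_gz]
      exact Prod.ext (by rw [← hc]; simp) h2
  · rintro ⟨_, ⟨m, rfl⟩, rfl⟩
    simp only [action_gz_zpow, map_add, D.π_τ, add_zero, and_self]

lemma toArc_adj_of_up {u v : A × (ZMod t → ZMod 2)} (h : D.Up u v) :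
    (CGraph (2 * t) t).Adj (D.toArc u) (D.toArc v) := by
  refine cGraph_adj_of_succ (D.toArc_val u) (y' := fun p => v.2 (red t p)) ?_ ?_
  · rw [toArc_val, D.π_of_up h, add_right_comm]
  · intro j hj
    refine (D.bit_of_up h (j + 1) (by omega) hj (Or.inl ?_)).symm
    simp only [map_add, red_t, map_one, red_natCast, res]
    push_cast
    ring

lemma toArc_adj {u v : A × (ZMod t → ZMod 2)} (h : D.graph.Adj u v) :
    (CGraph (2 * t) t).Adj (D.toArc u) (D.toArc v) := by
  rcases D.adj_iff.1 h with h | h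
  · exact D.toArc_adj_of_up h
  · exact (D.toArc_adj_of_up h).symm

lemma exists_of_red_ne {k : ZMod (2 * t)} {i : ZMod t} (hi : i ≠ red t k) :
    ∃ j : ℕ, j + 1 < t ∧ red t (k + (t : ZMod (2 * t)) + 1 + (j : ZMod (2 * t))) = i := by
  obtain ⟨j, hj, h⟩ := exists_index k i
  rcases j with - | j
  · rw [Nat.cast_zero, add_zero, map_add, red_t, add_zero] at h
    exact absurd h.symm hi
  · refine ⟨j, by omega, ?_⟩
    rw [← h]
    congr 1
    push_cast
    ring

/-- A neighbouring arc gains a fibre at one end. The lift is the upper or lower neighbour of `u`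
whose new bit is the bit of `w` on that fibre. -/
lemma exists_adj_of_toArc_adj {u w : A × (ZMod t → ZMod 2)}
    (h : (CGraph (2 * t) t).Adj (D.toArc u) (D.toArc w)) :
    ∃ v, D.graph.Adj u v ∧ D.toArc v = D.toArc w := by
  rcases cGraph_adj_cases (D.toArc_val u) (D.toArc_val w) h with ⟨h1, h2⟩ | ⟨h1, h2⟩
  · refine ⟨D.up (w.2 (D.res u.1)) u, D.adj_iff.2 (Or.inl (D.up_up _ _)), ?_⟩
    rw [toArc_eq_iff]
    refine ⟨?_, funext fun i => ?_⟩
    · rw [D.π_of_up (D.up_up _ u)]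
      linear_combination -h1
    · by_cases hi : i = D.res u.1
      · subst hi
        simp [up]
      · rw [(D.up_up _ u).2 i hi]
        obtain ⟨j, hj, rfl⟩ := exists_of_red_ne hi
        have := h2 j hj
        rwa [h1] at this
  · have hk : D.π u.1 = D.π w.1 + 1 := by linear_combination h1
    have hr : D.res u.1 - 1 = D.res w.1 := by rw [res, hk, map_add, map_one, res]; ring
    refine ⟨D.dn (w.2 (D.res u.1 - 1)) u, D.adj_iff.2 (Or.inr (D.up_dn _ _)), ?_⟩
    rw [toArc_eq_iff]
    refine ⟨?_, funext fun i => ?_⟩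
    · have := D.π_of_up (D.up_dn (w.2 (D.res u.1 - 1)) u)
      linear_combination hk - this
    · by_cases hi : i = D.res u.1 - 1
      · subst hi
        simp [dn]
      · rw [← (D.up_dn _ u).2 i (by rwa [res_dn])]
        rw [hr] at hi
        obtain ⟨j, hj, rfl⟩ := exists_of_red_ne hi
        have := h2 j hj
        rw [h1] at this
        exact this.symm

/-- Upper and lower neighbours have different levels because `1 ≠ -1` modulo `2t`, and neighbours on
one side are told apart by a bit. -/
lemma eq_of_toArc_eq {u v v' : A × (ZMod t → ZMod 2)} (h : D.graph.Adj u v)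
    (h' : D.graph.Adj u v') (he : D.toArc v = D.toArc v') : v = v' := by
  rw [toArc_eq_iff] at he
  rcases D.level_cases h with ⟨h, l⟩ | ⟨h, l⟩ <;> rcases D.level_cases h' with ⟨h', l'⟩ | ⟨h', l'⟩
  · exact D.eq_of_up_of_bit' h h' (by rw [he.2])
  · exact absurd (by linear_combination he.1 - l + l') (one_ne_neg_one (t := t))
  · exact absurd (by linear_combination l - he.1 - l') (one_ne_neg_one (t := t))
  · exact D.eq_of_up_of_bit h h' (by rw [he.2])

/-- The flip takes effect exactly when the fibre `i` is visible. Distinct fibres of one window have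
distinct residues modulo `t`, so no other vertex of the path is affected. -/
lemma toArc_gx (i : ZMod (2 * t)) (v : A × (ZMod t → ZMod 2)) :
    (D.toArc (D.action (gx ε i) v)).1 = mapSub (xAut (2 * t) i).1 (D.toArc v).1 := by
  have ht := hF.out
  rw [toArc_val, toArc_val, mapSub_xAut, action_gx, π_xFun]
  refine arcSub_congr fun j hj => ?_
  simp only [xFun, Pi.add_apply, Pi.single_apply]
  by_cases h : D.π v.1 + (t : ZMod (2 * t)) + (j : ZMod (2 * t)) = i
  · subst h
    rw [if_pos rfl, if_pos rfl,
      show D.π v.1 + (t : ZMod (2 * t)) + (j : ZMod (2 * t)) - D.π v.1 =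
        (t : ZMod (2 * t)) + (j : ZMod (2 * t)) by ring, half_t_add hj]
  · rw [if_neg h]
    split_ifs with h'
    · rcases zmod_two_cases (half (i - D.π v.1)) with h1 | h1
      · rw [h1, add_zero]
      · obtain ⟨j', hj', h2⟩ := exists_of_half_eq_one h1
        obtain rfl : i = D.π v.1 + (t : ZMod (2 * t)) + (j' : ZMod (2 * t)) := by linear_combination h2
        rw [map_add, map_add _ _ (j' : ZMod (2 * t)), add_right_inj, red_natCast,
          red_natCast] at h'
        rw [natCast_inj_of_lt (by omega) (by omega) h'] at h
        exact absurd rfl h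
    · rw [add_zero]

lemma toArc_ga (v : A × (ZMod t → ZMod 2)) :
    (D.toArc (D.action (ga ε) v)).1 = mapSub (aAut (2 * t)).1 (D.toArc v).1 := by
  rw [toArc_val, toArc_val, mapSub_aAut, action_ga]
  simp only [map_sub, D.π_α, map_add, map_one]
  congr 1
  ring

lemma toArc_gb (v : A × (ZMod t → ZMod 2)) :
    (D.toArc (D.action (gb ε) v)).1 = mapSub (bAut (2 * t) t).1 (D.toArc v).1 := by
  have ht := hF.out
  have h2 : ((2 * t : ℕ) : ZMod (2 * t)) - t - 1 = t - 1 := by push_cast; ring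
  rw [toArc_val, toArc_val, mapSub_bAut, action_gb, h2]
  simp only [bFun, map_sub, map_neg, map_one, red_t, zero_sub]
  congr 1
  rw [Nat.cast_sub (by omega)]
  push_cast
  linear_combination t_add_t t

lemma toArc_action (g : ExtGroup t ε) (v : A × (ZMod t → ZMod 2)) :
    D.toArc (D.action g v) = quotAction (2 * t) t (toQuot t ε g) (D.toArc v) := by
  let S : Subgroup (ExtGroup t ε) :=
    { carrier := {g | ∀ v, D.toArc (D.action g v) =
        quotAction (2 * t) t (toQuot t ε g) (D.toArc v)}
      one_mem' := fun v => by rw [action_one, map_one, map_one]; rfl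
      mul_mem' := fun {g h} hg hh v => by
        rw [action_mul, hg, hh, map_mul, map_mul, RelIso.mul_apply]
      inv_mem' := fun {g} hg v => by
        rw [map_inv (toQuot t ε), map_inv (quotAction (2 * t) t)]
        refine ((quotAction (2 * t) t (toQuot t ε g)).injective ?_)
        rw [RelIso.apply_inv_self, ← hg, action_action_inv] }
  have hS : S = ⊤ := by
    refine eq_top_of_gen_mem ε fun s v => Subtype.ext ?_
    rw [toQuot_gen]
    cases s with
    | x i => exact (D.toArc_gx i v).trans (quotAction_of (s := t) (.x i) _).symm
    | z =>
      rw [toQuotGen, map_one]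
      exact congrArg Subtype.val (D.toArc_eq_iff_exists.2
        ⟨gz ε, Subgroup.mem_zpowers _, rfl⟩).symm
    | a => exact (D.toArc_ga v).trans (quotAction_of (s := t) .a _).symm
    | b => exact (D.toArc_gb v).trans (quotAction_of (s := t) .b _).symm
  have hg : g ∈ S := hS ▸ Subgroup.mem_top g
  exact hg v

/-- Such an element keeps levels and bits, hence the orientation, and `exists_of_bits_eq` applies;
faithfulness turns the result into an identity in `G`. -/
lemma mem_zpowers_of_toArc {g : ExtGroup t ε} (h : ∀ v, D.toArc (D.action g v) = D.toArc v) :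
    g ∈ Subgroup.zpowers (gz ε) := by
  simp only [toArc_eq_iff] at h
  have hup : ∀ u v, D.Up u v → D.Up (D.action g u) (D.action g v) := fun u v huv => by
    refine (D.map_up huv).resolve_right fun h' => ?_
    have h1 := D.π_of_up huv
    have h2 := D.π_of_up h'
    rw [(h u).1, (h v).1] at h2
    exact one_ne_neg_one (t := t) (by linear_combination -h1 - h2)
  obtain ⟨m, hm⟩ := D.exists_of_bits_eq hup (fun v => (h v).1) (fun v => (h v).2)
  rw [D.action_injective hm]
  exact Subgroup.npow_mem_zpowers _ _

include D in
lemma zpowers_eq_ker : Subgroup.zpowers (gz ε) = (toQuot t ε).ker := by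
  refine le_antisymm ?_ fun g hg => D.mem_zpowers_of_toArc fun v => ?_
  · rw [Subgroup.zpowers_le, MonoidHom.mem_ker, toQuot_gen]
    rfl
  · rw [toArc_action, MonoidHom.mem_ker.1 hg, map_one]
    rfl

include D in
-- The presented group `G_{2t,t}` is handled through `G_t^±`: a preimage of an element acting
-- trivially fixes all arcs, so it lies in `⟨z⟩`, which the projection kills.
lemma quotAction_injective : Function.Injective (quotAction (2 * t) t) := by
  rw [injective_iff_map_eq_one]
  intro k hk
  obtain ⟨g, rfl⟩ := toQuot_surjective t ε k
  rw [← MonoidHom.mem_ker, ← D.zpowers_eq_ker]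
  refine D.mem_zpowers_of_toArc fun v => ?_
  rw [toArc_action, hk]
  rfl

include D in
lemma nonempty_zpowers_equiv :
    Nonempty (Subgroup.zpowers (gz (t := t) ε) ≃* Multiplicative (ZMod 2)) := by
  have hne : gz (t := t) ε ≠ 1 := by
    intro h
    have h1 := D.action_gz base
    rw [h, action_one] at h1
    have h2 := congrArg Prod.fst h1
    rw [left_eq_add, ← map_zero D.τ] at h2
    exact absurd (D.τ_injective h2) (by decide)
  have hc : Nat.card (Subgroup.zpowers (gz (t := t) ε)) = 2 := by
    rw [Nat.card_zpowers]
    exact orderOf_eq_prime (by rw [pow_two]; exact gz_sq ε) hne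
  have : Fact (Nat.Prime 2) := ⟨Nat.prime_two⟩
  exact ⟨mulEquivOfPrimeCardEq hc (by simp)⟩

include D in
lemma isCentralCover :
    IsCentralCover (extAction t ε) (Subgroup.zpowers (gz ε)) (quotAction (2 * t) t) := by
  refine isCentralCover_of_covering D.extAction_injective D.quotAction_injective
    ((Subgroup.zpowers_le).2 (gz_mem_center ε)) (fun v => D.toArc (D.cosetIso v))
    (D.toArc_surjective.comp D.cosetIso.surjective) (fun u v => ?_)
    (fun u v h => D.toArc_adj (D.cosetIso.map_rel_iff.2 h)) (fun u w h => ?_)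
    (fun u v v' h h' he => D.cosetIso.injective
      (D.eq_of_toArc_eq (D.cosetIso.map_rel_iff.2 h) (D.cosetIso.map_rel_iff.2 h') he))
    (toQuot t ε) (toQuot_surjective t ε) D.zpowers_eq_ker
    (fun g v => by rw [cosetIso_action, toArc_action])
  · rw [toArc_eq_iff_exists]
    simp only [← cosetIso_action, EmbeddingLike.apply_eq_iff_eq]
  · obtain ⟨w, rfl⟩ := D.toArc_surjective w
    obtain ⟨v, hv, hv'⟩ := D.exists_adj_of_toArc_adj h
    obtain ⟨v, rfl⟩ := D.cosetIso.surjective v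
    exact ⟨v, D.cosetIso.map_rel_iff.1 hv, hv'⟩

end PhaseGroup

/-! ### Pairings of neighbours induced by automorphisms. -/

namespace PhaseGroup

variable {t : ℕ} {ε : Sgn} {A : Type} [AddCommGroup A] (D : PhaseGroup t ε A)
variable [hF : Fact (2 ≤ t)]

/-- The parity of the level of a vertex. -/
def parity (v : A × (ZMod t → ZMod 2)) : ZMod 2 :=
  ZMod.castHom (Dvd.intro t rfl) (ZMod 2) (D.π v.1)

lemma parity_of_adj {u v : A × (ZMod t → ZMod 2)} (h : D.graph.Adj u v) :
    D.parity v = D.parity u + 1 := by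
  rcases D.level_cases h with ⟨-, h⟩ | ⟨-, h⟩
  · rw [parity, h, map_add, map_one, parity]
  · rw [parity, h, map_sub, map_one, parity, CharTwo.sub_eq_add]

/-- The difference between the parities of `φ v` and `v` does not change along edges, so it is
constant. -/
lemma parity_map_iff (φ : D.graph ≃g D.graph) {u v : A × (ZMod t → ZMod 2)} :
    D.parity (φ u) = D.parity (φ v) ↔ D.parity u = D.parity v := by
  have h := D.eq_of_forall_up (fun v => D.parity (φ v) - D.parity v) (fun u v h => by
    have h := D.adj_iff.2 (Or.inl h)
    simp only [D.parity_of_adj h, D.parity_of_adj (φ.map_rel_iff.2 h), add_sub_add_right_eq_sub])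
    u v
  constructor <;> intro h'
  · linear_combination h' - h
  · linear_combination h' + h

/-- Vertices of the same parity which are equal or have no common neighbour. -/
def Alike (w x : A × (ZMod t → ZMod 2)) : Prop :=
  D.parity w = D.parity x ∧ (w = x ∨ ∀ y ∈ D.nbrs w, y ∉ D.nbrs x)

lemma Alike.symm {D : PhaseGroup t ε A} {w x : A × (ZMod t → ZMod 2)} (h : D.Alike w x) :
    D.Alike x w :=
  ⟨h.1.symm, h.2.imp Eq.symm fun h y hx hw => h y hw hx⟩

lemma Alike.map {D : PhaseGroup t ε A} {w x : A × (ZMod t → ZMod 2)} (h : D.Alike w x)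
    (φ : D.graph ≃g D.graph) : D.Alike (φ w) (φ x) := by
  refine ⟨(D.parity_map_iff φ).2 h.1, h.2.imp (congrArg φ) fun h y hw hx => ?_⟩
  obtain ⟨y, rfl⟩ := φ.surjective y
  rw [mem_nbrs, φ.map_adj_iff, ← mem_nbrs] at hw hx
  exact h y hw hx

/-- The neighbours of a vertex, indexed by their side and a bit. -/
def nbr (v : A × (ZMod t → ZMod 2)) (i : ZMod 2 × ZMod 2) : A × (ZMod t → ZMod 2) :=
  if i.1 = 0 then D.up i.2 v else D.dn i.2 v

lemma adj_iff_exists_nbr {v w : A × (ZMod t → ZMod 2)} :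
    D.graph.Adj v w ↔ ∃ i, w = D.nbr v i := by
  rw [← mem_nbrs]
  simp only [nbrs, List.mem_cons, List.not_mem_nil, or_false]
  constructor
  · rintro (rfl | rfl | rfl | rfl)
    exacts [⟨(0, 0), rfl⟩, ⟨(0, 1), rfl⟩, ⟨(1, 0), rfl⟩, ⟨(1, 1), rfl⟩]
  · rintro ⟨⟨a, b⟩, rfl⟩
    rcases zmod_two_cases a with rfl | rfl <;> rcases zmod_two_cases b with rfl | rfl <;>
      simp [nbr]

lemma side_nbr_iff (v : A × (ZMod t → ZMod 2)) (i j : ZMod 2 × ZMod 2) :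
    D.Side v (D.nbr v i) (D.nbr v j) ↔ i.1 = j.1 := by
  have h1 := fun c => D.up_up c v
  have h2 := fun c => D.up_dn c v
  have h3 := fun c => D.not_up_of_up (h1 c)
  have h4 := fun c => D.not_up_of_up (h2 c)
  obtain ⟨a, b⟩ := i
  obtain ⟨c, d⟩ := j
  rcases zmod_two_cases a with rfl | rfl <;> rcases zmod_two_cases c with rfl | rfl <;>
    simp [Side, nbr, h1, h2, h3, h4]

lemma nbr_injective (v : A × (ZMod t → ZMod 2)) : Function.Injective (D.nbr v) := by
  have h1 := D.up_zero_ne_up_one v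
  have h2 := D.dn_zero_ne_dn_one v
  have h3 := fun c d => D.up_ne_dn c d v
  rintro ⟨a, b⟩ ⟨c, d⟩ h
  rcases zmod_two_cases a with rfl | rfl <;> rcases zmod_two_cases b with rfl | rfl <;>
  rcases zmod_two_cases c with rfl | rfl <;> rcases zmod_two_cases d with rfl | rfl <;>
  first
    | rfl
    | exact absurd h h1
    | exact absurd h.symm h1
    | exact absurd h h2
    | exact absurd h.symm h2
    | exact absurd h (h3 _ _)
    | exact absurd h.symm (h3 _ _)

/-- The pairing of the neighbours of `v` induced by `φ` from the sides at `φ v`. -/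
def IsPairing (φ : D.graph ≃g D.graph) (v : A × (ZMod t → ZMod 2)) (c : ZMod 2 × ZMod 2) : Prop :=
  ∀ i j, D.Side (φ v) (φ (D.nbr v i)) (φ (D.nbr v j)) ↔ j = i ∨ j = i + c

/-- The sides at `φ v` pull back to a partition of the four neighbours of `v` into two pairs.
Indexing the neighbours by `ZMod 2 × ZMod 2`, each of the three such partitions consists of the
cosets of `{0, c}` for one nonzero `c`. -/
lemma exists_isPairing (φ : D.graph ≃g D.graph) (v : A × (ZMod t → ZMod 2)) :
    ∃ c : {c : ZMod 2 × ZMod 2 // c ≠ 0}, D.IsPairing φ v c := by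
  have h : ∀ i, ∃ j, φ (D.nbr v i) = D.nbr (φ v) j := fun i =>
    D.adj_iff_exists_nbr.1 (φ.map_rel_iff.2 (D.adj_iff_exists_nbr.2 ⟨i, rfl⟩))
  choose σ hσ using h
  have hi : Function.Injective σ := fun i j h => D.nbr_injective v (φ.injective (by
    rw [hσ, hσ, h]))
  have key : ∀ σ : Equiv.Perm (ZMod 2 × ZMod 2), ∃ c : {c : ZMod 2 × ZMod 2 // c ≠ 0},
      ∀ i j, (σ i).1 = (σ j).1 ↔ j = i ∨ j = i + c.1 := by
    decide +kernel
  obtain ⟨c, hc⟩ := key (Equiv.ofBijective σ (Finite.injective_iff_bijective.1 hi))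
  refine ⟨c, fun i j => ?_⟩
  rw [hσ, hσ, side_nbr_iff]
  exact hc i j

/-- A pairing is determined by the partner of the neighbour with index 0. -/
lemma IsPairing.eq {D : PhaseGroup t ε A} {φ : D.graph ≃g D.graph} {v : A × (ZMod t → ZMod 2)}
    {c c' : ZMod 2 × ZMod 2} (h : D.IsPairing φ v c) (hc' : c' ≠ 0)
    (h' : D.Side (φ v) (φ (D.nbr v 0)) (φ (D.nbr v c'))) : c' = c := by
  have := ((h _ _).1 h').resolve_left hc'
  rwa [zero_add] at this

end PhaseGroup

section Decidability

variable {t : ℕ} {ε : Sgn} {A : Type} [AddCommGroup A] [DecidableEq A] (D : PhaseGroup t ε A)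
variable [hF : Fact (2 ≤ t)]

instance decidableUp : DecidableRel D.Up := fun _ _ => decidable_of_iff _ D.up_iff_eq_up.symm

instance decidableAlike : DecidableRel D.Alike := fun w x =>
  inferInstanceAs (Decidable (D.parity w = D.parity x ∧ (w = x ∨ ∀ y ∈ D.nbrs w, y ∉ D.nbrs x)))

instance decidableSide (v w w' : A × (ZMod t → ZMod 2)) : Decidable (D.Side v w w') :=
  inferInstanceAs (Decidable ((D.Up v w ∧ D.Up v w') ∨ (D.Up w v ∧ D.Up w' v)))

end Decidability

/-! ### The exceptional graph `Γ_2^-` and the index 9. -/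

section ExceptionalGraph

open PhaseGroup

/-- The vertices of the model of `Γ_2^-`. -/
abbrev ExcVertex : Type := ZMod (2 * (2 * 2)) × (ZMod 2 → ZMod 2)

/-- A numbering of the vertices. -/
def excCode (v : ExcVertex) : ℕ := 4 * v.1.val + 2 * (v.2 0).val + (v.2 1).val

/-- The vertex with a given number. -/
def excVertex (n : ℕ) : ExcVertex := (((n / 4 : ℕ) : ZMod 8), ![((n / 2 : ℕ) : ZMod 2), (n : ZMod 2)])

/-- A collineation of order three. -/
def excFun₁ (v : ExcVertex) : ExcVertex :=
  excVertex ([0, 26, 25, 3, 29, 23, 4, 14, 17, 27, 8, 2, 12, 22, 21, 15, 16, 10, 9, 19, 13, 7, 20,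
    30, 1, 11, 24, 18, 28, 6, 5, 31].getD (excCode v) 0)

/-- Another collineation of order three. -/
def excFun₂ (v : ExcVertex) : ExcVertex :=
  excVertex ([0, 1, 17, 19, 29, 7, 4, 13, 27, 25, 9, 8, 15, 5, 22, 31, 3, 18, 2, 16, 30, 20, 23,
    14, 24, 10, 26, 11, 28, 6, 21, 12].getD (excCode v) 0)

/-- An automorphism from a map of order three preserving adjacency. -/
def autOfCube {V : Type*} {Γ : SimpleGraph V} (f : V → V) (h : ∀ v, f (f (f v)) = v)
    (ha : ∀ u v, Γ.Adj u v → Γ.Adj (f u) (f v)) : Γ ≃g Γ where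
  toFun := f
  invFun v := f (f v)
  left_inv := h
  right_inv := h
  map_rel_iff' := by
    intro u v
    refine ⟨fun huv => ?_, ha u v⟩
    have h1 := ha _ _ (ha _ _ huv)
    simpa only [Equiv.coe_fn_mk, h] using h1

set_option maxRecDepth 100000

lemma excFun₁_cube : ∀ v, excFun₁ (excFun₁ (excFun₁ v)) = v := by decide +kernel

lemma excFun₂_cube : ∀ v, excFun₂ (excFun₂ (excFun₂ v)) = v := by decide +kernel

lemma excFun₁_adj : ∀ u, ∀ v ∈ (minusPhase 2).nbrs u,
    excFun₁ v ∈ (minusPhase 2).nbrs (excFun₁ u) := by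
  decide +kernel

lemma excFun₂_adj : ∀ u, ∀ v ∈ (minusPhase 2).nbrs u,
    excFun₂ v ∈ (minusPhase 2).nbrs (excFun₂ u) := by
  decide +kernel

/-- The automorphisms of `Γ_2^-` given by the two collineations. -/
def excIso₁ : (minusPhase 2).graph ≃g (minusPhase 2).graph :=
  autOfCube excFun₁ excFun₁_cube fun u v h =>
    (minusPhase 2).mem_nbrs.1 (excFun₁_adj u v ((minusPhase 2).mem_nbrs.2 h))

/-- The automorphisms of `Γ_2^-` given by the two collineations. -/
def excIso₂ : (minusPhase 2).graph ≃g (minusPhase 2).graph :=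
  autOfCube excFun₂ excFun₂_cube fun u v h =>
    (minusPhase 2).mem_nbrs.1 (excFun₂_adj u v ((minusPhase 2).mem_nbrs.2 h))

/-- The nine products of powers of the two maps of order three realise every pair of pairings at the
base vertex and one of its neighbours. -/
lemma exists_exceptional_pairing : ∀ c d : {c : ZMod 2 × ZMod 2 // c ≠ 0}, ∃ i j : Fin 3,
    (minusPhase 2).Side (excFun₁^[i] (excFun₂^[j] base))
        (excFun₁^[i] (excFun₂^[j] ((minusPhase 2).nbr base 0)))
        (excFun₁^[i] (excFun₂^[j] ((minusPhase 2).nbr base c))) ∧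
      (minusPhase 2).Side (excFun₁^[i] (excFun₂^[j] ((minusPhase 2).up 0 base)))
        (excFun₁^[i] (excFun₂^[j] ((minusPhase 2).nbr ((minusPhase 2).up 0 base) 0)))
        (excFun₁^[i] (excFun₂^[j] ((minusPhase 2).nbr ((minusPhase 2).up 0 base) d))) := by
  decide +kernel

/-- Since `Γ_2^-` is 4-valent of girth 6, a vertex has 12 vertices at distance two among the 16 of
its parity, so it is alike to itself and three others. The finite check says that sides at different
vertices correspond under this relation, which automorphisms preserve. -/
lemma side_of_alike_base : ∀ w ∈ (minusPhase 2).nbrs base, ∀ w' ∈ (minusPhase 2).nbrs base,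
    (minusPhase 2).Side base w w' → ∀ v', ∀ x ∈ (minusPhase 2).nbrs v', (minusPhase 2).Alike w x →
      ∀ x' ∈ (minusPhase 2).nbrs v', (minusPhase 2).Alike w' x' → (minusPhase 2).Side v' x x' := by
  decide +kernel

-- It follows that the pairing at any vertex is governed by the pairing at the base vertex or at its
-- chosen upper neighbour, one for each parity.
set_option synthInstance.maxHeartbeats 400000 in
set_option synthInstance.maxSize 1000 in
lemma exists_alike : ∀ v, (∀ w ∈ (minusPhase 2).nbrs v, ∃ x ∈ (minusPhase 2).nbrs base,
      (minusPhase 2).Alike w x) ∨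
    ∀ w ∈ (minusPhase 2).nbrs v, ∃ x ∈ (minusPhase 2).nbrs ((minusPhase 2).up 0 base),
      (minusPhase 2).Alike w x := by
  decide +kernel

lemma side_of_alike {v v' w w' x x' : ExcVertex} (h : (minusPhase 2).Side v w w')
    (hx : (minusPhase 2).Alike w x) (hx' : (minusPhase 2).Alike w' x')
    (ha : (minusPhase 2).graph.Adj v' x) (ha' : (minusPhase 2).graph.Adj v' x') :
    (minusPhase 2).Side v' x x' := by
  obtain ⟨g, -, hg⟩ := (minusPhase 2).exists_oriented_to_base v
  have hs := (minusPhase 2).side_action g h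
  rw [hg] at hs
  have hm : ∀ {u y}, (minusPhase 2).graph.Adj u y →
      (minusPhase 2).action g y ∈ (minusPhase 2).nbrs ((minusPhase 2).action g u) := fun h =>
    (minusPhase 2).mem_nbrs.2 (((minusPhase 2).action g).map_rel_iff.2 h)
  have h1 := hm ((minusPhase 2).adj_iff.2 (h.imp And.left And.left))
  have h2 := hm ((minusPhase 2).adj_iff.2 (h.imp And.right And.right))
  rw [hg] at h1 h2
  have h3 := (minusPhase 2).side_action g⁻¹ (side_of_alike_base _ h1 _ h2 hs _ _ (hm ha)
    (hx.map _) _ (hm ha') (hx'.map _))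
  simpa only [action_inv_action] using h3

/-- The pair `w, w'` at `v` is moved to `b` along the relation `Alike`, compared there by means of
the common pairing, and moved back. -/
lemma side_of_isPairing {φ φ' : (minusPhase 2).graph ≃g (minusPhase 2).graph}
    {b v w w' : ExcVertex} {c : ZMod 2 × ZMod 2} (hc : (minusPhase 2).IsPairing φ b c)
    (hc' : (minusPhase 2).IsPairing φ' b c)
    (hb : ∀ w ∈ (minusPhase 2).nbrs v, ∃ x ∈ (minusPhase 2).nbrs b, (minusPhase 2).Alike w x)
    (h : (minusPhase 2).Side (φ v) (φ w) (φ w')) : (minusPhase 2).Side (φ' v) (φ' w) (φ' w') := by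
  have hw : (minusPhase 2).graph.Adj v w :=
    φ.map_rel_iff.1 ((minusPhase 2).adj_iff.2 (h.imp And.left And.left))
  have hw' : (minusPhase 2).graph.Adj v w' :=
    φ.map_rel_iff.1 ((minusPhase 2).adj_iff.2 (h.imp And.right And.right))
  obtain ⟨x, hx, hwx⟩ := hb w ((minusPhase 2).mem_nbrs.2 hw)
  obtain ⟨x', hx', hwx'⟩ := hb w' ((minusPhase 2).mem_nbrs.2 hw')
  rw [mem_nbrs] at hx hx'
  have h1 := side_of_alike h (hwx.map φ) (hwx'.map φ) (φ.map_rel_iff.2 hx) (φ.map_rel_iff.2 hx')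
  obtain ⟨i, rfl⟩ := (minusPhase 2).adj_iff_exists_nbr.1 hx
  obtain ⟨j, rfl⟩ := (minusPhase 2).adj_iff_exists_nbr.1 hx'
  exact side_of_alike ((hc' i j).2 ((hc i j).1 h1)) (hwx.symm.map φ') (hwx'.symm.map φ')
    (φ'.map_rel_iff.2 hw) (φ'.map_rel_iff.2 hw')

/-- The index of `G_2^-` in the automorphism group of the model. -/
lemma index_range_action_minus_two : (minusPhase 2).action.range.index = 9 := by
  choose c hc using (minusPhase 2).exists_isPairing
  -- The inverse makes `T` constant on the left cosets of `G`: replacing `φ` by `φ g` composes `φ⁻¹`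
  -- with `g⁻¹` on the left, and `G` respects sides. Conversely, if `T φ = T φ'`, then `φ⁻¹ φ'`
  -- respects all sides and lies in `G`, so `T` separates the cosets.
  let T : ((minusPhase 2).graph ≃g (minusPhase 2).graph) →
      {c : ZMod 2 × ZMod 2 // c ≠ 0} × {c : ZMod 2 × ZMod 2 // c ≠ 0} := fun φ =>
    (c φ⁻¹ base, c φ⁻¹ ((minusPhase 2).up 0 base))
  have hT : ∀ φ φ', T φ = T φ' ↔ φ⁻¹ * φ' ∈ (minusPhase 2).action.range := by
    intro φ φ'
    constructor
    · intro h
      have h1 := congrArg Prod.fst h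
      have h2 := congrArg Prod.snd h
      simp only [T] at h1 h2
      obtain ⟨g, hg⟩ := (minusPhase 2).exists_of_preserves_side (φ := φ⁻¹ * φ')
        fun v w w' hs => by
          have hs' : (minusPhase 2).Side (φ'⁻¹ (φ' v)) (φ'⁻¹ (φ' w)) (φ'⁻¹ (φ' w')) := by
            simpa only [RelIso.inv_apply_self] using hs
          change (minusPhase 2).Side (φ⁻¹ (φ' v)) (φ⁻¹ (φ' w)) (φ⁻¹ (φ' w'))
          rcases exists_alike (φ' v) with hb | hb
          · exact side_of_isPairing (h1 ▸ hc φ'⁻¹ base) (h1 ▸ hc φ⁻¹ base) hb hs'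
          · exact side_of_isPairing (h2 ▸ hc φ'⁻¹ ((minusPhase 2).up 0 base))
              (h2 ▸ hc φ⁻¹ ((minusPhase 2).up 0 base)) hb hs'
      exact ⟨g, hg.symm⟩
    · rintro ⟨g, hg⟩
      have h1 : ∀ v, φ'⁻¹ v = (minusPhase 2).action g⁻¹ (φ⁻¹ v) := fun v => by
        have : φ'⁻¹ = ((minusPhase 2).action g)⁻¹ * φ⁻¹ := by rw [hg]; group
        rw [this, map_inv]
        rfl
      have h2 : ∀ v, (c φ⁻¹ v) = c φ'⁻¹ v := fun v => by
        refine Subtype.ext ((hc φ'⁻¹ v).eq (c φ⁻¹ v).2 ?_)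
        rw [h1, h1, h1]
        refine (minusPhase 2).side_action _ ((hc φ⁻¹ v _ _).2 (Or.inr ?_))
        rw [zero_add]
      exact Prod.ext (h2 _) (h2 _)
  have hsurj : Function.Surjective T := by
    rintro ⟨d, d'⟩
    obtain ⟨i, j, h, h'⟩ := exists_exceptional_pairing d d'
    have hpow : ∀ v, ((excIso₁ ^ (i : ℕ) * excIso₂ ^ (j : ℕ))⁻¹)⁻¹ v =
        excFun₁^[i] (excFun₂^[j] v) := by
      intro v
      have h1 : ∀ (θ : (minusPhase 2).graph ≃g (minusPhase 2).graph) (n : ℕ) v,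
          (θ ^ n) v = θ^[n] v := by
        intro θ n
        induction n with
        | zero => exact fun v => rfl
        | succ n ih => exact fun v => by rw [pow_succ, Function.iterate_succ_apply, ← ih]; rfl
      rw [inv_inv]
      exact (h1 _ _ _).trans (congrArg _ (h1 _ _ _))
    refine ⟨(excIso₁ ^ (i : ℕ) * excIso₂ ^ (j : ℕ))⁻¹, Prod.ext (Subtype.ext ?_) (Subtype.ext ?_)⟩
    · refine ((hc _ base).eq d.2 ?_).symm
      rw [hpow, hpow, hpow]
      exact h
    · refine ((hc _ ((minusPhase 2).up 0 base)).eq d'.2 ?_).symm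
      rw [hpow, hpow, hpow]
      exact h'
  let f : ((minusPhase 2).graph ≃g (minusPhase 2).graph) ⧸ (minusPhase 2).action.range →
      {c : ZMod 2 × ZMod 2 // c ≠ 0} × {c : ZMod 2 × ZMod 2 // c ≠ 0} :=
    Quotient.lift T fun φ φ' h => (hT φ φ').2 (QuotientGroup.leftRel_apply.1 h)
  have hf : Function.Bijective f := by
    refine ⟨?_, fun x => ?_⟩
    · rintro ⟨φ⟩ ⟨φ'⟩ h
      exact Quotient.sound (QuotientGroup.leftRel_apply.2 ((hT φ φ').1 h))
    · obtain ⟨φ, rfl⟩ := hsurj x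
      exact ⟨QuotientGroup.mk φ, rfl⟩
  rw [Subgroup.index, Nat.card_congr (Equiv.ofBijective f hf), Nat.card_eq_fintype_card]
  decide

end ExceptionalGraph

/-! ### Transfer of the results on automorphisms to the coset graph. -/

namespace PhaseGroup

variable {t : ℕ} {ε : Sgn} {A : Type} [AddCommGroup A] (D : PhaseGroup t ε A)
variable [hF : Fact (2 ≤ t)]

/-- Automorphisms of the coset graph correspond to automorphisms of the model. -/
noncomputable def autEquiv : (ExtGraph t ε ≃g ExtGraph t ε) ≃* (D.graph ≃g D.graph) where
  toFun φ := (D.cosetIso.symm.trans φ).trans D.cosetIso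
  invFun φ := (D.cosetIso.trans φ).trans D.cosetIso.symm
  left_inv φ := RelIso.ext fun v => by simp
  right_inv φ := RelIso.ext fun v => by simp
  map_mul' φ ψ := RelIso.ext fun v => by simp

lemma autEquiv_extAction (g : ExtGroup t ε) : D.autEquiv (extAction t ε g) = D.action g := by
  refine RelIso.ext fun v => ?_
  obtain ⟨v, rfl⟩ := D.cosetIso.surjective v
  rw [← cosetIso_action]
  simp [autEquiv]

lemma index_range_extAction : (extAction t ε).range.index = D.action.range.index := by
  have h : D.action = D.autEquiv.toMonoidHom.comp (extAction t ε) :=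
    MonoidHom.ext fun g => (D.autEquiv_extAction g).symm
  rw [h, ← MonoidHom.map_range]
  exact (Subgroup.index_map_equiv _ D.autEquiv).symm

lemma extAction_bijective
    (h : ∀ (φ : D.graph ≃g D.graph) v w w', D.Side v w w' → D.Side (φ v) (φ w) (φ w')) :
    Function.Bijective (extAction t ε) := by
  refine ⟨D.extAction_injective, fun φ => ?_⟩
  obtain ⟨g, hg⟩ := D.exists_of_preserves_side (h (D.autEquiv φ))
  exact ⟨g, D.autEquiv.injective (by rw [autEquiv_extAction, hg])⟩

include D in
lemma card_eq_two_mul_logb (v : RightCosets (ExtH t ε)) :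
    (Nat.card (RightCosets (ExtH t ε)) : ℝ) =
      2 * (Nat.card (vertexStabilizer (extAction t ε) v) : ℝ) *
        Real.logb 2 ((Nat.card (vertexStabilizer (extAction t ε) v) : ℝ) / 2) := by
  rw [D.card_vertexStabilizer, D.card_rightCosets]
  have : ((2 ^ (t + 1) : ℕ) : ℝ) / 2 = 2 ^ (t : ℝ) := by
    rw [Real.rpow_natCast]
    push_cast
    ring
  rw [this, Real.logb_rpow (by norm_num) (by norm_num)]
  push_cast
  ring

end PhaseGroup

end ArcTransitive

theorem mainTheorem1 (t : ℕ) (ht : 2 ≤ t) (ε : ArcTransitive.Sgn) :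
    -- `G` is a group of automorphisms of `Γ`, i.e. it acts faithfully
    Function.Injective (ArcTransitive.extAction t ε) ∧
    -- (i)
    (Nat.card (ArcTransitive.RightCosets (ArcTransitive.ExtH t ε)) = t * 2 ^ (t + 2) ∧
      (∀ v, Nat.card (ArcTransitive.vertexStabilizer (ArcTransitive.extAction t ε) v)
        = 2 ^ (t + 1)) ∧
      (∀ v, (Nat.card (ArcTransitive.RightCosets (ArcTransitive.ExtH t ε)) : ℝ) =
        2 * (Nat.card (ArcTransitive.vertexStabilizer (ArcTransitive.extAction t ε) v) : ℝ) *
          Real.logb 2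
            ((Nat.card (ArcTransitive.vertexStabilizer (ArcTransitive.extAction t ε) v) : ℝ)
              / 2))) ∧
    -- (ii)
    (∃ N : Subgroup (ArcTransitive.ExtGroup t ε), N = Subgroup.zpowers (ArcTransitive.gen ε .z) ∧
      Nonempty (N ≃* Multiplicative (ZMod 2)) ∧
      ArcTransitive.IsCentralCover (ArcTransitive.extAction t ε) N
        (ArcTransitive.quotAction (2 * t) t)) ∧
    -- (iii)
    ArcTransitive.IsLocallyD4 (ArcTransitive.extAction t ε) ∧
    -- (iv)
    ((t = 2 → ε = .plus → (ArcTransitive.ExtGraph t ε).girth = 4) ∧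
      (t = 2 → ε = .minus → (ArcTransitive.ExtGraph t ε).girth = 6) ∧
      (t = 3 → ε = .plus → (ArcTransitive.ExtGraph t ε).girth = 6) ∧
      (t = 3 → ε = .minus → (ArcTransitive.ExtGraph t ε).girth = 8) ∧
      (4 ≤ t → (ArcTransitive.ExtGraph t ε).girth = 8)) ∧
    -- (v)
    ((¬ (t = 2 ∧ ε = .minus) → Function.Bijective (ArcTransitive.extAction t ε)) ∧
      (t = 2 ∧ ε = .minus → (ArcTransitive.extAction t ε).range.index = 9)) := by
  have : Fact (2 ≤ t) := ⟨ht⟩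
  open ArcTransitive in
  cases ε with
  | plus =>
    have hside := plusPhase_preserves_side (t := t)
    have hgirth : (ExtGraph t .plus).girth = (plusPhase t).graph.girth :=
      (plusPhase t).cosetIso.girth_eq
    refine ⟨(plusPhase t).extAction_injective, ⟨(plusPhase t).card_rightCosets,
      (plusPhase t).card_vertexStabilizer, (plusPhase t).card_eq_two_mul_logb⟩,
      ⟨_, rfl, (plusPhase t).nonempty_zpowers_equiv, (plusPhase t).isCentralCover⟩,
      (plusPhase t).isLocallyD4, ⟨?_, nofun, ?_, nofun, ?_⟩,
      fun _ => (plusPhase t).extAction_bijective hside, nofun⟩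
    · rintro rfl -
      exact hgirth.trans girth_plus_two
    · rintro rfl -
      exact hgirth.trans girth_plus_three
    · exact fun h => hgirth.trans ((plusPhase t).girth_eq_eight h)
  | minus =>
    have hgirth : (ExtGraph t .minus).girth = (minusPhase t).graph.girth :=
      (minusPhase t).cosetIso.girth_eq
    refine ⟨(minusPhase t).extAction_injective, ⟨(minusPhase t).card_rightCosets,
      (minusPhase t).card_vertexStabilizer, (minusPhase t).card_eq_two_mul_logb⟩,
      ⟨_, rfl, (minusPhase t).nonempty_zpowers_equiv, (minusPhase t).isCentralCover⟩,
      (minusPhase t).isLocallyD4, ⟨nofun, ?_, nofun, ?_, ?_⟩, fun h =>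
      (minusPhase t).extAction_bijective (minusPhase_preserves_side (by
        have : t ≠ 2 := fun h' => h ⟨h', rfl⟩
        omega)), ?_⟩
    · rintro rfl -
      exact hgirth.trans girth_minus_two
    · rintro rfl -
      exact hgirth.trans girth_minus_three
    · exact fun h => hgirth.trans ((minusPhase t).girth_eq_eight h)
    · rintro ⟨rfl, -⟩
      exact (minusPhase 2).index_range_extAction.trans index_range_action_minus_two
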